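/- **Setting.** Let $F=\mathbb R^n$ with its Euclidean scalar product $\langle\cdot,\cdot\rangle$ and let $L\subset F$ be an even lattice: a discrete subgroup spanning $F$ with $\langle\alpha,\alpha\rangle\in2\mathbb N$ for $\alpha\in L$. A proper interval is a non-empty open arc $I\subset\mathbb S^1$ whose complement has non-empty interior. *Current algebra.* For a smooth loop $f:\mathbb S^1\to F$ with Fourier coefficients $\hat f_k\in F_{\mathbb C}$ put $\|f\|^2=\sum_{k\ge1}k\|\hat f_k\|^2$. The one-particle space $\mathcal H_{0,F}$ is the completion of (smooth loops)/(constants) with the complex structure $\hat f_k\mapsto-\mathrm i\,\mathrm{sign}(k)\hat f_k$; the class of $f$ is $[f]$. On the symmetric Fock space $\mathcal H_F=\mathrm e^{\mathcal H_{0,F}}$ with coherent vectors $\mathrm e^h$, $(\mathrm e^f,\mathrm e^h)=\mathrm e^{(f,h)}$, the Weyl operators are the unitaries with $W(f)\mathrm e^h=\mathrm e^{-\|f\|^2/2-(f,h)}\mathrm e^{f+h}$. For a proper interval $I$ let $H_F(I)$ be the closure of $\{[f]: f=0 \text{ off } I\}$ and $\mathcal A_F(I)=\{W(h):h\in H_F(I)\}''$.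 *Lattice net.* Loops in the torus $F/2\pi L$ are written $\mathrm e^{\mathrm if}$ with $f:\mathbb R\to F$ smooth, $f(\theta+2\pi)=f(\theta)+2\pi\Delta_f$, $\Delta_f\in L$ the winding number; $\mathrm e^{\mathrm if}$ is supported in $I$ if $f(\theta)\in2\pi L$ for $\mathrm e^{\mathrm i\theta}\notin I$. Write $f(\theta)=\Delta_f\theta+f_0+f_1(\theta)$ with $f_1$ periodic of mean zero. Fix a bimultiplicative $\varepsilon:L\times L\to\{\pm1\}$ with $\varepsilon(\alpha,\alpha)=(-1)^{\langle\alpha,\alpha\rangle/2}$ and put $\eta(\alpha,\beta)=\varepsilon(\alpha,\beta)\mathrm e^{\mathrm i\pi\langle\alpha,\beta\rangle/2}$. On $\mathcal H_L=\ell^2(L,\mathcal H_F)$ the vacuum representation of the loop group is, up to phases, $$(\pi(\mathrm e^{\mathrm if})\xi)_\beta=\mathrm e^{-\mathrm i\langle f_0,\beta\rangle}\,\eta(-\beta,\Delta_f)\,W([f_1])\,\xi_{\beta-\Delta_f}.$$ Let $\mathcal A_L(I)$ be the von Neumann algebra generated by the $\pi(\mathrm e^{\mathrm if})$ with $\mathrm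 e^{\mathrm if}$ supported in $I$, and $\mathcal A_L^0(I)$ the one generated by those with in addition $\Delta_f=0$. *Crossed product.* Let $\beta:L\to\mathrm{Aut}(\mathcal M)$ be an action on a von Neumann algebra $\mathcal M\subset\mathrm B(\mathcal K)$ and $\sigma:L\times L\to\mathbb T$ a 2-cocycle. Then $\mathcal M\rtimes_{\beta,\sigma}L$ is the von Neumann algebra on $\ell^2(L,\mathcal K)$ generated by the operators $(\pi_\beta(x)\xi)(\gamma)=\beta_{-\gamma}(x)\xi(\gamma)$, $x\in\mathcal M$, and $(\lambda_\sigma(\alpha)\xi)(\gamma)=\sigma(\alpha,\gamma-\alpha)\xi(\gamma-\alpha)$, $\alpha\in L$. For $\sigma=1$ it is the ordinary crossed product. **Proposition.** Let $I$ be a proper interval. 1. There is a $*$-isomorphism $\Phi:\mathcal A_F(I)\to\mathcal A_L^0(I)$ whose inverse is restriction to the charge-zero subspace: $\Phi(x)$ acts on the copy of $\mathcal H_F$ in $\mathcal H_L$ with index $0\in L$ as $x$. 2. There are smooth $M:\mathbb R\to\mathbb R$ with $M(\theta+2\pi)=M(\theta)+2\pi$ and $M(\theta)\in2\pi\mathbb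 Z$ for $\mathrm e^{\mathrm i\theta}\notin I$. For every such $M$, with $m=M'$, there is an action $\beta$ of $L$ on $\mathcal A_F(I)$ by $*$-automorphisms such that: * $\Phi(\beta_\alpha(x))=\pi(\mathrm e^{\mathrm iM\alpha})\,\Phi(x)\,\pi(\mathrm e^{\mathrm iM\alpha})^*$ for all $\alpha\in L$, $x\in\mathcal A_F(I)$; here $\mathrm e^{\mathrm iM\alpha}$ is supported in $I$ and has winding number $\alpha$; * if the smooth loop $f$ is equal to a constant $c\in F$ off $I$, then $W([f])\in\mathcal A_F(I)$ and for all $\alpha\in L$ $$\beta_\alpha(W([f]))=\exp\Big(\mathrm i\int_0^{2\pi}\langle f(\theta)-c,\,m(\theta)\alpha\rangle\frac{\mathrm d\theta}{2\pi}\Big)W([f]);$$ * $\beta$ is free (for $\alpha\ne0$ and $a\in\mathcal A_F(I)$: if $ax=\beta_\alpha(x)a$ for all $x\in\mathcal A_F(I)$, then $a=0$) and faithful ($\beta_\alpha=\mathrm{id}$ only for $\alpha=0$); * for every $\mathbb Z$-basis $(\alpha_i)$ of $L$, $\mathcal A_L(I)$ is generated as a von Neumann algebra by $\Phi(\mathcal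 A_F(I))$ and the unitaries $\pi(\mathrm e^{\mathrm iM\alpha_i})$; * $\mathcal A_L(I)$ is the crossed product of $\mathcal A_F(I)$ with $L$ by $\beta$, with the cocycle class given by $\varepsilon$: for every 2-cocycle $\sigma:L\times L\to\mathbb T$ with $\sigma(\alpha,\gamma)=(-1)^{\langle\alpha,\gamma\rangle}\sigma(\gamma,\alpha)$ for all $\alpha,\gamma$ (for example $\sigma=\varepsilon$, or $\sigma=1$ if all $\langle\alpha,\gamma\rangle$ are even) there are phases $h(\alpha)\in\mathbb T$ and a unitary $V:\mathcal H_L\to\ell^2(L,\mathcal H_F)$ with $$V\mathcal A_L(I)V^*=\mathcal A_F(I)\rtimes_{\beta,\sigma}L,\qquad V\Phi(x)V^*=\pi_\beta(x),\qquad V\,h(\alpha)\pi(\mathrm e^{\mathrm iM\alpha})\,V^*=\lambda_\sigma(\alpha)$$ for all $x\in\mathcal A_F(I)$ and $\alpha\in L$. -/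

import Mathlib

open scoped ComplexConjugate ComplexOrder

noncomputable section

set_option linter.unusedSectionVars false

namespace LatticeNet

/-! ### Von Neumann algebras generated by sets -/

section VN

variable {K : Type*} [NormedAddCommGroup K] [InnerProductSpace ℂ K] [CompleteSpace K]

/-- The von Neumann algebra generated by a set `S` of bounded operators, i.e. the double commutant
of `S ∪ S*`. -/
def vnGen (S : Set (K →L[ℂ] K)) : VonNeumannAlgebra K where
  toStarSubalgebra :=
    StarSubalgebra.centralizer ℂ (StarSubalgebra.centralizer ℂ S : Set (K →L[ℂ] K))
  centralizer_centralizer' := by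
    change Set.centralizer (Set.centralizer
      ((StarSubalgebra.centralizer ℂ (StarSubalgebra.centralizer ℂ S : Set (K →L[ℂ] K)) :
        StarSubalgebra ℂ (K →L[ℂ] K)) : Set (K →L[ℂ] K))) =
      ((StarSubalgebra.centralizer ℂ (StarSubalgebra.centralizer ℂ S : Set (K →L[ℂ] K)) :
        StarSubalgebra ℂ (K →L[ℂ] K)) : Set (K →L[ℂ] K))
    rw [StarSubalgebra.coe_centralizer_centralizer, Set.centralizer_centralizer_centralizer]

/-- The *-algebra underlying a von Neumann algebra, as a type. -/
abbrev Alg (A : VonNeumannAlgebra K) : Type _ := A.toStarSubalgebra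

theorem subset_vnGen (S : Set (K →L[ℂ] K)) {x : K →L[ℂ] K} (hx : x ∈ S) :
    x ∈ (vnGen S).toStarSubalgebra := by
  change x ∈ ((StarSubalgebra.centralizer ℂ
    (StarSubalgebra.centralizer ℂ S : Set (K →L[ℂ] K)) : StarSubalgebra ℂ (K →L[ℂ] K)) :
      Set (K →L[ℂ] K))
  rw [StarSubalgebra.coe_centralizer_centralizer]
  exact Set.subset_centralizer_centralizer (Or.inl hx)

instance isClosed_alg (A : VonNeumannAlgebra K) :
    IsClosed (A.toStarSubalgebra : Set (K →L[ℂ] K)) := by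
  have h := A.centralizer_centralizer'
  change IsClosed A.carrier
  rw [← h]
  exact Set.isClosed_centralizer _

/-- A *-automorphism of a von Neumann algebra is isometric. -/
theorem norm_aut {A : VonNeumannAlgebra K} (φ : Alg A ≃⋆ₐ[ℂ] Alg A) (x : Alg A) :
    ‖((φ x : Alg A) : K →L[ℂ] K)‖ = ‖(x : K →L[ℂ] K)‖ :=
  StarAlgEquiv.norm_map φ x

/-- An action `β` of a group (written additively) on a von Neumann algebra is *free* if every
`β g` with `g ≠ 0` acts freely: `a x = β g (x) a` for all `x` forces `a = 0`. -/
def IsFreeAction {G : Type*} [AddGroup G] {A : VonNeumannAlgebra K}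
    (β : Multiplicative G →* (Alg A ≃⋆ₐ[ℂ] Alg A)) : Prop :=
  ∀ g : G, g ≠ 0 → ∀ a : Alg A, (∀ x : Alg A, a * x = β (.ofAdd g) x * a) → a = 0

end VN

/-! ### Crossed products by discrete groups -/

section Crossed

variable (G : Type*) [AddCommGroup G]
variable (K : Type*) [NormedAddCommGroup K] [InnerProductSpace ℂ K] [CompleteSpace K]

/-- The Hilbert space `ℓ²(G, K) = ⨁_{g ∈ G} K`. -/
abbrev Ell2 : Type _ := lp (fun _ : G => K) 2

variable {G K}

/-- The shift `(Γ_a ξ) g = ξ (g - a)`. -/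
def shift (a : G) : Ell2 G K →L[ℂ] Ell2 G K :=
  LinearMap.mkContinuous
    { toFun := fun ξ => ⟨fun g => ξ (g - a), by
        refine memℓp_gen ?_
        have h := (lp.memℓp ξ).summable (by norm_num)
        exact ((Equiv.subRight a).summable_iff (f := fun g => ‖ξ g‖ ^ (2 : ENNReal).toReal)).2 h⟩
      map_add' := fun ξ η => rfl
      map_smul' := fun c ξ => rfl }
    1 (fun ξ => by
      rw [one_mul, lp.norm_eq_tsum_rpow (by norm_num), lp.norm_eq_tsum_rpow (by norm_num)]
      exact le_of_eq (congrArg (fun t : ℝ => t ^ (1 / (2 : ENNReal).toReal))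
        ((Equiv.subRight a).tsum_eq (fun g => ‖ξ g‖ ^ (2 : ENNReal).toReal))))

@[simp] theorem shift_apply (a : G) (ξ : Ell2 G K) (g : G) : shift a ξ g = ξ (g - a) := rfl

/-- The diagonal operator `(T ξ) g = T_g (ξ g)` of a uniformly bounded family of operators. -/
def diag (T : G → K →L[ℂ] K) (C : ℝ) (hT : ∀ g, ‖T g‖ ≤ C) : Ell2 G K →L[ℂ] Ell2 G K :=
  lp.mapCLM 2 T (le_trans (norm_nonneg _) (hT 0)) hT

@[simp] theorem diag_apply (T : G → K →L[ℂ] K) (C : ℝ) (hT : ∀ g, ‖T g‖ ≤ C) (ξ : Ell2 G K)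
    (g : G) : diag T C hT ξ g = T g (ξ g) := rfl

/-- A circle-valued 2-cocycle on an abelian group (with trivial action). -/
def IsTwoCocycle (σ : G → G → Circle) : Prop :=
  ∀ a b c, σ b c * σ a (b + c) = σ a b * σ (a + b) c

variable {A : VonNeumannAlgebra K}

/-- The representation `(π_β(x) ξ) g = β_{-g}(x) ξ(g)` of `A` on `ℓ²(G, K)`. -/
def crossedRep (β : Multiplicative G →* (Alg A ≃⋆ₐ[ℂ] Alg A)) (x : Alg A) :
    Ell2 G K →L[ℂ] Ell2 G K :=
  diag (fun g => (β (.ofAdd (-g)) x : Alg A)) ‖(x : K →L[ℂ] K)‖ fun _ => (norm_aut _ x).le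

/-- The `σ`-twisted left translations `(λ_σ(a) ξ) g = σ(a, g - a) ξ(g - a)`. If `σ` is a 2-cocycle
these unitaries satisfy `λ_σ(a) λ_σ(b) = σ(a, b) λ_σ(a + b)`. -/
def twistedTranslation (σ : G → G → Circle) (a : G) : Ell2 G K →L[ℂ] Ell2 G K :=
  diag (fun g => (σ a (g - a) : ℂ) • ContinuousLinearMap.id ℂ K) 1
    (fun g => by
      rw [norm_smul, Circle.norm_coe, one_mul]; exact ContinuousLinearMap.norm_id_le) ∘L shift a

/-- The (cocycle) crossed product `A ⋊_{β,σ} G` as a von Neumann algebra on `ℓ²(G, K)`: it is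
generated by `π_β(A)` and the twisted translations. For `σ = 1` it is the ordinary crossed
product `A ⋊_β G`. -/
def crossedProduct (β : Multiplicative G →* (Alg A ≃⋆ₐ[ℂ] Alg A)) (σ : G → G → Circle) :
    VonNeumannAlgebra (Ell2 G K) :=
  vnGen (Set.range (crossedRep β) ∪ Set.range (twistedTranslation σ))

theorem twistedTranslation_mul (σ : G → G → Circle) (hσ : IsTwoCocycle σ) (a b : G) :
    (twistedTranslation σ a * twistedTranslation σ b : Ell2 G K →L[ℂ] Ell2 G K)
      = (σ a b : ℂ) • twistedTranslation σ (a + b) := by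
  ext ξ g
  have h := hσ a b (g - (a + b))
  have e1 : g - a - b = g - (a + b) := by abel
  have e2 : b + (g - (a + b)) = g - a := by abel
  rw [e2] at h
  have h' : (σ a (g - a) : ℂ) * σ b (g - (a + b)) = σ a b * σ (a + b) (g - (a + b)) := by
    rw [mul_comm]; exact_mod_cast congrArg (Circle.coeHom) h
  simp only [twistedTranslation, mul_apply_eq_comp, ContinuousLinearMap.comp_apply,
    diag_apply, shift_apply, smul_apply, ContinuousLinearMap.id_apply,
    lp.coeFn_smul, Pi.smul_apply, smul_smul, e1, h']

theorem twistedTranslation_mul_crossedRep (β : Multiplicative G →* (Alg A ≃⋆ₐ[ℂ] Alg A))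
    (σ : G → G → Circle) (a : G) (x : Alg A) :
    twistedTranslation σ a * crossedRep β x
      = crossedRep β (β (.ofAdd a) x) * twistedTranslation σ a := by
  ext ξ g
  have h : β (.ofAdd (-(g - a))) x = β (.ofAdd (-g)) (β (.ofAdd a) x) := by
    rw [← StarAlgEquiv.mul_apply, ← map_mul, ← ofAdd_add]; congr 3; abel
  simp only [twistedTranslation, crossedRep, mul_apply_eq_comp,
    ContinuousLinearMap.comp_apply, diag_apply, shift_apply, smul_apply,
    ContinuousLinearMap.id_apply, map_smul, h]

end Crossed

/-! ### The symmetric Fock space and Weyl operators -/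

section Fock

variable (E : Type*) [NormedAddCommGroup E] [InnerProductSpace ℂ E]

/-- Finite formal combinations of the coherent vectors `e^h`, `h ∈ E`. -/
def FockPre : Type _ := E →₀ ℂ

instance : AddCommGroup (FockPre E) := inferInstanceAs (AddCommGroup (E →₀ ℂ))
instance : Module ℂ (FockPre E) := inferInstanceAs (Module ℂ (E →₀ ℂ))

variable {E}

/-- The sesquilinear form with `(e^f, e^h) = e^{(f, h)}`. -/
def fockInner (x y : E →₀ ℂ) : ℂ :=
  x.sum fun f a => y.sum fun h b => conj a * Complex.exp (inner ℂ f h) * b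

theorem posSemidef_gram' {V : Type*} [NormedAddCommGroup V] [InnerProductSpace ℂ V] (v : E → V) :
    (Matrix.of fun f h : E => inner ℂ (v f) (v h)).PosSemidef := by
  refine ⟨Matrix.ext fun _ _ => inner_conj_symm _ _, fun x => ?_⟩
  have e : (x.sum fun f a => x.sum fun h b =>
      star a * (Matrix.of fun f h : E => inner ℂ (v f) (v h)) f h * b) =
      inner ℂ (x.sum fun f a => a • v f) (x.sum fun f a => a • v f) := by
    unfold Finsupp.sum
    rw [sum_inner]
    refine Finset.sum_congr rfl fun f _ => ?_
    rw [inner_sum]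
    refine Finset.sum_congr rfl fun h _ => ?_
    rw [inner_smul_left, inner_smul_right]
    simp only [Matrix.of_apply, RCLike.star_def]
    ring
  rw [e]
  rw [inner_self_eq_norm_sq_to_K]
  norm_cast
  exact Complex.zero_le_real.2 (sq_nonneg _)

theorem posSemidef_gramPow (k : ℕ) :
    (Matrix.of fun f h : E => (inner ℂ f h) ^ k).PosSemidef := by
  induction k with
  | zero =>
    have h := posSemidef_gram' (E := E) (fun _ => (1 : ℂ))
    have e : (Matrix.of fun f h : E => (inner ℂ f h) ^ 0) =
        Matrix.of fun _ _ : E => inner ℂ (1 : ℂ) (1 : ℂ) := by ext; simp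
    rw [e]; exact h
  | succ k ih =>
    have h := ih.hadamard (posSemidef_gram' (E := E) fun f => f)
    have e : (Matrix.of fun f h : E => (inner ℂ f h) ^ (k + 1)) =
        (Matrix.of fun f h : E => (inner ℂ f h) ^ k).hadamard
          (Matrix.of fun f h : E => inner ℂ f h) := by ext; simp [pow_succ]
    rw [e]; exact h

theorem fockInner_self_nonneg (x : E →₀ ℂ) : 0 ≤ (fockInner x x).re := by
  have hs : HasSum (fun k : ℕ => x.sum fun f a => x.sum fun h b =>
      conj a * ((k.factorial : ℂ)⁻¹ * (inner ℂ f h) ^ k) * b) (fockInner x x) := by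
    unfold fockInner Finsupp.sum
    refine hasSum_sum fun f _ => hasSum_sum fun h _ => ?_
    refine HasSum.mul_right _ (HasSum.mul_left _ ?_)
    have := NormedSpace.expSeries_div_hasSum_exp (𝔸 := ℂ) (inner ℂ f h)
    rw [← Complex.exp_eq_exp_ℂ] at this
    simpa [div_eq_inv_mul] using this
  refine (Complex.hasSum_re hs).nonneg fun k => ?_
  have h := (posSemidef_gramPow (E := E) k).2 x
  have e : (x.sum fun f a => x.sum fun h b =>
      conj a * ((k.factorial : ℂ)⁻¹ * (inner ℂ f h) ^ k) * b) = ((k.factorial : ℝ)⁻¹ : ℝ) *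
      (x.sum fun f a => x.sum fun h b => star a * (Matrix.of fun f h : E => (inner ℂ f h) ^ k) f h * b) := by
    unfold Finsupp.sum
    rw [Finset.mul_sum]
    refine Finset.sum_congr rfl fun f _ => ?_
    rw [Finset.mul_sum]
    refine Finset.sum_congr rfl fun h _ => ?_
    simp only [Matrix.of_apply, RCLike.star_def]
    push_cast
    ring
  rw [e, Complex.re_ofReal_mul]
  exact mul_nonneg (by positivity) (Complex.le_def.1 h).1

instance : PreInnerProductSpace.Core ℂ (FockPre E) where
  inner x y := fockInner (E := E) x y
  conj_inner_symm x y := by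
    change conj (fockInner (E := E) y x) = fockInner (E := E) x y
    unfold fockInner Finsupp.sum
    rw [Finset.sum_comm]
    simp only [map_sum, map_mul, Complex.conj_conj, ← Complex.exp_conj, inner_conj_symm]
    exact Finset.sum_congr rfl fun f _ => Finset.sum_congr rfl fun h _ => by ring
  re_inner_nonneg x := fockInner_self_nonneg (E := E) x
  add_left x y z := by
    change fockInner (E := E) (x + y) z = fockInner (E := E) x z + fockInner (E := E) y z
    unfold fockInner
    refine Finsupp.sum_add_index' (h := fun f a => Finsupp.sum (α := E) (M := ℂ) z
      fun h b => conj a * Complex.exp (inner ℂ f h) * b) (fun f => ?_) (fun f a b => ?_)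
    · simp [Finsupp.sum]
    · simp [Finsupp.sum, add_mul, Finset.sum_add_distrib]
  smul_left x y r := by
    change fockInner (E := E) (r • x) y = conj r * fockInner (E := E) x y
    unfold fockInner
    refine (Finsupp.sum_smul_index (h := fun f a => Finsupp.sum (α := E) (M := ℂ) y
      fun h b => conj a * Complex.exp (inner ℂ f h) * b) (fun f => by simp [Finsupp.sum])).trans ?_
    simp only [Finsupp.sum, Finset.mul_sum, map_mul, mul_assoc]

instance : SeminormedAddCommGroup (FockPre E) :=
  InnerProductSpace.Core.toSeminormedAddCommGroup (𝕜 := ℂ)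

instance : InnerProductSpace ℂ (FockPre E) := .ofCore _

/-- The formal multiple `a • e^h`. -/
def FockPre.single (h : E) (a : ℂ) : FockPre E := Finsupp.single (M := ℂ) h a

theorem FockPre.smul_single (c : ℂ) (h : E) (a : ℂ) :
    c • FockPre.single h a = FockPre.single h (c * a) := Finsupp.smul_single c h a

theorem inner_single (f h : E) (a b : ℂ) :
    inner ℂ (FockPre.single f a) (FockPre.single h b) = conj a * Complex.exp (inner ℂ f h) * b := by
  change fockInner (Finsupp.single f a) (Finsupp.single h b) = _
  simp [fockInner]

theorem FockPre.induction {p : FockPre E → Prop} (x : FockPre E) (h0 : p 0)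
    (hadd : ∀ x y, p x → p y → p (x + y)) (hs : ∀ h a, p (FockPre.single h a)) : p x :=
  Finsupp.induction_linear (motive := p) x h0 hadd hs

variable (E) in
/-- The symmetric (Bosonic) Fock space `e^E`: the Hilbert space completion of the span of
the coherent vectors `e^h = ⨁_k h^{⊗k} / √k!`, which are total in `⨁_k P_k E^{⊗k}` and have
inner products `(e^f, e^h) = e^{(f, h)}`. -/
abbrev Fock : Type _ := UniformSpace.Completion (FockPre E)

/-- The coherent vector `e^h`. -/
def coherent (h : E) : Fock E := ((FockPre.single h 1 : FockPre E) : Fock E)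

theorem inner_coherent (f h : E) :
    inner ℂ (coherent f) (coherent h) = Complex.exp (inner ℂ f h) := by
  unfold coherent
  rw [UniformSpace.Completion.inner_coe, inner_single]
  simp

/-- The Weyl operator `W(f)` on finite combinations of coherent vectors:
`W(f) e^h = e^{-‖f‖²/2 - (f, h)} e^{f + h}`. -/
def weylPre (f : E) : FockPre E →ₗ[ℂ] FockPre E :=
  Finsupp.linearCombination ℂ fun h : E =>
    FockPre.single (f + h) (Complex.exp (-(‖f‖ ^ 2 / 2 : ℝ) - inner ℂ f h))

theorem weylPre_single (f h : E) (a : ℂ) : weylPre f (FockPre.single h a) =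
    FockPre.single (f + h) (a * Complex.exp (-(‖f‖ ^ 2 / 2 : ℝ) - inner ℂ f h)) :=
  (Finsupp.linearCombination_single ℂ a h).trans (FockPre.smul_single _ _ _)

theorem inner_weylPre (f : E) (x y : FockPre E) :
    inner ℂ (weylPre f x) (weylPre f y) = inner ℂ x y := by
  induction x using FockPre.induction with
  | h0 => simp
  | hadd x x' hx hx' => rw [map_add, inner_add_left, hx, hx', inner_add_left]
  | hs h a =>
    induction y using FockPre.induction with
    | h0 => simp
    | hadd y y' hy hy' => rw [map_add, inner_add_right, hy, hy', inner_add_right]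
    | hs k b =>
      rw [weylPre_single, weylPre_single, inner_single, inner_single]
      simp only [map_mul, ← Complex.exp_conj, map_sub, map_neg, Complex.conj_ofReal,
        inner_conj_symm]
      have e : Complex.exp (-(‖f‖ ^ 2 / 2 : ℝ) - inner ℂ h f) *
          Complex.exp (inner ℂ (f + h) (f + k)) *
          Complex.exp (-(‖f‖ ^ 2 / 2 : ℝ) - inner ℂ f k) = Complex.exp (inner ℂ h k) := by
        rw [← Complex.exp_add, ← Complex.exp_add, inner_add_left, inner_add_right, inner_add_right,
          inner_self_eq_norm_sq_to_K]
        congr 1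
        push_cast
        simp only [Complex.coe_algebraMap]
        ring
      rw [← e]
      ring

theorem norm_weylPre (f : E) (x : FockPre E) : ‖weylPre f x‖ = ‖x‖ := by
  rw [@norm_eq_sqrt_re_inner ℂ, @norm_eq_sqrt_re_inner ℂ _ _ _ _ x, inner_weylPre]

/-- The Weyl operator `W(f)` on the Fock space, the continuous extension of `weylPre f`. -/
def weyl (f : E) : Fock E →L[ℂ] Fock E :=
  ((UniformSpace.Completion.toComplL (𝕜 := ℂ) (E := FockPre E)).toLinearMap ∘ₗ
    weylPre f).extendOfNorm (UniformSpace.Completion.toComplL (𝕜 := ℂ) (E := FockPre E)).toLinearMap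

theorem weyl_coe (f : E) (x : FockPre E) : weyl f (x : Fock E) = (weylPre f x : FockPre E) :=
  LinearMap.extendOfNorm_eq (UniformSpace.Completion.denseRange_coe)
    ⟨1, fun x => by simp [norm_weylPre]⟩ x

theorem weyl_coherent (f h : E) : weyl f (coherent h) =
    Complex.exp (-(‖f‖ ^ 2 / 2 : ℝ) - inner ℂ f h) • coherent (f + h) := by
  unfold coherent
  rw [weyl_coe, weylPre_single, ← UniformSpace.Completion.coe_smul, FockPre.smul_single, one_mul,
    mul_one]

theorem norm_weyl_le (f : E) : ‖weyl f‖ ≤ 1 := by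
  refine ContinuousLinearMap.opNorm_le_bound _ zero_le_one fun x => ?_
  exact LinearMap.norm_extendOfNorm_apply_le (UniformSpace.Completion.denseRange_coe) 1
    (fun x => by simp [norm_weylPre]) x

/-- The second quantization algebra `R(H)`, generated by the `W(f)` with `f ∈ H`. -/
def secondQuantization (H : Set E) : VonNeumannAlgebra (Fock E) := vnGen (weyl '' H)

end Fock

/-! ### Loops in a Euclidean space and the one-particle space -/

section OneParticle

open Real MeasureTheory

open scoped ContDiff

/-- A smooth loop `𝕊¹ → F`, `F = ℝⁿ`, given as a smooth `2π`-periodic function of the angle. -/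
structure Loop (n : ℕ) where
  toFun : ℝ → EuclideanSpace ℝ (Fin n)
  smooth : ContDiff ℝ ∞ toFun
  periodic : Function.Periodic toFun (2 * π)

instance (n : ℕ) : CoeFun (Loop n) fun _ => ℝ → EuclideanSpace ℝ (Fin n) := ⟨Loop.toFun⟩

variable {n : ℕ}

/-- The Fourier coefficient `f̂_k = ∫₀^{2π} e^{-ikθ} f(θ) dθ/2π` in `F_ℂ = ℂⁿ`. -/
def Loop.fourier (f : Loop n) (k : ℤ) : EuclideanSpace ℂ (Fin n) :=
  WithLp.toLp 2 fun j => (2 * π : ℂ)⁻¹ *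
    ∫ θ in (0)..(2 * π), Complex.exp (-(Complex.I * k * θ)) * (f θ j : ℂ)

theorem integral_exp_mul_eq (k : ℤ) (hk : k ≠ 0) (u u' : ℝ → ℝ)
    (hu : ∀ θ, HasDerivAt u (u' θ) θ) (hu' : Continuous u') (hp : u (2 * π) = u 0) :
    ∫ θ in (0)..(2 * π), Complex.exp (-(Complex.I * k * θ)) * (u θ : ℂ) =
      (Complex.I * k)⁻¹ * ∫ θ in (0)..(2 * π), Complex.exp (-(Complex.I * k * θ)) * (u' θ : ℂ) := by
  have hk' : (Complex.I * k : ℂ) ≠ 0 := mul_ne_zero Complex.I_ne_zero (by exact_mod_cast hk)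
  have hv : ∀ θ : ℝ, HasDerivAt (fun θ : ℝ => -(Complex.I * k)⁻¹ *
      Complex.exp (-(Complex.I * k * θ))) (Complex.exp (-(Complex.I * k * θ))) θ := by
    intro θ
    have h1 : HasDerivAt (fun θ : ℝ => -(Complex.I * k * (θ : ℂ))) (-(Complex.I * k * 1)) θ :=
      ((Complex.ofRealCLM.hasDerivAt (x := θ)).const_mul (Complex.I * k)).neg
    have h2 := (h1.cexp).const_mul (-(Complex.I * k : ℂ)⁻¹)
    refine h2.congr_deriv ?_
    rw [mul_one, mul_comm (Complex.exp _), ← mul_assoc, neg_mul_neg, inv_mul_cancel₀ hk', one_mul]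
  have hU : ∀ θ : ℝ, HasDerivAt (fun θ : ℝ => (u θ : ℂ)) (u' θ : ℂ) θ := fun θ => (hu θ).ofReal_comp
  have h := intervalIntegral.integral_mul_deriv_eq_deriv_mul (a := 0) (b := 2 * π)
    (u := fun θ => (u θ : ℂ)) (u' := fun θ => (u' θ : ℂ))
    (v := fun θ : ℝ => -(Complex.I * k)⁻¹ * Complex.exp (-(Complex.I * k * θ)))
    (v' := fun θ : ℝ => Complex.exp (-(Complex.I * k * θ)))
    (fun θ _ => hU θ) (fun θ _ => hv θ)
    (by apply Continuous.intervalIntegrable; fun_prop)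
    (by apply Continuous.intervalIntegrable; fun_prop)
  have e0 : Complex.exp (-(Complex.I * k * ((2 * π : ℝ) : ℂ))) = 1 := by
    rw [Complex.exp_eq_one_iff]
    exact ⟨-k, by push_cast; ring⟩
  simp only [mul_comm (Complex.exp _) (u _ : ℂ), h, e0, hp]
  rw [← intervalIntegral.integral_const_mul]
  have : ∫ x in (0)..(2 * π), (u' x : ℂ) * (-(Complex.I * k)⁻¹ * Complex.exp (-(Complex.I * k * x)))
      = - ∫ x in (0)..(2 * π), (Complex.I * k)⁻¹ * (Complex.exp (-(Complex.I * k * x)) * (u' x : ℂ)) := by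
    rw [← intervalIntegral.integral_neg]
    congr 1; ext x; ring
  rw [this]
  simp

theorem Loop.fourier_bound (f : Loop n) :
    ∃ C : ℝ, ∀ k : ℤ, k ≠ 0 → ‖f.fourier k‖ ≤ C / (k : ℝ) ^ 2 := by
  have hc : ∀ j : Fin n, ContDiff ℝ ∞ fun θ => f θ j := fun j =>
    (contDiff_euclidean.1 f.smooth) j
  have key : ∀ j : Fin n, ∃ C : ℝ, ∀ k : ℤ, k ≠ 0 → ‖f.fourier k j‖ ≤ C / (k : ℝ) ^ 2 := by
    intro j
    set u : ℝ → ℝ := fun θ => f θ j with hu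
    have h1 : ContDiff ℝ ∞ (deriv u) := ((contDiff_infty_iff_deriv).1 (hc j)).2
    have h2 : ContDiff ℝ ∞ (deriv (deriv u)) := ((contDiff_infty_iff_deriv).1 h1).2
    have hper : Function.Periodic u (2 * π) := fun θ => by simp only [hu, f.periodic θ]
    have hper' : deriv u (2 * π) = deriv u 0 := by
      have e : (fun θ => u (θ + 2 * π)) = u := funext hper
      have := deriv_comp_add_const u (2 * π) 0
      rw [e, zero_add] at this
      exact this.symm
    refine ⟨(2 * π)⁻¹ * ∫ θ in (0)..(2 * π), |deriv (deriv u) θ|, fun k hk => ?_⟩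
    have e1 := integral_exp_mul_eq k hk u (deriv u)
      (fun θ => ((hc j).differentiable (by simp) θ).hasDerivAt) h1.continuous
      (by simpa using hper 0)
    have e2 := integral_exp_mul_eq k hk (deriv u) (deriv (deriv u))
      (fun θ => (h1.differentiable (by simp) θ).hasDerivAt) h2.continuous hper'
    have e3 : f.fourier k j = (2 * π : ℂ)⁻¹ * ((Complex.I * k)⁻¹ * ((Complex.I * k)⁻¹ *
        ∫ θ in (0)..(2 * π), Complex.exp (-(Complex.I * k * θ)) * ((deriv (deriv u) θ : ℝ) : ℂ))) := by
      rw [← e2, ← e1]; rfl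
    have hb : ‖∫ θ in (0)..(2 * π), Complex.exp (-(Complex.I * k * θ)) * ((deriv (deriv u) θ : ℝ) : ℂ)‖
        ≤ ∫ θ in (0)..(2 * π), |deriv (deriv u) θ| := by
      refine (intervalIntegral.norm_integral_le_integral_norm (by positivity)).trans (le_of_eq ?_)
      congr 1
      ext θ
      have : -(Complex.I * k * (θ : ℂ)) = ((-(k * θ) : ℝ) : ℂ) * Complex.I := by push_cast; ring
      rw [norm_mul, this, Complex.norm_exp_ofReal_mul_I, one_mul, Complex.norm_real, norm_eq_abs]
    rw [e3]
    simp only [norm_mul, norm_inv, Complex.norm_I, one_mul, Complex.norm_real, norm_eq_abs,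
      Complex.norm_intCast, Complex.norm_ofNat, abs_of_pos pi_pos]
    have hk2 : |(k : ℝ)|⁻¹ * |(k : ℝ)|⁻¹ = ((k : ℝ) ^ 2)⁻¹ := by
      rw [← mul_inv, ← sq, sq_abs]
    calc _ = (2 * π)⁻¹ * (|(k : ℝ)|⁻¹ * |(k : ℝ)|⁻¹) *
          ‖∫ θ in (0)..(2 * π), Complex.exp (-(Complex.I * k * θ)) * ((deriv (deriv u) θ : ℝ) : ℂ)‖ := by
            ring
      _ ≤ (2 * π)⁻¹ * (|(k : ℝ)|⁻¹ * |(k : ℝ)|⁻¹) * ∫ θ in (0)..(2 * π), |deriv (deriv u) θ| := by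
            gcongr
      _ = _ := by rw [hk2]; ring
  choose C hC using key
  refine ⟨∑ j, C j, fun k hk => ?_⟩
  calc ‖f.fourier k‖ ≤ ∑ j, ‖f.fourier k j‖ := by
        have : f.fourier k = ∑ j, EuclideanSpace.single j (f.fourier k j) := by
          ext i; simp [Finset.sum_apply, Pi.single_apply]
        calc ‖f.fourier k‖ = ‖∑ j, EuclideanSpace.single j (f.fourier k j)‖ := by rw [← this]
          _ ≤ ∑ j, ‖EuclideanSpace.single j (f.fourier k j)‖ := norm_sum_le _ _
          _ = _ := by simp
    _ ≤ ∑ j, C j / (k : ℝ) ^ 2 := Finset.sum_le_sum fun j _ => hC j k hk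
    _ = _ := by rw [Finset.sum_div]

/-- The one-particle space `H_{0,F}`: the Hilbert space completion of `LF / F` for the
norm `‖f‖² = ∑_{k ≥ 1} k ‖f̂_k‖²` and the complex structure `f̂_k ↦ -i sign(k) f̂_k`. Since
multiplication by `i` acts by `+i` on the coefficients with negative index, it is realized
as `ℓ²(ℕ, F_ℂ)` through `[f] ↦ (√k f̂_{-k})_{k ≥ 1}`. -/
abbrev OneParticle (n : ℕ) : Type _ := lp (fun _ : ℕ => EuclideanSpace ℂ (Fin n)) 2

/-- The canonical map `LF → LF / F → H_{0,F}`, `f ↦ [f]`; the entry with index `m : ℕ` belongs to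
the frequency `k = m + 1`. -/
def Loop.vec (f : Loop n) : OneParticle n :=
  ⟨fun m => (√(m + 1 : ℝ) : ℂ) • f.fourier (-(m + 1 : ℤ)), by
    obtain ⟨C, hC⟩ := f.fourier_bound
    refine memℓp_gen ?_
    have hs : Summable fun m : ℕ => C ^ 2 * (1 / ((m + 1 : ℕ) : ℝ) ^ 2) :=
      ((summable_nat_add_iff 1).2 (Real.summable_one_div_nat_pow.2 one_lt_two)).mul_left _
    refine Summable.of_nonneg_of_le (fun _ => by positivity) (fun m => ?_) hs
    have h1 : ‖f.fourier (-(m + 1 : ℤ))‖ ≤ C / ((m : ℝ) + 1) ^ 2 := by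
      have := hC (-(m + 1 : ℤ)) (by omega)
      push_cast at this
      rwa [neg_sq] at this
    have hC0 : 0 ≤ C / ((m : ℝ) + 1) ^ 2 := (norm_nonneg _).trans h1
    have hm : (0 : ℝ) < m + 1 := by positivity
    rw [norm_smul, Complex.norm_real, norm_eq_abs, abs_of_nonneg (sqrt_nonneg _)]
    simp only [ENNReal.toReal_ofNat, rpow_ofNat]
    rw [mul_pow, sq_sqrt hm.le]
    calc (m + 1 : ℝ) * ‖f.fourier (-(m + 1 : ℤ))‖ ^ 2
        ≤ (m + 1 : ℝ) * (C / ((m : ℝ) + 1) ^ 2) ^ 2 := by gcongr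
      _ = C ^ 2 * (1 / (m + 1 : ℝ) ^ 3) := by field_simp
      _ ≤ C ^ 2 * (1 / (m + 1 : ℝ) ^ 2) := by
          gcongr
          · linarith
          · norm_num
      _ = _ := by push_cast; ring⟩

/-- A proper interval of the circle: a non-empty open arc whose complement has non-empty
interior. -/
def IsProperInterval (I : Set Circle) : Prop :=
  ∃ a b : ℝ, a < b ∧ b < a + 2 * π ∧ I = Circle.exp '' Set.Ioo a b

/-- The loop `f` vanishes off `I`, i.e. `f` belongs to `L_I F`. -/
def Loop.SupportedIn (f : Loop n) (I : Set Circle) : Prop :=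
  ∀ θ : ℝ, Circle.exp θ ∉ I → f θ = 0

/-- The local real subspace `H_F(I)`, the closure of `{[f] : f ∈ L_I F}`. -/
def localSubspace (n : ℕ) (I : Set Circle) : Set (OneParticle n) :=
  closure {v | ∃ f : Loop n, f.SupportedIn I ∧ f.vec = v}

/-- The local algebra `𝒜_F(I) = R(H_F(I))` of the Abelian current net over `F = ℝⁿ`. -/
def currentAlgebra (n : ℕ) (I : Set Circle) : VonNeumannAlgebra (Fock (OneParticle n)) :=
  secondQuantization (localSubspace n I)

end OneParticle

/-! ### Loops in the torus of a lattice and the lattice net -/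

section Lattice

open Real

open scoped ContDiff

variable {n : ℕ} (L : Submodule ℤ (EuclideanSpace ℝ (Fin n)))

/-- The lattice `L` is even: `⟨α, α⟩ ∈ 2ℕ` for all `α ∈ L`. -/
def IsEven : Prop := ∀ α ∈ L, ∃ k : ℕ, inner ℝ α α = 2 * (k : ℝ)

/-- A bimultiplicative map `ε : L × L → {±1}` with `ε(α, α) = (-1)^{⟨α, α⟩ / 2}`. -/
structure IsSignCocycle (ε : L → L → ℤˣ) : Prop where
  add_left : ∀ α β γ, ε (α + β) γ = ε α γ * ε β γ
  add_right : ∀ α β γ, ε α (β + γ) = ε α β * ε α γ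
  self : ∀ (α : L) (k : ℕ), inner ℝ (α : EuclideanSpace ℝ (Fin n)) α = 2 * (k : ℝ) →
    ε α α = (-1) ^ k

/-- A loop `e^{if}` in the torus `T = F / 2πL`, given by a smooth `f : ℝ → F` for
which `Δ_f = (f(θ + 2π) - f(θ)) / 2π` is a constant element of `L`. Two functions represent the same
loop iff they differ by a constant in `2πL`. -/
structure TorusLoop where
  toFun : ℝ → EuclideanSpace ℝ (Fin n)
  smooth : ContDiff ℝ ∞ toFun
  /-- The winding number `Δ_f`. -/
  winding : L
  map_add_two_pi : ∀ θ, toFun (θ + 2 * π) =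
    toFun θ + (2 * π) • (winding : EuclideanSpace ℝ (Fin n))

instance : CoeFun (TorusLoop L) fun _ => ℝ → EuclideanSpace ℝ (Fin n) := ⟨TorusLoop.toFun⟩

variable {L}

/-- `e^{if} ∈ L_I T`: the loop is trivial off `I`, that is `f(θ) ∈ 2πL` for `e^{iθ} ∉ I`. -/
def TorusLoop.SupportedIn (f : TorusLoop L) (I : Set Circle) : Prop :=
  ∀ θ : ℝ, Circle.exp θ ∉ I → ∃ l ∈ L, f θ = (2 * π) • l

/-- The periodic function `f_∘(θ) = f(θ) - θ Δ_f = f₀ + f₁(θ)`. -/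
def TorusLoop.periodicPart (f : TorusLoop L) : Loop n where
  toFun θ := f θ - θ • (f.winding : EuclideanSpace ℝ (Fin n))
  smooth := f.smooth.sub (contDiff_id.smul contDiff_const)
  periodic θ := by simp only [f.map_add_two_pi, add_smul]; abel

/-- The zeroth mode `f₀`, the mean of `f_∘`. -/
def TorusLoop.zeroMode (f : TorusLoop L) : EuclideanSpace ℝ (Fin n) :=
  (2 * π)⁻¹ • ∫ θ in (0)..(2 * π), f.periodicPart θ

/-- The cocycle `η(α, β) = c(e^{iαθ}, e^{iβθ}) = ε(α, β) e^{iπ⟨α, β⟩/2}`. -/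
def klein (ε : L → L → ℤˣ) (α β : L) : ℂ :=
  ((ε α β : ℤ) : ℂ) * Circle.exp (π / 2 * inner ℝ (α : EuclideanSpace ℝ (Fin n)) β)

theorem norm_klein (ε : L → L → ℤˣ) (α β : L) : ‖klein ε α β‖ = 1 := by
  rw [klein, norm_mul, Circle.norm_coe, mul_one, Complex.norm_intCast]
  rcases Int.units_eq_one_or (ε α β) with h | h <;> simp [h]

variable (L) in
/-- The Hilbert space `H_L = ⨁_{α ∈ L} (H_F)_α = ℓ²(L, H_F)`, `H_F` being the Fock space over
`H_{0,F}`. -/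
abbrev LatticeSpace : Type _ := Ell2 L (Fock (OneParticle n))

/-- The vacuum representation of the loop group of `T` (up to phases)
`π(e^{if}) = e^{-i⟨f₀, Q⟩} W(f₁) η(-Q, Δ_f) Γ_{Δ_f}` on `H_L`, where `Q` is the charge operator,
which is multiplication by `α` on `(H_F)_α`, and `Γ_Δ` is the charge shift. -/
def TorusLoop.op (ε : L → L → ℤˣ) (f : TorusLoop L) : LatticeSpace L →L[ℂ] LatticeSpace L :=
  diag (fun q : L =>
      ((Circle.exp (-inner ℝ f.zeroMode (q : EuclideanSpace ℝ (Fin n))) : ℂ) *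
        klein ε (-q) f.winding) • weyl f.periodicPart.vec) 1
    (fun q => by
      rw [norm_smul, norm_mul, Circle.norm_coe, norm_klein, one_mul, one_mul]
      exact norm_weyl_le _) ∘L
    shift f.winding

/-- The local algebra `𝒜_L(I) = π(L_I T)''` of the conformal net of the lattice `L`. -/
def latticeAlgebra (ε : L → L → ℤˣ) (I : Set Circle) : VonNeumannAlgebra (LatticeSpace L) :=
  vnGen {x | ∃ f : TorusLoop L, f.SupportedIn I ∧ f.op ε = x}

/-- The algebra `π((L_I T)₀)''` of the localized loops with winding number zero. -/
def neutralAlgebra (ε : L → L → ℤˣ) (I : Set Circle) : VonNeumannAlgebra (LatticeSpace L) :=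
  vnGen {x | ∃ f : TorusLoop L, f.SupportedIn I ∧ f.winding = 0 ∧ f.op ε = x}

/-- A smooth step function localized in `I`: `M(θ + 2π) = M(θ) + 2π`, and `M(θ) ∈ 2πℤ` for
`e^{iθ} ∉ I`. -/
structure StepFunction (I : Set Circle) where
  toFun : ℝ → ℝ
  smooth : ContDiff ℝ ∞ toFun
  map_add_two_pi : ∀ θ, toFun (θ + 2 * π) = toFun θ + 2 * π
  off_interval : ∀ θ : ℝ, Circle.exp θ ∉ I → ∃ k : ℤ, toFun θ = 2 * π * k

/-- The loop `e^{iMα}`, which is localized in `I` and has winding number `α`. -/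
def StepFunction.loop {I : Set Circle} (M : StepFunction I) (α : L) : TorusLoop L where
  toFun θ := M.toFun θ • (α : EuclideanSpace ℝ (Fin n))
  smooth := M.smooth.smul contDiff_const
  winding := α
  map_add_two_pi θ := by rw [M.map_add_two_pi, add_smul]

theorem StepFunction.loop_supportedIn {I : Set Circle} (M : StepFunction I) (α : L) :
    (M.loop α).SupportedIn I := by
  intro θ hθ
  obtain ⟨k, hk⟩ := M.off_interval θ hθ
  refine ⟨k • (α : EuclideanSpace ℝ (Fin n)), L.smul_mem k α.2, ?_⟩
  change M.toFun θ • (α : EuclideanSpace ℝ (Fin n)) = _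
  rw [hk, mul_smul, Int.cast_smul_eq_zsmul]

end Lattice

end LatticeNet

end

open LatticeNet

noncomputable section

set_option linter.unusedSectionVars false

namespace LatticeNet

/-! ### Generated von Neumann algebras -/

section VN

variable {K : Type*} [NormedAddCommGroup K] [InnerProductSpace ℂ K] [CompleteSpace K]
variable {K' : Type*} [NormedAddCommGroup K'] [InnerProductSpace ℂ K'] [CompleteSpace K']

/-! Write `I` as the arc `(a, b)`. Besides the step function `M` for `I`, fix an auxiliary step
function `N` for the complementary arc `(b, a + 2π)`. Let `m_α` and `n_α` be the one-particle
vectors of the periodic parts of `Mα` and `Nα`; both are additive in `α`. With these vectors all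
assertions become Weyl relations.

Neutral loops. For `g` supported in `I`, conjugation by `W(n_q)` multiplies `W([g])` by `exp(i ∫ ⟨g,
(N' - 1) q⟩ dθ/2π)`. Since `N' = 0` on `I`, this is the zero-mode phase with which the loop acts on
charge `q` (`op_eq_chargeRep`). Hence `Φ(x) = ⨁_q Ad W(n_q)(x)`, an amplification conjugated by a
diagonal unitary. Such maps respect generated von Neumann algebras (`mem_vnGen_chargeRep_image`,
`mem_neutralAlgebra_iff`), and `n_0 = 0` gives the restriction to charge zero.

Action. The difference `(M - N)α` is periodic, and `β_α = Ad W(m_α - n_α)`. The phases of the Weyl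
relations cancel in `Ad`, so this is an action. It preserves the current algebra because Weyl
operators are only multiplied by phases, and it is implemented by `π(e^{iMα})` because `n_q + m_α -
n_α = m_α + n_{q-α}` (`chargeRep_stepAction`).

Freeness. Let `x` intertwine the identity and `β_α`. Take smoothed indicator functions of `I` and of
its complement, both multiplied by a vector `v` with `⟨v, α⟩ = π`. Moving `x` past the first Weyl
operator costs a phase tending to `-1`; with the second one `x` commutes by locality. The sum of the
two loops is a constant minus bumps shrinking at `a` and `b`. By scale invariance of the Sobolev
norm of order one half the bumps stay bounded in the one-particle space, and they tend weakly to
zero. After rescaling, their Weyl operators tend weakly to the identity, so `x = -x`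
(`eq_zero_of_intertwines`, `eq_zero_of_weyl_anticommute`).

Crossed product. A localized loop is, up to a phase, a neutral one times `e^{iMα}`, which gives the
generators. Conjugation by `⨁_q c_q W(-m_q)` turns `Φ(x)` into the family `β_{-q}(x)`. It turns
`π(e^{iMα})` into a translation with scalar phases, because the `m_α` are isotropic for the
symplectic form (`StepFunction.im_inner_vec`). The cocycle of the `π(e^{iMα})` and the prescribed
`σ` have the same commutator, so their quotient is symmetric, hence a coboundary on the free group
`L` (`exists_coboundary_of_symmetric`); this supplies the phases. -/

theorem mem_vnGen_iff {S : Set (K →L[ℂ] K)} {x : K →L[ℂ] K} :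
    x ∈ vnGen S ↔ ∀ y : K →L[ℂ] K, (∀ s ∈ S, s * y = y * s ∧ star s * y = y * star s) →
      y * x = x * y := by
  change x ∈ StarSubalgebra.centralizer ℂ (StarSubalgebra.centralizer ℂ S : Set (K →L[ℂ] K)) ↔ _
  rw [StarSubalgebra.mem_centralizer_iff]
  constructor
  · intro h y hy
    exact (h y (by rw [SetLike.mem_coe, StarSubalgebra.mem_centralizer_iff]; exact hy)).1
  · intro h y hy
    rw [SetLike.mem_coe] at hy
    refine ⟨h y ((StarSubalgebra.mem_centralizer_iff ℂ).1 hy), h _ ?_⟩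
    exact (StarSubalgebra.mem_centralizer_iff ℂ).1 (star_mem hy)

theorem mem_vnGen_of_mem {S : Set (K →L[ℂ] K)} {x : K →L[ℂ] K} (hx : x ∈ S) : x ∈ vnGen S :=
  subset_vnGen S hx

theorem mem_of_commute_commutant (A : VonNeumannAlgebra K) {x : K →L[ℂ] K}
    (h : ∀ y : K →L[ℂ] K, (∀ s ∈ A, s * y = y * s) → y * x = x * y) : x ∈ A := by
  rw [← SetLike.mem_coe, ← A.centralizer_centralizer]
  intro y hy
  exact h y fun s hs => hy s hs

theorem vnGen_le {S : Set (K →L[ℂ] K)} {A : VonNeumannAlgebra K}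
    (h : S ⊆ A) : vnGen S ≤ A := by
  intro x hx
  refine mem_of_commute_commutant A fun y hy => mem_vnGen_iff.1 hx y fun s hs => ?_
  exact ⟨hy s (h hs), hy _ (star_mem (h hs))⟩

theorem smul_mem_vn (A : VonNeumannAlgebra K) (c : ℂ) {x : K →L[ℂ] K} (hx : x ∈ A) : c • x ∈ A :=
  A.toStarSubalgebra.smul_mem hx c

/-- A *-isomorphism of the full operator algebras maps generated von Neumann algebras to generated
von Neumann algebras. -/
theorem mem_vnGen_image (φ : (K →L[ℂ] K) ≃⋆ₐ[ℂ] (K' →L[ℂ] K')) (S : Set (K →L[ℂ] K))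
    {x : K →L[ℂ] K} : φ x ∈ vnGen (φ '' S) ↔ x ∈ vnGen S := by
  have hm : ∀ a b, φ (a * b) = φ a * φ b := φ.map_mul'
  have hst : ∀ a, φ (star a) = star (φ a) := φ.map_star'
  have hinj : ∀ {a b}, φ a = φ b → a = b := fun h => EquivLike.injective φ h
  rw [mem_vnGen_iff, mem_vnGen_iff]
  constructor
  · intro h y hy
    apply hinj
    rw [hm, hm]
    refine h _ ?_
    rintro _ ⟨s, hs, rfl⟩
    rw [← hst, ← hm, ← hm, ← hm, ← hm, (hy s hs).1, (hy s hs).2]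
    exact ⟨rfl, rfl⟩
  · intro h y hy
    obtain ⟨y, rfl⟩ := EquivLike.surjective φ y
    rw [← hm, ← hm, h]
    intro s hs
    have := hy _ ⟨s, hs, rfl⟩
    simp only [← hst, ← hm] at this
    exact ⟨hinj this.1, hinj this.2⟩

theorem image_vnGen (φ : (K →L[ℂ] K) ≃⋆ₐ[ℂ] (K' →L[ℂ] K')) (S : Set (K →L[ℂ] K)) :
    φ '' (vnGen S : Set (K →L[ℂ] K)) = vnGen (φ '' S) := by
  ext y
  obtain ⟨x, rfl⟩ := EquivLike.surjective φ y
  rw [(EquivLike.injective φ).mem_set_image, SetLike.mem_coe, SetLike.mem_coe, mem_vnGen_image]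

/-- Restriction of a *-automorphism of `B(K)` to a globally invariant von Neumann algebra. -/
def restrictAut (A : VonNeumannAlgebra K) (φ : (K →L[ℂ] K) ≃⋆ₐ[ℂ] (K →L[ℂ] K))
    (h : ∀ x ∈ A, φ x ∈ A) (h' : ∀ x ∈ A, φ.symm x ∈ A) : Alg A ≃⋆ₐ[ℂ] Alg A where
  toFun x := ⟨φ x, h x x.2⟩
  invFun x := ⟨φ.symm x, h' x x.2⟩
  left_inv x := Subtype.ext (φ.symm_apply_apply x)
  right_inv x := Subtype.ext (φ.apply_symm_apply x)
  map_mul' x y := Subtype.ext (map_mul φ (x : K →L[ℂ] K) y)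
  map_add' x y := Subtype.ext (map_add φ (x : K →L[ℂ] K) y)
  map_star' x := Subtype.ext (map_star φ (x : K →L[ℂ] K))
  map_smul' c x := Subtype.ext (map_smul φ c (x : K →L[ℂ] K))

/-- A *-isomorphism of von Neumann algebras from an injective *-homomorphism of `B(K)` mapping
one onto the other. -/
def restrictEquiv (A : VonNeumannAlgebra K) (B : VonNeumannAlgebra K')
    (φ : (K →L[ℂ] K) →⋆ₐ[ℂ] (K' →L[ℂ] K')) (hφ : Function.Injective φ)
    (h : ∀ x ∈ A, φ x ∈ B) (h' : ∀ y ∈ B, ∃ x ∈ A, φ x = y) : Alg A ≃⋆ₐ[ℂ] Alg B where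
  toEquiv := Equiv.ofBijective (fun x : Alg A => (⟨φ x, h x x.2⟩ : Alg B))
    ⟨fun x y hxy => Subtype.ext (hφ (congrArg Subtype.val hxy)),
      fun y => by obtain ⟨x, hx, e⟩ := h' y y.2; exact ⟨⟨x, hx⟩, Subtype.ext e⟩⟩
  map_mul' x y := Subtype.ext (map_mul φ (x : K →L[ℂ] K) y)
  map_add' x y := Subtype.ext (map_add φ (x : K →L[ℂ] K) y)
  map_star' x := Subtype.ext (map_star φ (x : K →L[ℂ] K))
  map_smul' c x := Subtype.ext (map_smul φ c (x : K →L[ℂ] K))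

theorem coe_restrictEquiv (A : VonNeumannAlgebra K) (B : VonNeumannAlgebra K')
    (φ : (K →L[ℂ] K) →⋆ₐ[ℂ] (K' →L[ℂ] K')) (hφ : Function.Injective φ)
    (h : ∀ x ∈ A, φ x ∈ B) (h' : ∀ y ∈ B, ∃ x ∈ A, φ x = y) (x : Alg A) :
    (restrictEquiv A B φ hφ h h' x : K' →L[ℂ] K') = φ (x : K →L[ℂ] K) := rfl

end VN

/-! ### Diagonal operators and amplifications -/

section Diagonal

variable {G : Type*} [AddCommGroup G]
variable {K : Type*} [NormedAddCommGroup K] [InnerProductSpace ℂ K] [CompleteSpace K]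

theorem ell2_ext_single [DecidableEq G] {X Y : Ell2 G K →L[ℂ] Ell2 G K}
    (h : ∀ g (k : K), X (lp.single 2 g k) = Y (lp.single 2 g k)) : X = Y := by
  ext1 ξ
  have hs := lp.hasSum_single (p := 2) (by norm_num) ξ
  have h1 := hs.mapL X
  have h2 := hs.mapL Y
  simp only [h] at h1
  exact h1.unique h2

theorem diag_mul_diag (S T : G → K →L[ℂ] K) (C D E : ℝ) (hS hT hE) :
    diag S C hS * diag T D hT = diag (fun g => S g * T g) E hE := by
  ext ξ g; rfl

theorem star_diag (T : G → K →L[ℂ] K) (C : ℝ) (hT) (hT') :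
    star (diag T C hT) = diag (fun g => star (T g)) C hT' := by
  rw [ContinuousLinearMap.star_eq_adjoint, ← ContinuousLinearMap.eq_adjoint_iff _ _ |>.2]
  intro ξ η
  rw [lp.inner_eq_tsum, lp.inner_eq_tsum]
  refine tsum_congr fun g => ?_
  rw [diag_apply, diag_apply, ContinuousLinearMap.star_eq_adjoint,
    ContinuousLinearMap.adjoint_inner_left]

theorem shift_mul_shift (a b : G) :
    (shift a * shift b : Ell2 G K →L[ℂ] Ell2 G K) = shift (a + b) := by
  ext ξ g
  change ξ (g - a - b) = ξ (g - (a + b))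
  rw [sub_sub]

theorem shift_zero : (shift 0 : Ell2 G K →L[ℂ] Ell2 G K) = 1 := by
  ext ξ g
  change ξ (g - 0) = ξ g
  rw [sub_zero]

theorem star_shift (a : G) : star (shift a : Ell2 G K →L[ℂ] Ell2 G K) = shift (-a) := by
  rw [ContinuousLinearMap.star_eq_adjoint, ← ContinuousLinearMap.eq_adjoint_iff _ _ |>.2]
  intro ξ η
  rw [lp.inner_eq_tsum, lp.inner_eq_tsum,
    ← (Equiv.subRight a).tsum_eq (fun g => inner ℂ (shift (-a) ξ g) (η g))]
  refine tsum_congr fun g => ?_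
  simp

variable (G K) in
/-- The amplification `x ↦ 1 ⊗ x` on `ℓ²(G, K)`. -/
def amp : (K →L[ℂ] K) →⋆ₐ[ℂ] (Ell2 G K →L[ℂ] Ell2 G K) where
  toFun x := diag (fun _ => x) ‖x‖ fun _ => le_rfl
  map_one' := rfl
  map_mul' _ _ := rfl
  map_zero' := rfl
  map_add' _ _ := rfl
  commutes' _ := rfl
  map_star' x := by rw [star_diag _ _ _ (fun _ => (norm_star x).le)]; rfl

theorem amp_single [DecidableEq G] (x : K →L[ℂ] K) (g : G) (k : K) :
    amp G K x (lp.single 2 g k) = lp.single 2 g (x k) := by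
  ext i
  change x ((lp.single 2 g k : Ell2 G K) i) = _
  by_cases h : i = g
  · subst h; simp
  · simp [h]

theorem amp_injective : Function.Injective (amp G K) := by
  classical
  intro x y h
  ext k
  have := congrArg (fun T => T (lp.single 2 (0 : G) k : Ell2 G K) 0) h
  simpa [amp_single] using this

/-- The operator `ξ ↦ e_p ⊗ ξ q`. -/
def matrixUnit [DecidableEq G] (p q : G) : Ell2 G K →L[ℂ] Ell2 G K :=
  (lp.singleContinuousLinearMap ℂ (fun _ : G => K) 2 p) ∘L lp.evalCLM ℂ (fun _ : G => K) 2 q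

theorem matrixUnit_apply [DecidableEq G] (p q : G) (ξ : Ell2 G K) :
    matrixUnit p q ξ = lp.single 2 p (ξ q) := rfl

theorem matrixUnit_single [DecidableEq G] (p q : G) (k : K) :
    matrixUnit p q (lp.single 2 q k) = lp.single 2 p k := by
  rw [matrixUnit_apply, lp.single_apply_self]

theorem amp_mul_matrixUnit [DecidableEq G] (x : K →L[ℂ] K) (p q : G) :
    amp G K x * matrixUnit p q = matrixUnit p q * amp G K x := by
  ext1 ξ
  change amp G K x (lp.single 2 p (ξ q)) = lp.single 2 p (x (ξ q))
  rw [amp_single]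

/-- An operator commuting with all matrix units is an amplification. -/
theorem exists_amp_of_commute_matrixUnit [DecidableEq G] (T : Ell2 G K →L[ℂ] Ell2 G K)
    (h : ∀ p q, matrixUnit p q * T = T * matrixUnit p q) : ∃ x : K →L[ℂ] K, amp G K x = T := by
  -- Evaluated on vectors supported at `q`, the commutation relation says that `T` is diagonal with
  -- the same entry at every index.
  have key : ∀ (p q : G) (k : K), T (lp.single 2 p k) = lp.single 2 p (T (lp.single 2 q k) q) := by
    intro p q k
    have := congrArg (fun X => X (lp.single 2 q k : Ell2 G K)) (h p q)
    change matrixUnit p q (T (lp.single 2 q k)) = T (matrixUnit p q (lp.single 2 q k)) at this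
    rw [matrixUnit_single, matrixUnit_apply] at this
    exact this.symm
  refine ⟨lp.evalCLM ℂ (fun _ : G => K) 2 0 ∘L T ∘L
    lp.singleContinuousLinearMap ℂ (fun _ : G => K) 2 0, ell2_ext_single fun g k => ?_⟩
  rw [amp_single, key g 0 k]
  rfl

/-- The von Neumann algebra generated by an amplified set is the amplification of the generated
von Neumann algebra. -/
theorem mem_vnGen_amp_image {S : Set (K →L[ℂ] K)} {T : Ell2 G K →L[ℂ] Ell2 G K} :
    T ∈ vnGen (amp G K '' S) ↔ ∃ x ∈ vnGen S, amp G K x = T := by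
  classical
  constructor
  · intro hT
    rw [mem_vnGen_iff] at hT
    -- Matrix units commute with every amplified operator, so they lie in the commutant that `T` has
    -- to respect.
    obtain ⟨x, rfl⟩ := exists_amp_of_commute_matrixUnit T fun p q => hT _ (by
      rintro _ ⟨s, -, rfl⟩
      rw [← map_star, amp_mul_matrixUnit, amp_mul_matrixUnit]
      exact ⟨rfl, rfl⟩)
    refine ⟨x, mem_vnGen_iff.2 fun y hy => amp_injective (G := G) ?_, rfl⟩
    rw [map_mul, map_mul]
    refine hT _ ?_
    rintro _ ⟨s, hs, rfl⟩
    rw [← map_star, ← map_mul, ← map_mul, ← map_mul, ← map_mul, (hy s hs).1, (hy s hs).2]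
    exact ⟨rfl, rfl⟩
  · rintro ⟨x, hx, rfl⟩
    refine mem_vnGen_iff.2 fun Y hY => ?_
    -- the matrix entries of `Y` commute with `x`
    have hent : ∀ (p q : G) (ξ : K),
        Y (lp.single 2 q (x ξ)) p = x (Y (lp.single 2 q ξ) p) := by
      intro p q ξ
      set y : K →L[ℂ] K := lp.evalCLM ℂ (fun _ : G => K) 2 p ∘L Y ∘L
        lp.singleContinuousLinearMap ℂ (fun _ : G => K) 2 q with hy
      have hyx : ∀ s : K →L[ℂ] K, amp G K s * Y = Y * amp G K s → s * y = y * s := by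
        intro s hs
        ext1 k
        have := congrArg (fun X => X (lp.single 2 q k : Ell2 G K) p) hs
        change s (Y (lp.single 2 q k) p) = Y (amp G K s (lp.single 2 q k)) p at this
        rw [amp_single] at this
        exact this
      have := mem_vnGen_iff.1 hx y fun s hs => by
        refine ⟨hyx s (hY _ ⟨s, hs, rfl⟩).1, hyx _ ?_⟩
        rw [map_star]
        exact (hY _ ⟨s, hs, rfl⟩).2
      exact congrArg (fun X => X ξ) this
    refine ell2_ext_single fun q k => ?_
    ext p
    change Y (amp G K x (lp.single 2 q k)) p = x (Y (lp.single 2 q k) p)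
    rw [amp_single, hent]

/-- Only an inequality, since `K` may be the zero space, where the identity has norm zero. -/
theorem norm_unitary_le_one (u : unitary (K →L[ℂ] K)) : ‖(u : K →L[ℂ] K)‖ ≤ 1 := by
  rw [← mul_one (u : K →L[ℂ] K), CStarRing.norm_coe_unitary_mul]
  exact ContinuousLinearMap.norm_id_le

/-- The diagonal unitary of a family of unitaries. -/
def diagUnitary (u : G → unitary (K →L[ℂ] K)) : unitary (Ell2 G K →L[ℂ] Ell2 G K) :=
  ⟨diag (fun g => (u g : K →L[ℂ] K)) 1 fun g => norm_unitary_le_one (u g), by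
    have h : ∀ g, ‖star (u g : K →L[ℂ] K)‖ ≤ 1 := fun g => by
      rw [norm_star]; exact norm_unitary_le_one (u g)
    rw [Unitary.mem_iff, star_diag _ _ _ h, diag_mul_diag _ _ _ _ 1 _ _ (fun g => by
      rw [Unitary.star_mul_self_of_mem (u g).2]; exact ContinuousLinearMap.norm_id_le),
      diag_mul_diag _ _ _ _ 1 _ _ (fun g => by
      rw [Unitary.mul_star_self_of_mem (u g).2]; exact ContinuousLinearMap.norm_id_le)]
    constructor
    · ext ξ g
      exact congrArg (fun X => X (ξ g)) (Unitary.star_mul_self_of_mem (u g).2)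
    · ext ξ g
      exact congrArg (fun X => X (ξ g)) (Unitary.mul_star_self_of_mem (u g).2)⟩

theorem star_diagUnitary_apply (u : G → unitary (K →L[ℂ] K)) (ξ : Ell2 G K) (g : G) :
    star (diagUnitary u : Ell2 G K →L[ℂ] Ell2 G K) ξ g = star (u g : K →L[ℂ] K) (ξ g) := by
  change star (diag (fun g => (u g : K →L[ℂ] K)) 1 fun g => norm_unitary_le_one (u g)) ξ g = _
  rw [star_diag _ _ _ (fun g => by
      rw [norm_star]; exact norm_unitary_le_one (u g)), diag_apply]

end Diagonal

/-! ### Weyl relations -/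

section Weyl

open Filter Topology

variable {E : Type*} [NormedAddCommGroup E] [InnerProductSpace ℂ E]

/-- The pre-Fock space is spanned by the coherent vectors and is dense in its completion; operator
identities are therefore checked on coherent vectors only. -/
theorem fock_ext {V : Type*} [NormedAddCommGroup V] [NormedSpace ℂ V]
    {X Y : Fock E →L[ℂ] V} (h : ∀ f, X (coherent f) = Y (coherent f)) : X = Y := by
  ext1 ξ
  induction ξ using UniformSpace.Completion.induction_on with
  | hp => exact isClosed_eq X.continuous Y.continuous
  | ih x =>
    induction x using FockPre.induction with
    | h0 => rw [UniformSpace.Completion.coe_zero, map_zero, map_zero]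
    | hadd x y hx hy => rw [UniformSpace.Completion.coe_add, map_add, map_add, hx, hy]
    | hs f a =>
      have : ((FockPre.single f a : FockPre E) : Fock E) = a • coherent f := by
        unfold coherent
        rw [← UniformSpace.Completion.coe_smul, FockPre.smul_single, mul_one]
      rw [this, map_smul, map_smul, h]

theorem weyl_zero : weyl (0 : E) = 1 := by
  refine fock_ext fun f => ?_
  rw [weyl_coherent]
  simp

/-- On `e^h` both sides are multiples of `e^{f+g+h}`, and the exponents differ by `Re(f, g) - (f, g)
= -i Im(f, g)`. -/
theorem weyl_mul (f g : E) :
    weyl f * weyl g = Complex.exp (-(Complex.I * (inner ℂ f g).im)) • weyl (f + g) := by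
  refine fock_ext fun h => ?_
  change weyl f (weyl g (coherent h)) = Complex.exp _ • weyl (f + g) (coherent h)
  rw [weyl_coherent, map_smul, weyl_coherent, weyl_coherent, smul_smul, smul_smul, add_assoc,
    ← Complex.exp_add, ← Complex.exp_add]
  congr 2
  have h1 : ((‖f + g‖ ^ 2 : ℝ) : ℂ) = ‖f‖ ^ 2 + 2 * ((inner ℂ f g).re : ℂ) + ‖g‖ ^ 2 := by
    rw [@norm_add_sq ℂ]
    push_cast
    rfl
  have h2 : inner ℂ f g = ((inner ℂ f g).re : ℂ) + (inner ℂ f g).im * Complex.I :=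
    (Complex.re_add_im _).symm
  have h3 : inner ℂ f (g + h) = inner ℂ f g + inner ℂ f h := inner_add_right _ _ _
  rw [h3, inner_add_left]
  have h4 : (((‖f + g‖ ^ 2 / 2 : ℝ)) : ℂ) = ((‖f + g‖ ^ 2 : ℝ) : ℂ) / 2 := by push_cast; ring
  rw [h4, h1]
  push_cast
  linear_combination (-1 : ℂ) * h2

theorem weyl_mul_comm (f g : E) :
    weyl f * weyl g = Complex.exp (-(2 * Complex.I * (inner ℂ f g).im)) • (weyl g * weyl f) := by
  rw [weyl_mul, weyl_mul, smul_smul, ← Complex.exp_add, add_comm g f]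
  congr 2
  have : (inner ℂ g f).im = -(inner ℂ f g).im := by
    rw [← inner_conj_symm, Complex.conj_im]
  rw [this]
  push_cast
  ring

theorem weyl_mul_weyl_neg (f : E) : weyl f * weyl (-f) = 1 := by
  rw [weyl_mul, add_neg_cancel, weyl_zero, inner_neg_right, Complex.neg_im]
  have : (inner ℂ f f).im = 0 := inner_self_im (𝕜 := ℂ) f
  rw [this]
  simp

theorem weyl_neg_mul_weyl (f : E) : weyl (-f) * weyl f = 1 := by
  simpa using weyl_mul_weyl_neg (-f)

theorem inner_weyl (f : E) (x y : Fock E) : inner ℂ (weyl f x) (weyl f y) = inner ℂ x y := by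
  induction x, y using UniformSpace.Completion.induction_on₂ with
  | hp => exact isClosed_eq (by fun_prop) (by fun_prop)
  | ih x y =>
    rw [weyl_coe, weyl_coe, UniformSpace.Completion.inner_coe, UniformSpace.Completion.inner_coe,
      inner_weylPre]

/-- An isometry with the right inverse `W(-f)` is unitary, with that inverse as its adjoint. -/
theorem star_weyl (f : E) : star (weyl f) = weyl (-f) := by
  have h : star (weyl f) * weyl f = 1 := by
    ext1 x
    refine ext_inner_right ℂ fun y => ?_
    change inner ℂ (ContinuousLinearMap.adjoint (weyl f) (weyl f x)) y = inner ℂ x y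
    rw [ContinuousLinearMap.adjoint_inner_left, inner_weyl]
  calc star (weyl f) = star (weyl f) * (weyl f * weyl (-f)) := by
        rw [weyl_mul_weyl_neg, mul_one]
    _ = weyl (-f) := by rw [← mul_assoc, h, one_mul]

/-- The Weyl operator as a unitary. -/
def weylU (f : E) : unitary (Fock E →L[ℂ] Fock E) :=
  ⟨weyl f, by
    rw [Unitary.mem_iff, star_weyl]
    exact ⟨weyl_neg_mul_weyl f, weyl_mul_weyl_neg f⟩⟩

theorem weyl_conj (f g : E) : weyl f * weyl g * star (weyl f) =
    Complex.exp (-(2 * Complex.I * (inner ℂ f g).im)) • weyl g := by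
  rw [weyl_mul_comm, smul_mul_assoc, mul_assoc (weyl g), star_weyl, weyl_mul_weyl_neg, mul_one]

/-- `Ad W(f)`. -/
def adWeyl (f : E) : (Fock E →L[ℂ] Fock E) ≃⋆ₐ[ℂ] (Fock E →L[ℂ] Fock E) :=
  Unitary.conjStarAlgAut ℂ _ (weylU f)

theorem adWeyl_apply (f : E) (x : Fock E →L[ℂ] Fock E) :
    adWeyl f x = weyl f * x * star (weyl f) := rfl

theorem adWeyl_symm_apply (f : E) (x : Fock E →L[ℂ] Fock E) :
    (adWeyl f).symm x = adWeyl (-f) x := by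
  rw [adWeyl_apply, star_weyl, neg_neg, ← star_weyl]
  rfl

/-- `W` is only a projective representation of the additive group of `E`, but its phases cancel in
conjugations. This is what makes `β` a genuine action. -/
theorem adWeyl_adWeyl (f g : E) (x : Fock E →L[ℂ] Fock E) :
    adWeyl f (adWeyl g x) = adWeyl (f + g) x := by
  simp only [adWeyl_apply]
  have h : weyl f * (weyl g * x * star (weyl g)) * star (weyl f) =
      (weyl f * weyl g) * x * star (weyl f * weyl g) := by
    rw [star_mul]; simp only [mul_assoc]
  rw [h, weyl_mul, star_smul, smul_mul_assoc, smul_mul_assoc, mul_smul_comm, smul_smul,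
    RCLike.star_def, ← Complex.exp_conj, ← Complex.exp_add]
  convert one_smul ℂ _
  simp

theorem dense_span_coherent :
    Dense (Submodule.span ℂ (Set.range (coherent : E → Fock E)) : Set (Fock E)) := by
  rw [Submodule.dense_iff_topologicalClosure_eq_top, Submodule.topologicalClosure_eq_top_iff,
    Submodule.eq_bot_iff]
  intro x hx
  have : innerSL ℂ x = 0 := fock_ext fun f =>
    (Submodule.mem_orthogonal' _ _).1 hx _ (Submodule.subset_span ⟨f, rfl⟩)
  refine (inner_self_eq_zero (𝕜 := ℂ)).1 ?_
  rw [← innerSL_apply_apply ℂ, this]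
  rfl

theorem continuous_coherent : Continuous (coherent : E → Fock E) := by
  rw [continuous_iff_continuousAt]
  intro f
  rw [ContinuousAt, tendsto_iff_norm_sub_tendsto_zero]
  have h : ∀ g : E, ‖coherent g - coherent f‖ =
      √(Complex.exp (inner ℂ g g) - 2 * Complex.exp (inner ℂ g f) +
        Complex.exp (inner ℂ f f)).re := by
    intro g
    rw [@norm_eq_sqrt_re_inner ℂ, @inner_sub_sub_self ℂ, inner_coherent, inner_coherent,
      inner_coherent, inner_coherent, ← inner_conj_symm f g, Complex.exp_conj]
    congr 1
    simp
    ring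
  simp only [h]
  have hc : Continuous fun g : E => √(Complex.exp (inner ℂ g g) - 2 * Complex.exp (inner ℂ g f) +
        Complex.exp (inner ℂ f f)).re := by fun_prop
  convert hc.tendsto f using 2
  simp
  ring_nf
  simp

/-- `f ↦ W(f)` is strongly continuous. -/
theorem continuous_weyl_apply (ξ : Fock E) : Continuous fun f : E => weyl f ξ := by
  have hdense : ∀ ξ ∈ Submodule.span ℂ (Set.range (coherent : E → Fock E)),
      Continuous fun f : E => weyl f ξ := by
    intro ξ hξ
    induction hξ using Submodule.span_induction with
    | mem x hx =>
      obtain ⟨h, rfl⟩ := hx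
      simp only [weyl_coherent]
      have h1 : Continuous fun f : E => Complex.exp (-((‖f‖ ^ 2 / 2 : ℝ) : ℂ) - inner ℂ f h) := by
        fun_prop
      exact h1.smul (continuous_coherent.comp (continuous_id.add continuous_const))
    | zero => simpa using continuous_const
    | add x y _ _ hx hy =>
      simp only [map_add]
      exact hx.add hy
    | smul a x _ hx =>
      simp only [map_smul]
      exact hx.const_smul a
  rw [Metric.continuous_iff]
  intro f r hr
  obtain ⟨η, hη, hd⟩ := Metric.dense_iff.1 dense_span_coherent ξ (r / 3) (by positivity)
  obtain ⟨δ, hδ, hc⟩ := Metric.continuous_iff.1 (hdense η hd) f (r / 3) (by positivity)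
  refine ⟨δ, hδ, fun g hg => ?_⟩
  have hW : ∀ k : E, dist (weyl k ξ) (weyl k η) ≤ dist ξ η := fun k => by
    rw [dist_eq_norm, dist_eq_norm, ← map_sub]
    exact ((weyl k).le_of_opNorm_le (norm_weyl_le k) _).trans (one_mul _).le
  have hη' : dist ξ η < r / 3 := by rw [dist_comm]; exact hη
  calc dist (weyl g ξ) (weyl f ξ)
      ≤ dist (weyl g ξ) (weyl g η) + dist (weyl g η) (weyl f η) + dist (weyl f η) (weyl f ξ) :=
        dist_triangle4 _ _ _ _
    _ < r / 3 + r / 3 + r / 3 := by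
        have h1 := hW g
        have h2 := hW f
        rw [dist_comm (weyl f ξ)] at h2
        have h3 := hc g hg
        linarith
    _ = r := by ring

/-- A commutation relation with Weyl operators extends to the closure of the set of vectors. -/
theorem weyl_mem_of_closure (A : VonNeumannAlgebra (Fock E)) {S : Set E}
    (h : ∀ f ∈ S, weyl f ∈ A) : ∀ f ∈ closure S, weyl f ∈ A := by
  intro f hf
  refine mem_of_commute_commutant A fun y hy => ?_
  have hcl : IsClosed {f : E | ∀ ξ, y (weyl f ξ) = weyl f (y ξ)} := by
    simp only [Set.ofPred_forall]
    exact isClosed_iInter fun ξ => isClosed_eq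
      (y.continuous.comp (continuous_weyl_apply ξ)) (continuous_weyl_apply (y ξ))
  have := closure_minimal (t := {f : E | ∀ ξ, y (weyl f ξ) = weyl f (y ξ)})
    (fun g hg ξ => congrArg (fun X => X ξ) (hy _ (h g hg)).symm) hcl hf
  exact ContinuousLinearMap.ext this

/-- By strong continuity of `W`, passing to the closure adds no operators; the local current algebra
can thus be handled through smooth loops alone. -/
theorem secondQuantization_closure (S : Set E) :
    secondQuantization (closure S) = vnGen (weyl '' S) := by
  apply le_antisymm
  · refine vnGen_le ?_
    rintro _ ⟨f, hf, rfl⟩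
    exact weyl_mem_of_closure (vnGen (weyl '' S)) (fun g hg => mem_vnGen_of_mem ⟨g, hg, rfl⟩) f hf
  · refine vnGen_le ?_
    rintro _ ⟨f, hf, rfl⟩
    exact mem_vnGen_of_mem ⟨f, subset_closure hf, rfl⟩

/-- `Ad W(g)` leaves the algebras generated by Weyl operators invariant. -/
theorem adWeyl_mem (S : Set E) (g : E) {x : Fock E →L[ℂ] Fock E} (hx : x ∈ vnGen (weyl '' S)) :
    adWeyl g x ∈ vnGen (weyl '' S) := by
  have h : adWeyl g x ∈ vnGen (adWeyl g '' (weyl '' S)) := (mem_vnGen_image _ _).2 hx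
  refine vnGen_le (A := vnGen (weyl '' S)) ?_ h
  rintro _ ⟨_, ⟨f, hf, rfl⟩, rfl⟩
  rw [adWeyl_apply, weyl_conj]
  exact smul_mem_vn _ _ (mem_vnGen_of_mem ⟨f, hf, rfl⟩)

/-- Weak convergence of a bounded sequence of operators can be checked on total sets. -/
theorem tendsto_inner_of_dense_span {H : Type*} [NormedAddCommGroup H] [InnerProductSpace ℂ H]
    (T : ℕ → H →L[ℂ] H) (T₀ : H →L[ℂ] H) (C : ℝ) (hC : ∀ k, ‖T k‖ ≤ C) {S : Set H}
    (hS : Dense (Submodule.span ℂ S : Set H))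
    (h : ∀ x ∈ S, ∀ y ∈ S, Tendsto (fun k => inner ℂ x (T k y)) atTop (𝓝 (inner ℂ x (T₀ y))))
    (x y : H) : Tendsto (fun k => inner ℂ x (T k y)) atTop (𝓝 (inner ℂ x (T₀ y))) := by
  have hC0 : 0 ≤ C := (norm_nonneg _).trans (hC 0)
  have hT : ∀ k z, ‖T k z‖ ≤ C * ‖z‖ := fun k z => (T k).le_of_opNorm_le (hC k) z
  have step1 : ∀ x ∈ S, ∀ y, Tendsto (fun k => inner ℂ x (T k y)) atTop (𝓝 (inner ℂ x (T₀ y))) := by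
    intro x hx y
    -- The uniform norm bound makes these functions equicontinuous, so the set of `y` for which
    -- convergence holds is closed. It contains the dense span. The same argument is used afterwards
    -- in the other variable.
    have heq : Equicontinuous fun k y => inner ℂ x (T k y) := by
      refine (LipschitzWith.uniformEquicontinuous _ (Real.toNNReal (‖x‖ * C))
        fun k => LipschitzWith.of_dist_le_mul fun y z => ?_).equicontinuous
      rw [dist_eq_norm, dist_eq_norm, ← inner_sub_right, ← map_sub,
        Real.coe_toNNReal _ (by positivity), mul_assoc]
      exact (norm_inner_le_norm _ _).trans (by gcongr; exact hT _ _)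
    have hcl := heq.isClosed_setOfPred_tendsto (l := atTop) (f := fun y => inner ℂ x (T₀ y))
      (by fun_prop)
    refine closure_minimal (s := (Submodule.span ℂ S : Set H)) (fun z hz => ?_) hcl (hS y)
    change Tendsto (fun k => inner ℂ x (T k z)) atTop (𝓝 (inner ℂ x (T₀ z)))
    induction hz using Submodule.span_induction with
    | mem z hz => exact h x hx z hz
    | zero => simp
    | add z w _ _ hz hw => simpa only [map_add, inner_add_right] using hz.add hw
    | smul a z _ hz => simpa only [map_smul, inner_smul_right] using hz.const_mul a
  have heq : Equicontinuous fun k x => inner ℂ x (T k y) := by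
    refine (LipschitzWith.uniformEquicontinuous _ (Real.toNNReal (C * ‖y‖))
      fun k => LipschitzWith.of_dist_le_mul fun x z => ?_).equicontinuous
    rw [dist_eq_norm, dist_eq_norm, ← inner_sub_left, Real.coe_toNNReal _ (by positivity), mul_comm]
    exact (norm_inner_le_norm _ _).trans (by gcongr; exact hT _ _)
  have hcl := heq.isClosed_setOfPred_tendsto (l := atTop) (f := fun x => inner ℂ x (T₀ y))
    (by fun_prop)
  refine closure_minimal (s := (Submodule.span ℂ S : Set H)) (fun z hz => ?_) hcl (hS x)
  change Tendsto (fun k => inner ℂ z (T k y)) atTop (𝓝 (inner ℂ z (T₀ y)))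
  induction hz using Submodule.span_induction with
  | mem z hz => exact step1 z hz y
  | zero => simp
  | add z w _ _ hz hw => simpa only [inner_add_left] using hz.add hw
  | smul a z _ hz => simpa only [inner_smul_left] using hz.const_mul (conj a)

/-- If an operator commutes up to phases tending to `-1` with the Weyl operators of a bounded
sequence of vectors tending weakly to zero, it vanishes. -/
theorem eq_zero_of_weyl_anticommute (a : Fock E →L[ℂ] Fock E) (f : ℕ → E) (z : ℕ → ℂ) (C : ℝ)
    (hC : ∀ k, ‖f k‖ ≤ C) (hf : ∀ g : E, Tendsto (fun k => inner ℂ (f k) g) atTop (𝓝 0))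
    (hz : Tendsto z atTop (𝓝 (-1))) (ha : ∀ k, a * weyl (f k) = z k • (weyl (f k) * a)) :
    a = 0 := by
  -- This factor removes the scalar `e^{-‖f‖²/2}`: the matrix element of `r W(f)` between `e^g` and
  -- `e^h` is `exp((g, f) - (f, h) + (g, h))`, which tends to `(e^g, e^h)` as `f` tends weakly to
  -- zero. The bound on `‖f k‖` keeps the rescaled operators bounded.
  set r : ℕ → ℂ := fun k => Complex.exp ((‖f k‖ ^ 2 / 2 : ℝ) : ℂ) with hr
  have hC0 : 0 ≤ C := (norm_nonneg _).trans (hC 0)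
  have hbd : ∀ k, ‖r k • weyl (f k)‖ ≤ Real.exp (C ^ 2 / 2) := by
    intro k
    rw [norm_smul, hr, Complex.norm_exp, Complex.ofReal_re]
    calc _ ≤ Real.exp (‖f k‖ ^ 2 / 2) * 1 := by gcongr; exact norm_weyl_le _
      _ ≤ _ := by
        rw [mul_one]
        gcongr
        exact hC k
  have hlim := tendsto_inner_of_dense_span (fun k => r k • weyl (f k))
    (ContinuousLinearMap.id ℂ (Fock E)) _ hbd
    dense_span_coherent (by
      rintro _ ⟨g, rfl⟩ _ ⟨h, rfl⟩
      have e : ∀ k, inner ℂ (coherent g) ((r k • weyl (f k)) (coherent h)) =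
          Complex.exp (conj (inner ℂ (f k) g) - inner ℂ (f k) h + inner ℂ g h) := by
        intro k
        rw [smul_apply, weyl_coherent, smul_smul, inner_smul_right, inner_coherent, hr,
          ← Complex.exp_add, ← Complex.exp_add, inner_add_right, inner_conj_symm]
        congr 1
        ring
      simp only [e, ContinuousLinearMap.id_apply, inner_coherent]
      have h1 : Tendsto (fun k => conj (inner ℂ (f k) g) - inner ℂ (f k) h + inner ℂ g h) atTop
          (𝓝 (conj 0 - 0 + inner ℂ g h)) :=
        (((Complex.continuous_conj.tendsto _).comp (hf g)).sub (hf h)).add_const _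
      rw [map_zero, sub_zero, zero_add] at h1
      exact (Complex.continuous_exp.tendsto _).comp h1)
  ext1 ξ
  refine ext_inner_left ℂ fun η => ?_
  -- The two sides of the commutation relation converge weakly to `a` and to `-a`.
  have l1 := hlim (ContinuousLinearMap.adjoint a η) ξ
  have l2 := hz.mul (hlim η (a ξ))
  have e : ∀ k, inner ℂ (ContinuousLinearMap.adjoint a η) ((r k • weyl (f k)) ξ) =
      z k * inner ℂ η ((r k • weyl (f k)) (a ξ)) := by
    intro k
    have := congrArg (fun X => X ξ) (ha k)
    change a (weyl (f k) ξ) = z k • weyl (f k) (a ξ) at this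
    rw [ContinuousLinearMap.adjoint_inner_left, smul_apply, map_smul, this, smul_apply,
      inner_smul_right, inner_smul_right, inner_smul_right]
    ring
  simp only [e] at l1
  have := tendsto_nhds_unique l1 l2
  rw [ContinuousLinearMap.adjoint_inner_left, ContinuousLinearMap.id_apply,
    ContinuousLinearMap.id_apply] at this
  change _ = inner ℂ η (0 : Fock E)
  rw [inner_zero_right]
  linear_combination this / 2

end Weyl

/-! ### Fourier coefficients and the symplectic form -/

section Fourier

open Real MeasureTheory Filter Topology

open scoped ContDiff

/-- The Fourier coefficients of a real function on `[0, 2π]`. -/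
def fc (u : ℝ → ℝ) (k : ℤ) : ℂ :=
  (2 * π : ℂ)⁻¹ * ∫ θ in (0)..(2 * π), Complex.exp (-(Complex.I * k * θ)) * (u θ : ℂ)

theorem fc_eq_fourierCoeffOn (u : ℝ → ℝ) (k : ℤ) :
    fc u k = fourierCoeffOn (two_pi_pos) (fun θ => (u θ : ℂ)) k := by
  rw [fourierCoeffOn_eq_integral, fc, sub_zero, ← Complex.coe_smul, smul_eq_mul]
  congr 1
  · push_cast; rw [one_div]
  · refine intervalIntegral.integral_congr fun θ _ => ?_
    simp only [smul_eq_mul, fourier_coe_apply]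
    congr 2
    push_cast
    have : (π : ℂ) ≠ 0 := by exact_mod_cast pi_ne_zero
    field_simp

theorem fc_add {u v : ℝ → ℝ} (hu : Continuous u) (hv : Continuous v) (k : ℤ) :
    fc (fun θ => u θ + v θ) k = fc u k + fc v k := by
  unfold fc
  rw [← mul_add, ← intervalIntegral.integral_add]
  · congr 2
    ext θ
    push_cast
    ring
  · exact Continuous.intervalIntegrable (by fun_prop) _ _
  · exact Continuous.intervalIntegrable (by fun_prop) _ _

theorem fc_const_mul (c : ℝ) (u : ℝ → ℝ) (k : ℤ) : fc (fun θ => c * u θ) k = c * fc u k := by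
  have h : (fun θ : ℝ => Complex.exp (-(Complex.I * k * θ)) * ((c * u θ : ℝ) : ℂ)) =
      fun θ : ℝ => (c : ℂ) * (Complex.exp (-(Complex.I * k * θ)) * (u θ : ℂ)) := by
    ext θ
    push_cast
    ring
  unfold fc
  rw [h, intervalIntegral.integral_const_mul]
  ring

theorem fc_neg_index (u : ℝ → ℝ) (k : ℤ) : fc u (-k) = conj (fc u k) := by
  unfold fc
  rw [map_mul, intervalIntegral.integral_of_le two_pi_pos.le,
    intervalIntegral.integral_of_le two_pi_pos.le, ← integral_conj,
    ← intervalIntegral.integral_of_le two_pi_pos.le,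
    ← intervalIntegral.integral_of_le two_pi_pos.le]
  congr 1
  · rw [map_inv₀, map_mul, Complex.conj_ofReal, Complex.conj_ofNat]
  · refine intervalIntegral.integral_congr fun θ _ => ?_
    simp only [map_mul, ← Complex.exp_conj, map_neg, Complex.conj_I, Complex.conj_ofReal,
      map_intCast]
    push_cast
    ring_nf

theorem norm_fc_le (u : ℝ → ℝ) (k : ℤ) : ‖fc u k‖ ≤ (2 * π)⁻¹ * ∫ θ in (0)..(2 * π), |u θ| := by
  rw [fc, norm_mul, norm_inv]
  have h1 : ‖(2 * π : ℂ)‖ = 2 * π := by simp [abs_of_pos pi_pos]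
  rw [h1]
  gcongr
  refine (intervalIntegral.norm_integral_le_integral_norm (by positivity)).trans (le_of_eq ?_)
  congr 1
  ext θ
  have : -(Complex.I * k * (θ : ℂ)) = ((-(k * θ) : ℝ) : ℂ) * Complex.I := by push_cast; ring
  rw [norm_mul, this, Complex.norm_exp_ofReal_mul_I, one_mul, Complex.norm_real, norm_eq_abs]

theorem fc_const (c : ℝ) {k : ℤ} (hk : k ≠ 0) : fc (fun _ => c) k = 0 := by
  unfold fc
  rw [integral_exp_mul_eq k hk (fun _ => c) (fun _ => 0) (fun θ => hasDerivAt_const θ c)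
    continuous_const rfl]
  simp

theorem fc_deriv {u u' : ℝ → ℝ} (hu : ∀ θ, HasDerivAt u (u' θ) θ) (hu' : Continuous u')
    (hp : u (2 * π) = u 0) (k : ℤ) : fc u' k = Complex.I * k * fc u k := by
  -- At `k = 0` the formula says that the derivative of a periodic function has integral zero;
  -- integration by parts covers only `k ≠ 0`.
  rcases eq_or_ne k 0 with rfl | hk
  · have := intervalIntegral.integral_eq_sub_of_hasDerivAt (a := 0) (b := 2 * π)
      (fun θ _ => hu θ) (hu'.intervalIntegrable _ _)
    rw [hp, sub_self] at this
    have h2 : ∫ θ in (0)..(2 * π), (u' θ : ℂ) = 0 := by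
      rw [intervalIntegral.integral_ofReal, this, Complex.ofReal_zero]
    simp [fc, h2]
  · unfold fc
    rw [integral_exp_mul_eq k hk u u' hu hu' hp]
    have : (k : ℂ) ≠ 0 := by exact_mod_cast hk
    field_simp [Complex.I_ne_zero]

theorem hasSum_norm_sq_fc {u : ℝ → ℝ} (hu : Continuous u) :
    HasSum (fun k : ℤ => ‖fc u k‖ ^ 2) ((2 * π)⁻¹ * ∫ θ in (0)..(2 * π), u θ ^ 2) := by
  have h := hasSum_sq_fourierCoeffOn (a := 0) (b := 2 * π) two_pi_pos (f := fun θ => (u θ : ℂ)) (by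
    have hb := (isCompact_Icc (a := (0 : ℝ)) (b := 2 * π)).exists_bound_of_continuousOn
      hu.continuousOn
    obtain ⟨C, hC⟩ := hb
    refine MemLp.of_bound (by fun_prop) C ?_
    rw [ae_restrict_iff' measurableSet_Ioc]
    refine Eventually.of_forall fun x hx => ?_
    rw [Complex.norm_real]
    exact hC x (Set.Ioc_subset_Icc_self hx))
  simp only [← fc_eq_fourierCoeffOn, sub_zero, Complex.norm_real, norm_eq_abs, sq_abs,
    smul_eq_mul] at h
  exact h

/-- Parseval's formula, polarized. -/
theorem hasSum_re_fc_mul_fc {u v : ℝ → ℝ} (hu : Continuous u) (hv : Continuous v) :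
    HasSum (fun k : ℤ => (conj (fc u k) * fc v k).re)
      ((2 * π)⁻¹ * ∫ θ in (0)..(2 * π), u θ * v θ) := by
  have h1 := hasSum_norm_sq_fc (hu.add hv)
  have h2 := hasSum_norm_sq_fc hu
  have h3 := hasSum_norm_sq_fc hv
  have h := ((h1.sub h2).sub h3).div_const 2
  have e1 : (fun k : ℤ => (conj (fc u k) * fc v k).re) =
      fun k => (‖fc (u + v) k‖ ^ 2 - ‖fc u k‖ ^ 2 - ‖fc v k‖ ^ 2) / 2 := by
    ext k
    have : fc (u + v) k = fc u k + fc v k := fc_add hu hv k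
    rw [this, ← Complex.normSq_eq_norm_sq, ← Complex.normSq_eq_norm_sq,
      ← Complex.normSq_eq_norm_sq, Complex.normSq_add]
    simp only [Complex.mul_re, Complex.conj_re, Complex.conj_im]
    ring
  refine Eq.mp (congrArg (fun r => HasSum _ r) ?_) (h.congr_fun fun k => congrFun e1 k)
  symm
  rw [← mul_sub, ← mul_sub, ← intervalIntegral.integral_sub, ← intervalIntegral.integral_sub,
    mul_div_assoc, ← intervalIntegral.integral_div]
  · congr 1
    refine intervalIntegral.integral_congr fun θ _ => ?_
    simp only [Pi.add_apply]
    ring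
  all_goals exact Continuous.intervalIntegrable (by fun_prop) _ _

/-- Parseval for `u` and `v'`, where the coefficients of `v'` are `ik` times those of `v`. Both
functions are real, so the terms at `k` and `-k` agree and the sum over `ℤ` is twice a sum over
positive frequencies. -/
theorem hasSum_im_fc_mul_fc {u v v' : ℝ → ℝ} (hu : Continuous u) (hv : ∀ θ, HasDerivAt v (v' θ) θ)
    (hv' : Continuous v') (hp : v (2 * π) = v 0) :
    HasSum (fun m : ℕ => -2 * ((m + 1 : ℝ) * (conj (fc v (-(m + 1 : ℤ))) * fc u (-(m + 1 : ℤ))).im))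
      ((2 * π)⁻¹ * ∫ θ in (0)..(2 * π), u θ * v' θ) := by
  have h := (hasSum_re_fc_mul_fc hu hv').nat_add_neg
  have h0 : (conj (fc u 0) * fc v' 0).re = 0 := by simp [fc_deriv hv hv' hp]
  rw [h0, add_zero] at h
  -- The vanishing zero mode is dropped, so that the index `m` now stands for the frequency `m + 1`,
  -- as in the one-particle space.
  rw [← hasSum_nat_add_iff' 1] at h
  simp only [Finset.range_one, Finset.sum_singleton, Nat.cast_zero, neg_zero, h0, add_zero,
    sub_zero] at h
  refine h.congr_fun fun m => ?_
  rw [fc_neg_index u, fc_neg_index v', fc_deriv hv hv' hp, fc_neg_index u, fc_neg_index v]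
  push_cast
  simp
  ring

end Fourier

/-! ### Arcs and step functions -/

section Arcs

open Real Filter Topology

open scoped ContDiff

theorem mem_arc_iff {a b θ : ℝ} : Circle.exp θ ∈ Circle.exp '' Set.Ioo a b ↔
    ∃ k : ℤ, θ + k * (2 * π) ∈ Set.Ioo a b := by
  constructor
  · rintro ⟨t, ht, e⟩
    obtain ⟨m, hm⟩ := Circle.exp_eq_exp.1 e
    refine ⟨m, ?_⟩
    rwa [← hm]
  · rintro ⟨k, hk⟩
    exact ⟨_, hk, Circle.exp_eq_exp.2 ⟨k, rfl⟩⟩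

theorem exists_add_mem_Ico (a θ : ℝ) : ∃ k : ℤ, θ + k * (2 * π) ∈ Set.Ico a (a + 2 * π) := by
  obtain ⟨k, hk, -⟩ := existsUnique_add_zsmul_mem_Ico two_pi_pos θ a
  exact ⟨k, by simpa using hk⟩

theorem notMem_arc {a b θ : ℝ} (hθ : θ ∈ Set.Icc b (a + 2 * π)) (hab : a < b) :
    Circle.exp θ ∉ Circle.exp '' Set.Ioo a b := by
  rw [mem_arc_iff]
  rintro ⟨k, h1, h2⟩
  obtain ⟨h3, h4⟩ := hθ
  have hp := two_pi_pos
  -- A translate of `θ ≥ b` lying below `b` uses `k ≤ -1`, but then it is at most `a` because `θ ≤ a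
  -- + 2π`.
  have hk1 : (k : ℝ) < 0 := by
    by_contra hk
    have : 0 ≤ (k : ℝ) * (2 * π) := mul_nonneg (not_lt.1 hk) hp.le
    linarith
  have hk2 : k ≤ -1 := by
    have : k < 0 := by exact_mod_cast hk1
    omega
  have hk3 : (k : ℝ) ≤ -1 := by exact_mod_cast hk2
  nlinarith

/-- A smooth step function with steps at `[c, c + δ] + 2πℤ`. -/
def stdStep (c δ θ : ℝ) : ℝ :=
  2 * π * (⌊(θ - c) / (2 * π)⌋ + smoothTransition ((θ - c - ⌊(θ - c) / (2 * π)⌋ * (2 * π)) / δ))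

/-- The window extends to the left of the jump of the floor: there the floor is `k - 1` and its
transition has already reached `1`, while the transition of the formula for `k` is still `0`. One
smooth formula is therefore valid across the jump, which gives smoothness of `stdStep`. -/
theorem stdStep_eq {c δ : ℝ} (hδ : 0 < δ) (k : ℤ) {θ : ℝ}
    (h : θ - k * (2 * π) ∈ Set.Ioo (c + δ - 2 * π) (c + 2 * π)) :
    stdStep c δ θ = 2 * π * (k + smoothTransition ((θ - c - k * (2 * π)) / δ)) := by
  have hp := two_pi_pos
  obtain ⟨h1, h2⟩ := h
  rcases le_or_gt (c + k * (2 * π)) θ with h3 | h3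
  · have hf : ⌊(θ - c) / (2 * π)⌋ = k := by
      rw [Int.floor_eq_iff, le_div_iff₀ hp, div_lt_iff₀ hp]
      constructor <;> linarith
    rw [stdStep, hf]
  · have hf : ⌊(θ - c) / (2 * π)⌋ = k - 1 := by
      rw [Int.floor_eq_iff, le_div_iff₀ hp, div_lt_iff₀ hp]
      push_cast
      constructor <;> linarith
    rw [stdStep, hf, smoothTransition.one_of_one_le, smoothTransition.zero_of_nonpos]
    · push_cast; ring
    · exact div_nonpos_of_nonpos_of_nonneg (by linarith) hδ.le
    · rw [le_div_iff₀ hδ]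
      push_cast
      linarith

theorem contDiff_stdStep {c δ : ℝ} (hδ : 0 < δ) (hδ' : δ < 2 * π) : ContDiff ℝ ∞ (stdStep c δ) := by
  have hp := two_pi_pos
  rw [contDiff_iff_contDiffAt]
  intro θ
  obtain ⟨k, hk⟩ : ∃ k : ℤ, k = ⌊(θ - c) / (2 * π)⌋ := ⟨_, rfl⟩
  obtain ⟨h1, h2⟩ := Int.floor_eq_iff.1 hk.symm
  rw [le_div_iff₀ hp] at h1
  rw [div_lt_iff₀ hp] at h2
  have hev : stdStep c δ =ᶠ[𝓝 θ]
      fun θ => 2 * π * (k + smoothTransition ((θ - c - k * (2 * π)) / δ)) := by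
    have hopen : IsOpen {t : ℝ | t - k * (2 * π) ∈ Set.Ioo (c + δ - 2 * π) (c + 2 * π)} :=
      isOpen_Ioo.preimage (by fun_prop)
    filter_upwards [hopen.mem_nhds (show θ ∈ {t : ℝ | _} by
      constructor <;> linarith)] with t ht
    exact stdStep_eq hδ k ht
  refine ContDiffAt.congr_of_eventuallyEq ?_ hev
  have hs : ContDiff ℝ ∞ smoothTransition := smoothTransition.contDiff
  exact (contDiff_const.mul (contDiff_const.add (hs.comp (by fun_prop)))).contDiffAt

theorem stdStep_add_two_pi (c δ θ : ℝ) : stdStep c δ (θ + 2 * π) = stdStep c δ θ + 2 * π := by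
  have hp := two_pi_pos
  have hf : (θ + 2 * π - c) / (2 * π) = (θ - c) / (2 * π) + 1 := by field_simp; ring
  rw [stdStep, stdStep, hf, Int.floor_add_one]
  push_cast
  have : θ + 2 * π - c - (⌊(θ - c) / (2 * π)⌋ + 1) * (2 * π) =
    θ - c - ⌊(θ - c) / (2 * π)⌋ * (2 * π) := by ring
  rw [this]
  ring

/-- The standard step function of an arc. -/
def stdStepFunction {c δ : ℝ} (hδ : 0 < δ) (hδ' : δ < 2 * π) :
    StepFunction (Circle.exp '' Set.Ioo c (c + δ)) where
  toFun := stdStep c δ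
  smooth := contDiff_stdStep hδ hδ'
  map_add_two_pi := stdStep_add_two_pi c δ
  off_interval θ hθ := by
    have hp := two_pi_pos
    obtain ⟨k, hk⟩ : ∃ k : ℤ, k = ⌊(θ - c) / (2 * π)⌋ := ⟨_, rfl⟩
    obtain ⟨h1, h2⟩ := Int.floor_eq_iff.1 hk.symm
    rw [le_div_iff₀ hp] at h1
    rw [div_lt_iff₀ hp] at h2
    have he := stdStep_eq hδ k (θ := θ) (c := c) (by constructor <;> linarith)
    have hn : ¬ (θ + (-k : ℤ) * (2 * π) ∈ Set.Ioo c (c + δ)) := fun h =>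
      hθ (mem_arc_iff.2 ⟨-k, h⟩)
    push_cast at hn
    rcases le_or_gt (θ - k * (2 * π)) c with h3 | h3
    · refine ⟨k, ?_⟩
      rw [he, smoothTransition.zero_of_nonpos, add_zero]
      exact div_nonpos_of_nonpos_of_nonneg (by linarith) hδ.le
    · refine ⟨k + 1, ?_⟩
      rw [he, smoothTransition.one_of_one_le]
      · push_cast; ring
      · rw [le_div_iff₀ hδ]
        by_contra h4
        exact hn ⟨by linarith, by linarith⟩

theorem nonempty_stepFunction {I : Set Circle} (hI : IsProperInterval I) :
    Nonempty (StepFunction I) := by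
  obtain ⟨a, b, hab, hb, rfl⟩ := hI
  have h := stdStepFunction (c := a) (δ := b - a) (by linarith) (by linarith)
  rw [add_sub_cancel] at h
  exact ⟨h⟩

/-- A continuous function on the complementary arc with values in a discrete set is constant. -/
theorem eq_of_mem_discrete {X : Type*} [TopologicalSpace X] {T : Set X} [DiscreteTopology T]
    {s : Set ℝ} (hs : IsPreconnected s) {g : ℝ → X} (hg : Continuous g) (h : ∀ θ ∈ s, g θ ∈ T)
    {x y : ℝ} (hx : x ∈ s) (hy : y ∈ s) : g x = g y :=
  hs.constant_of_mapsTo ⟨inferInstance⟩ hg.continuousOn h hx hy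

theorem discreteTopology_two_pi_int :
    DiscreteTopology ({x : ℝ | ∃ k : ℤ, x = 2 * π * k} : Set ℝ) := by
  have : ({x : ℝ | ∃ k : ℤ, x = 2 * π * k} : Set ℝ) = AddSubgroup.zmultiples (2 * π) := by
    ext x
    rw [SetLike.mem_coe, AddSubgroup.mem_zmultiples_iff]
    constructor
    · rintro ⟨k, rfl⟩; exact ⟨k, by rw [zsmul_eq_mul, mul_comm]⟩
    · rintro ⟨k, rfl⟩; exact ⟨k, by rw [zsmul_eq_mul, mul_comm]⟩
  rw [this]
  exact inferInstanceAs (DiscreteTopology (AddSubgroup.zmultiples (2 * π)))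

/-- Off `I` the values lie in the discrete set `2πℤ`, so continuity forbids any change along a
connected set. -/
theorem StepFunction.eq_of_isPreconnected {I : Set Circle} (M : StepFunction I) {s : Set ℝ}
    (hs : IsPreconnected s) (h : ∀ θ ∈ s, Circle.exp θ ∉ I) {x y : ℝ} (hx : x ∈ s) (hy : y ∈ s) :
    M.toFun x = M.toFun y := by
  have := discreteTopology_two_pi_int
  exact eq_of_mem_discrete (T := {x : ℝ | ∃ k : ℤ, x = 2 * π * k}) hs M.smooth.continuous (fun θ hθ => M.off_interval θ (h θ hθ)) hx hy

theorem StepFunction.deriv_eq_zero {I : Set Circle} (M : StepFunction I) {x y θ : ℝ}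
    (h : ∀ θ ∈ Set.Ioo x y, Circle.exp θ ∉ I) (hθ : θ ∈ Set.Ioo x y) : deriv M.toFun θ = 0 := by
  have : M.toFun =ᶠ[𝓝 θ] fun _ => M.toFun θ := by
    filter_upwards [isOpen_Ioo.mem_nhds hθ] with t ht
    exact M.eq_of_isPreconnected isPreconnected_Ioo h ht hθ
  rw [this.deriv_eq, deriv_const]

theorem StepFunction.periodic_deriv {I : Set Circle} (M : StepFunction I) :
    Function.Periodic (deriv M.toFun) (2 * π) := by
  intro θ
  have e : (fun θ => M.toFun (θ + 2 * π)) = fun θ => M.toFun θ + 2 * π := funext M.map_add_two_pi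
  have := deriv_comp_add_const M.toFun (2 * π) θ
  rw [e, deriv_add_const] at this
  exact this.symm

theorem arc_disjoint {a b θ : ℝ} (hb : b < a + 2 * π)
    (h : Circle.exp θ ∈ Circle.exp '' Set.Ioo a b) :
    Circle.exp θ ∉ Circle.exp '' Set.Ioo b (a + 2 * π) := by
  obtain ⟨t, ht, e⟩ := h
  -- The roles of the two arcs are exchanged: `t + 2π` lies in the complement of `(b, a + 2π)`
  -- within one period starting at `b`.
  rw [← e, ← Circle.exp_add_two_pi t]
  exact notMem_arc (a := b) (b := a + 2 * π) ⟨by linarith [ht.1], by linarith [ht.2]⟩ hb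

/-- A step function for the complementary arc is locally constant on the arc. -/
theorem StepFunction.deriv_eq_zero_of_mem {a b θ : ℝ} (hb : b < a + 2 * π)
    (N : StepFunction (Circle.exp '' Set.Ioo b (a + 2 * π)))
    (h : Circle.exp θ ∈ Circle.exp '' Set.Ioo a b) : deriv N.toFun θ = 0 := by
  obtain ⟨k, hk⟩ := mem_arc_iff.1 h
  have h1 := N.deriv_eq_zero (θ := θ + k * (2 * π)) (x := a) (y := b)
    (fun t ht => arc_disjoint hb ⟨t, ht, rfl⟩) hk
  have h2 := N.periodic_deriv.int_mul k θ
  rw [← h2, h1]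

end Arcs

/-! ### The one-particle vectors of loops -/

section LoopVec

open Real MeasureTheory Filter Topology

open scoped ContDiff

variable {n : ℕ}

theorem Loop.vec_apply (f : Loop n) (m : ℕ) (j : Fin n) :
    f.vec m j = (√(m + 1 : ℝ) : ℂ) * fc (fun θ => f θ j) (-(m + 1 : ℤ)) := rfl

theorem Loop.contDiff_coord (f : Loop n) (j : Fin n) : ContDiff ℝ ∞ fun θ => f θ j :=
  (contDiff_euclidean.1 f.smooth) j

theorem Loop.continuous_coord (f : Loop n) (j : Fin n) : Continuous fun θ => f θ j :=
  (f.contDiff_coord j).continuous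

theorem vec_ext {x y : OneParticle n} (h : ∀ m j, x m j = y m j) : x = y := by
  ext m j
  exact h m j

/-- The class `[f]` is additive in `f` and independent of constants. -/
theorem Loop.vec_eq_add {f g h : Loop n} {c : EuclideanSpace ℝ (Fin n)}
    (e : ∀ θ, f θ = g θ + h θ + c) : f.vec = g.vec + h.vec := by
  refine vec_ext fun m j => ?_
  change _ = g.vec m j + h.vec m j
  have hk : (-(m + 1 : ℤ)) ≠ 0 := by omega
  have e1 : (fun θ => f θ j) = fun θ => (g θ j + h θ j) + c j := by
    ext θ; rw [e]; rfl
  rw [Loop.vec_apply, Loop.vec_apply, Loop.vec_apply, e1,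
    fc_add (u := fun θ => g θ j + h θ j) (v := fun _ => c j)
      ((g.continuous_coord j).add (h.continuous_coord j)) continuous_const,
    fc_add (g.continuous_coord j) (h.continuous_coord j), fc_const _ hk]
  ring

theorem Loop.vec_eq_zero {f : Loop n} {c : EuclideanSpace ℝ (Fin n)} (e : ∀ θ, f θ = c) :
    f.vec = 0 := by
  -- The constant `c` equals `c + c - c`, so additivity modulo constants forces the vector to equal
  -- its double.
  have h : f.vec = f.vec + f.vec := Loop.vec_eq_add (c := -c) fun θ => by rw [e]; abel
  simpa using h

theorem Loop.vec_congr {f g : Loop n} {c : EuclideanSpace ℝ (Fin n)} (e : ∀ θ, f θ = g θ + c) :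
    f.vec = g.vec := by
  let z : Loop n := ⟨fun _ => 0, contDiff_const, fun _ => rfl⟩
  have h : f.vec = g.vec + z.vec := Loop.vec_eq_add (c := c) fun θ => by
    change f θ = g θ + 0 + c
    rw [e, add_zero]
  rw [h, Loop.vec_eq_zero (f := z) fun _ => rfl, add_zero]

/-- The symplectic form is `-2 Im([g], [f]) = ∫ ⟨f, g'⟩ dθ/2π`. -/
theorem neg_two_mul_im_inner_vec (g f : Loop n) :
    -2 * (inner ℂ g.vec f.vec).im =
      (2 * π)⁻¹ * ∫ θ in (0)..(2 * π), inner ℝ (f θ) (deriv g.toFun θ) := by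
  have hd : ∀ j θ, HasDerivAt (fun θ => g θ j) (deriv g.toFun θ j) θ := fun j θ =>
    ((EuclideanSpace.proj (𝕜 := ℝ) j).hasFDerivAt).comp_hasDerivAt θ
      (g.smooth.differentiable (by simp) θ).hasDerivAt
  have hc : Continuous (deriv g.toFun) := (contDiff_infty_iff_deriv.1 g.smooth).2.continuous
  have hcj : ∀ j, Continuous fun θ => deriv g.toFun θ j := fun j =>
    (EuclideanSpace.proj (𝕜 := ℝ) j).continuous.comp hc
  have h1 := hasSum_sum (s := Finset.univ) fun j (_ : j ∈ Finset.univ) =>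
    hasSum_im_fc_mul_fc (f.continuous_coord j) (hd j) (hcj j) (by
      have := g.periodic 0
      rw [zero_add] at this
      rw [this])
  have h2 := (Complex.hasSum_im (lp.hasSum_inner g.vec f.vec)).mul_left (-2)
  have e : (fun m : ℕ => -2 * (inner ℂ (g.vec m) (f.vec m)).im) = fun m : ℕ => ∑ j,
      -2 * ((m + 1 : ℝ) * (conj (fc (fun θ => g θ j) (-(m + 1 : ℤ))) *
        fc (fun θ => f θ j) (-(m + 1 : ℤ))).im) := by
    ext m
    rw [PiLp.inner_apply, Complex.im_sum, Finset.mul_sum]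
    refine Finset.sum_congr rfl fun j _ => ?_
    rw [Loop.vec_apply, Loop.vec_apply]
    have hs : (√(m + 1 : ℝ) : ℂ) * √(m + 1 : ℝ) = ((m + 1 : ℝ) : ℂ) := by
      rw [← Complex.ofReal_mul, mul_self_sqrt (by positivity)]
    have : inner ℂ ((√(m + 1 : ℝ) : ℂ) * fc (fun θ => g θ j) (-(m + 1 : ℤ)))
        ((√(m + 1 : ℝ) : ℂ) * fc (fun θ => f θ j) (-(m + 1 : ℤ))) =
        ((m + 1 : ℝ) : ℂ) * (conj (fc (fun θ => g θ j) (-(m + 1 : ℤ))) *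
          fc (fun θ => f θ j) (-(m + 1 : ℤ))) := by
      rw [← hs, RCLike.inner_apply, map_mul, Complex.conj_ofReal]
      ring
    rw [this, Complex.im_ofReal_mul]
  rw [e] at h2
  rw [h2.unique h1, ← Finset.mul_sum, ← intervalIntegral.integral_finsetSum]
  · congr 1
    refine intervalIntegral.integral_congr fun θ _ => ?_
    simp only [PiLp.inner_apply]
    refine Finset.sum_congr rfl fun j _ => ?_
    rw [RCLike.inner_apply, mul_comm]
    rfl
  · intro j _
    exact ((f.continuous_coord j).mul (hcj j)).intervalIntegrable _ _

theorem Loop.norm_vec_apply_sq {f : Loop n} {ψ : ℝ → ℝ} {v : EuclideanSpace ℝ (Fin n)}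
    (hf : ∀ θ, f θ = ψ θ • v) (m : ℕ) :
    ‖f.vec m‖ ^ 2 = ‖v‖ ^ 2 * ((m + 1 : ℝ) * ‖fc ψ (-(m + 1 : ℤ))‖ ^ 2) := by
  rw [EuclideanSpace.norm_sq_eq, EuclideanSpace.norm_sq_eq, Finset.sum_mul]
  refine Finset.sum_congr rfl fun j _ => ?_
  have e : (fun θ => f θ j) = fun θ => v j * ψ θ := by
    ext θ; rw [hf, mul_comm]; rfl
  rw [Loop.vec_apply, e, fc_const_mul, norm_mul, norm_mul, mul_pow, mul_pow, Complex.norm_real,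
    Complex.norm_real, norm_of_nonneg (sqrt_nonneg _), sq_sqrt (by positivity)]
  ring

/-- The interpolation estimate for the Sobolev norm of order one half. -/
theorem Loop.norm_vec_sq_le {f : Loop n} {ψ ψ' : ℝ → ℝ} {v : EuclideanSpace ℝ (Fin n)}
    (hf : ∀ θ, f θ = ψ θ • v) (hψ : ∀ θ, HasDerivAt ψ (ψ' θ) θ) (hψ' : Continuous ψ')
    (hp : ψ (2 * π) = ψ 0) {t : ℝ} (ht : 0 < t) :
    ‖f.vec‖ ^ 2 ≤ ‖v‖ ^ 2 * ((2 * π)⁻¹ * (t⁻¹ * (∫ θ in (0)..(2 * π), ψ θ ^ 2) +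
      t * ∫ θ in (0)..(2 * π), ψ' θ ^ 2)) := by
  have hψc : Continuous ψ := continuous_iff_continuousAt.2 fun θ => (hψ θ).continuousAt
  have h1 := lp.hasSum_norm (p := 2) (by norm_num) f.vec
  simp only [ENNReal.toReal_ofNat, rpow_ofNat, Loop.norm_vec_apply_sq hf] at h1
  have h2 := (((hasSum_norm_sq_fc hψc).mul_left t⁻¹).add
    ((hasSum_norm_sq_fc hψ').mul_left t)).mul_left (‖v‖ ^ 2)
  -- The norm only involves the negative frequencies `-(m + 1)`; the nonnegative terms at all other
  -- frequencies are added to reach the full Parseval sums.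
  refine (hasSum_le_inj (fun m : ℕ => -(m + 1 : ℤ)) (fun a b hab => by simpa using hab)
    (fun k _ => by positivity) (fun m => ?_) h1 h2).trans (le_of_eq (by ring))
  gcongr
  rw [fc_deriv hψ hψ' hp, norm_mul, norm_mul, Complex.norm_I, one_mul, mul_pow]
  have hk : ‖((-(m + 1 : ℤ) : ℤ) : ℂ)‖ ^ 2 = (m + 1 : ℝ) ^ 2 := by
    rw [Complex.norm_intCast, sq_abs]
    push_cast
    ring
  rw [hk]
  -- The inequality of arithmetic and geometric means: the weight of order one half is interpolated
  -- between the weights of `L²` and of the derivative, with `t` left free for later optimization.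
  have hm : (m + 1 : ℝ) ≤ t⁻¹ + t * (m + 1 : ℝ) ^ 2 := by
    have h3 : 0 ≤ t⁻¹ * (t * (m + 1 : ℝ) - 1) ^ 2 := by positivity
    have h4 : t⁻¹ * (t * (m + 1 : ℝ) - 1) ^ 2 = t * (m + 1 : ℝ) ^ 2 - 2 * (m + 1) + t⁻¹ := by
      field_simp
      ring
    have h5 : (0 : ℝ) ≤ m := by positivity
    linarith
  calc (m + 1 : ℝ) * ‖fc ψ (-(m + 1 : ℤ))‖ ^ 2
      ≤ (t⁻¹ + t * (m + 1 : ℝ) ^ 2) * ‖fc ψ (-(m + 1 : ℤ))‖ ^ 2 := by gcongr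
    _ = _ := by ring

/-- A bounded sequence in `ℓ²` which tends to zero in every coordinate tends weakly to zero. -/
theorem tendsto_inner_of_coord (x : ℕ → OneParticle n) (C : ℝ) (hC : ∀ k, ‖x k‖ ≤ C)
    (hx : ∀ m, Tendsto (fun k => x k m) atTop (𝓝 0)) (g : OneParticle n) :
    Tendsto (fun k => inner ℂ (x k) g) atTop (𝓝 0) := by
  have hC0 : 0 ≤ C := (norm_nonneg _).trans (hC 0)
  have heq : Equicontinuous fun k (y : OneParticle n) => inner ℂ (x k) y := by
    refine (LipschitzWith.uniformEquicontinuous _ (Real.toNNReal C)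
      fun k => LipschitzWith.of_dist_le_mul fun y z => ?_).equicontinuous
    rw [dist_eq_norm, dist_eq_norm, ← inner_sub_right, Real.coe_toNNReal _ hC0]
    exact (norm_inner_le_norm _ _).trans (by gcongr; exact hC k)
  have hcl := heq.isClosed_setOfPred_tendsto (l := atTop) (f := fun _ => (0 : ℂ))
    continuous_const
  -- The vectors `g` for which convergence holds form a closed set, and coordinatewise convergence
  -- handles the finite truncations of `g`.
  refine hcl.mem_of_tendsto (lp.hasSum_single (p := 2) (by norm_num) g)
    (Eventually.of_forall fun s => ?_)
  change Tendsto (fun k => inner ℂ (x k) (∑ m ∈ s, lp.single 2 m (g m))) atTop (𝓝 0)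
  simp only [inner_sum, lp.inner_single_right]
  have := tendsto_finsetSum s fun m _ => (hx m).inner (𝕜 := ℂ) (tendsto_const_nhds (x := g m))
  simpa using this

end LoopVec

/-! ### Cutoff functions -/

section Cutoff

open Real MeasureTheory Filter Topology

open scoped ContDiff

/-- The smooth periodic function which is one on `[a + δ, b - δ]` and zero off `(a, b)`. -/
def plateau (a b δ θ : ℝ) : ℝ := (stdStep a δ θ - stdStep (b - δ) δ θ) / (2 * π)

/-- A smooth periodic function supported in `[c - δ, c + δ]` which is one in `c`. -/
def bump (c δ θ : ℝ) : ℝ := (stdStep (c - δ) δ θ - stdStep c δ θ) / (2 * π)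

/-- The profile of `bump`. -/
def bumpProfile (x : ℝ) : ℝ := smoothTransition (x + 1) - smoothTransition x

theorem contDiff_plateau {a b δ : ℝ} (hδ : 0 < δ) (hδ' : δ < 2 * π) :
    ContDiff ℝ ∞ (plateau a b δ) :=
  ((contDiff_stdStep hδ hδ').sub (contDiff_stdStep hδ hδ')).div_const _

theorem contDiff_bump {c δ : ℝ} (hδ : 0 < δ) (hδ' : δ < 2 * π) : ContDiff ℝ ∞ (bump c δ) :=
  ((contDiff_stdStep hδ hδ').sub (contDiff_stdStep hδ hδ')).div_const _

theorem plateau_periodic (a b δ : ℝ) : Function.Periodic (plateau a b δ) (2 * π) := fun θ => by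
  rw [plateau, plateau, stdStep_add_two_pi, stdStep_add_two_pi, add_sub_add_right_eq_sub]

theorem bump_periodic (c δ : ℝ) : Function.Periodic (bump c δ) (2 * π) := fun θ => by
  rw [bump, bump, stdStep_add_two_pi, stdStep_add_two_pi, add_sub_add_right_eq_sub]

theorem stdStep_two_pi_add (c δ θ : ℝ) : stdStep (c + 2 * π) δ θ = stdStep c δ θ - 2 * π := by
  have h := stdStep_add_two_pi c δ (θ - 2 * π)
  rw [sub_add_cancel] at h
  have e : stdStep (c + 2 * π) δ θ = stdStep c δ (θ - 2 * π) := by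
    have : θ - (c + 2 * π) = θ - 2 * π - c := by ring
    rw [stdStep, stdStep, this]
  rw [e, h]
  ring

/-- The two plateaus contain upward steps at `a` and `b` and downward steps ending there. The last
one, at `a + 2π - δ`, is the step at `a - δ` lowered by `2π`, which accounts for the `1`; the
remaining steps combine into bumps. Modulo constants the sum therefore lives near the end points
only. -/
theorem plateau_add_plateau (a b δ θ : ℝ) :
    plateau a b δ θ + plateau b (a + 2 * π) δ θ = 1 - (bump a δ θ + bump b δ θ) := by
  have e : a + 2 * π - δ = (a - δ) + 2 * π := by ring
  rw [plateau, plateau, bump, bump, e, stdStep_two_pi_add]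
  field_simp
  ring

theorem plateau_eq {a b δ θ : ℝ} (hδ : 0 < δ) (hδ' : δ < b - a) (hb : b < a + 2 * π)
    (hθ : θ ∈ Set.Ico a (a + 2 * π)) :
    plateau a b δ θ = smoothTransition ((θ - a) / δ) - smoothTransition ((θ - (b - δ)) / δ) := by
  obtain ⟨h1, h2⟩ := hθ
  have hp := two_pi_pos
  rw [plateau, stdStep_eq hδ 0 (by constructor <;> push_cast <;> linarith),
    stdStep_eq hδ 0 (by constructor <;> push_cast <;> linarith)]
  push_cast
  field_simp
  ring_nf

theorem abs_plateau_le {a b δ : ℝ} (hδ : 0 < δ) (hδ' : δ < b - a) (hb : b < a + 2 * π) (θ : ℝ) :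
    |plateau a b δ θ| ≤ 1 := by
  obtain ⟨k, hk⟩ := exists_add_mem_Ico a θ
  rw [← (plateau_periodic a b δ).int_mul k θ, plateau_eq hδ hδ' hb hk, abs_le]
  have h1 := smoothTransition.nonneg ((θ + k * (2 * π) - a) / δ)
  have h2 := smoothTransition.le_one ((θ + k * (2 * π) - a) / δ)
  have h3 := smoothTransition.nonneg ((θ + k * (2 * π) - (b - δ)) / δ)
  have h4 := smoothTransition.le_one ((θ + k * (2 * π) - (b - δ)) / δ)
  constructor <;> linarith

theorem plateau_eq_one {a b δ θ : ℝ} (hδ : 0 < δ) (hδ' : δ < b - a) (hb : b < a + 2 * π)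
    (h1 : a + δ ≤ θ) (h2 : θ ≤ b - δ) : plateau a b δ θ = 1 := by
  rw [plateau_eq hδ hδ' hb ⟨by linarith, by linarith⟩, smoothTransition.one_of_one_le,
    smoothTransition.zero_of_nonpos, sub_zero]
  · exact div_nonpos_of_nonpos_of_nonneg (by linarith) hδ.le
  · rw [le_div_iff₀ hδ]; linarith

theorem plateau_eq_zero {a b δ θ : ℝ} (hδ : 0 < δ) (hδ' : δ < b - a) (hb : b < a + 2 * π)
    (hθ : Circle.exp θ ∉ Circle.exp '' Set.Ioo a b) : plateau a b δ θ = 0 := by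
  obtain ⟨k, hk⟩ := exists_add_mem_Ico a θ
  rw [← (plateau_periodic a b δ).int_mul k θ, plateau_eq hδ hδ' hb hk]
  have hn : ¬ (θ + k * (2 * π) ∈ Set.Ioo a b) := fun h => hθ (mem_arc_iff.2 ⟨k, h⟩)
  set t := θ + k * (2 * π)
  rcases hk.1.eq_or_lt with h | h
  · rw [smoothTransition.zero_of_nonpos, smoothTransition.zero_of_nonpos, sub_zero]
    · exact div_nonpos_of_nonpos_of_nonneg (by linarith) hδ.le
    · exact div_nonpos_of_nonpos_of_nonneg (by linarith) hδ.le
  · have hb' : b ≤ t := by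
      by_contra h'
      exact hn ⟨h, not_le.1 h'⟩
    rw [smoothTransition.one_of_one_le, smoothTransition.one_of_one_le, sub_self]
    · rw [le_div_iff₀ hδ]; linarith
    · rw [le_div_iff₀ hδ]; linarith

theorem bump_eq {c δ θ : ℝ} (hδ : 0 < δ)
    (hθ : θ ∈ Set.Ioo (c + δ - 2 * π) (c - δ + 2 * π)) :
    bump c δ θ = bumpProfile ((θ - c) / δ) := by
  obtain ⟨h1, h2⟩ := hθ
  rw [bump, stdStep_eq hδ 0 (by constructor <;> push_cast <;> linarith),
    stdStep_eq hδ 0 (by constructor <;> push_cast <;> linarith), bumpProfile]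
  have e : (θ - (c - δ) - (0 : ℤ) * (2 * π)) / δ = (θ - c) / δ + 1 := by
    push_cast
    field_simp
    ring
  rw [e]
  push_cast
  field_simp
  ring_nf

theorem contDiff_bumpProfile : ContDiff ℝ ∞ bumpProfile := by
  have h : ContDiff ℝ ∞ smoothTransition := smoothTransition.contDiff
  exact (h.comp (contDiff_id.add contDiff_const)).sub h

theorem bumpProfile_eq_zero {x : ℝ} (hx : x ∉ Set.Ioo (-1 : ℝ) 1) : bumpProfile x = 0 := by
  rw [Set.mem_Ioo, not_and_or, not_lt, not_lt] at hx
  rcases hx with h | h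
  · rw [bumpProfile, smoothTransition.zero_of_nonpos (by linarith),
      smoothTransition.zero_of_nonpos (by linarith), sub_zero]
  · rw [bumpProfile, smoothTransition.one_of_one_le (by linarith),
      smoothTransition.one_of_one_le (by linarith), sub_self]

theorem deriv_bumpProfile_eq_zero {x : ℝ} (hx : x ∉ Set.Icc (-1 : ℝ) 1) :
    deriv bumpProfile x = 0 := by
  have : bumpProfile =ᶠ[𝓝 x] fun _ => 0 := by
    filter_upwards [isClosed_Icc.isOpen_compl.mem_nhds hx] with y hy
    exact bumpProfile_eq_zero fun h => hy (Set.Ioo_subset_Icc_self h)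
  rw [this.deriv_eq, deriv_const]

/-- Rescaling of integrals of concentrating periodic functions. -/
theorem integral_concentrate {u g : ℝ → ℝ} {c δ : ℝ} (hδ : 0 < δ) (hδ' : δ < π / 2)
    (hu : Function.Periodic u (2 * π))
    (hug : ∀ θ ∈ Set.Ioo (c + δ - 2 * π) (c - δ + 2 * π), u θ = g ((θ - c) / δ))
    (hg : ∀ x, x ∉ Set.Icc (-1 : ℝ) 1 → g x = 0) :
    ∫ θ in (0)..(2 * π), u θ = δ * ∫ x, g x := by
  have hp := pi_pos
  -- The period is centred at `c`; as `δ < π / 2`, it lies in the window where `u` is given by its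
  -- profile.
  have h1 : ∫ θ in (0)..(2 * π), u θ = ∫ θ in (c - π)..(c + π), u θ := by
    have := hu.intervalIntegral_add_eq 0 (c - π)
    rw [zero_add] at this
    rw [this]
    congr 1
    ring
  have h2 : ∫ θ in (c - π)..(c + π), u θ = ∫ θ in (c - π)..(c + π), g ((θ - c) / δ) := by
    refine intervalIntegral.integral_congr fun θ hθ => hug θ ?_
    rw [Set.uIcc_of_le (by linarith)] at hθ
    constructor <;> linarith [hθ.1, hθ.2]
  have h3 : ∫ θ in (c - π)..(c + π), g ((θ - c) / δ) = δ * ∫ x in (-π / δ)..(π / δ), g x := by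
    have := intervalIntegral.integral_comp_sub_right (fun x => g (x / δ)) c (a := c - π) (b := c + π)
    rw [this, intervalIntegral.integral_comp_div _ hδ.ne', smul_eq_mul]
    congr 2 <;> ring
  rw [h1, h2, h3, intervalIntegral.integral_eq_integral_of_support_subset]
  intro x hx
  by_contra hx'
  refine hx (hg x fun h => hx' ?_)
  constructor
  · refine lt_of_lt_of_le ?_ h.1
    rw [div_lt_iff₀ hδ]
    linarith
  · refine h.2.trans ?_
    rw [le_div_iff₀ hδ]
    linarith

theorem integral_bump_sq {c δ : ℝ} (hδ : 0 < δ) (hδ' : δ < π / 2) :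
    ∫ θ in (0)..(2 * π), bump c δ θ ^ 2 = δ * ∫ x, bumpProfile x ^ 2 :=
  integral_concentrate hδ hδ' (fun θ => by simp only [bump_periodic c δ θ])
    (fun θ hθ => by rw [bump_eq hδ hθ])
    (fun x hx => by
      rw [bumpProfile_eq_zero fun h => hx (Set.Ioo_subset_Icc_self h)]
      simp)

theorem integral_abs_bump {c δ : ℝ} (hδ : 0 < δ) (hδ' : δ < π / 2) :
    ∫ θ in (0)..(2 * π), |bump c δ θ| = δ * ∫ x, |bumpProfile x| :=
  integral_concentrate hδ hδ' (fun θ => by simp only [bump_periodic c δ θ])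
    (fun θ hθ => by rw [bump_eq hδ hθ])
    (fun x hx => by
      rw [bumpProfile_eq_zero fun h => hx (Set.Ioo_subset_Icc_self h)]
      simp)

/-- The chain rule gives `δ⁻²` and the substitution gives `δ`. The resulting `δ⁻¹` balances the
factor `δ` of `integral_bump_sq`, which is the scale invariance of the norm of order one half. -/
theorem integral_deriv_bump_sq {c δ : ℝ} (hδ : 0 < δ) (hδ' : δ < π / 2) :
    ∫ θ in (0)..(2 * π), deriv (bump c δ) θ ^ 2 = δ⁻¹ * ∫ x, deriv bumpProfile x ^ 2 := by
  have hper : Function.Periodic (deriv (bump c δ)) (2 * π) := fun θ => by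
    have e : (fun θ => bump c δ (θ + 2 * π)) = bump c δ := funext (bump_periodic c δ)
    have := deriv_comp_add_const (bump c δ) (2 * π) θ
    rw [e] at this
    exact this.symm
  rw [integral_concentrate (g := fun x => (δ⁻¹ * deriv bumpProfile x) ^ 2) (c := c) hδ hδ'
    (fun θ => by simp only [hper θ])]
  · simp only [mul_pow]
    rw [integral_const_mul, ← mul_assoc]
    congr 1
    field_simp
  · intro θ hθ
    have : bump c δ =ᶠ[𝓝 θ] fun θ => bumpProfile ((θ - c) / δ) := by
      filter_upwards [isOpen_Ioo.mem_nhds hθ] with t ht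
      exact bump_eq hδ ht
    simp only [this.deriv_eq]
    have hd : HasDerivAt (fun θ => bumpProfile ((θ - c) / δ))
        (deriv bumpProfile ((θ - c) / δ) * (1 / δ)) θ :=
      HasDerivAt.comp θ (contDiff_bumpProfile.differentiable (by simp) _).hasDerivAt
        (((hasDerivAt_id θ).sub_const c).div_const δ)
    rw [hd.deriv, one_div, mul_comm]
  · intro x hx
    simp [deriv_bumpProfile_eq_zero hx]

end Cutoff

/-! ### Locality and freeness -/

section Free

open Real MeasureTheory Filter Topology

open scoped ContDiff

variable {n : ℕ}

/-- The loop `u v` of a periodic function `u` and a vector `v`. -/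
def smulLoop (u : ℝ → ℝ) (hu : ContDiff ℝ ∞ u) (hp : Function.Periodic u (2 * π))
    (v : EuclideanSpace ℝ (Fin n)) : Loop n where
  toFun θ := u θ • v
  smooth := hu.smul contDiff_const
  periodic θ := by simp only [hp θ]

theorem currentAlgebra_eq (I : Set Circle) :
    currentAlgebra n I = vnGen (weyl '' {v | ∃ f : Loop n, f.SupportedIn I ∧ f.vec = v}) :=
  secondQuantization_closure _

theorem weyl_mem_currentAlgebra {I : Set Circle} {f : Loop n} (hf : f.SupportedIn I) :
    weyl f.vec ∈ currentAlgebra n I := by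
  rw [currentAlgebra_eq]
  exact mem_vnGen_of_mem ⟨_, ⟨f, hf, rfl⟩, rfl⟩

theorem weyl_mem_currentAlgebra_of_const {I : Set Circle} {f : Loop n}
    {c : EuclideanSpace ℝ (Fin n)} (hf : ∀ θ : ℝ, Circle.exp θ ∉ I → f θ = c) :
    weyl f.vec ∈ currentAlgebra n I := by
  let g : Loop n := ⟨fun θ => f θ - c, f.smooth.sub contDiff_const, fun θ => by
    simp only [f.periodic θ]⟩
  have hg : g.SupportedIn I := fun θ hθ => by
    change f θ - c = 0
    rw [hf θ hθ, sub_self]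
  -- Subtracting the constant does not change the class in the one-particle space.
  rw [Loop.vec_congr (g := g) (c := c) fun θ => (sub_add_cancel _ _).symm]
  exact weyl_mem_currentAlgebra hg

/-- `W([g])` and `W([f])` commute up to the phase given by the symplectic form. -/
theorem weyl_vec_conj (g f : Loop n) : weyl g.vec * weyl f.vec * star (weyl g.vec) =
    (Circle.exp ((2 * π)⁻¹ * ∫ θ in (0)..(2 * π), inner ℝ (f θ) (deriv g.toFun θ)) : ℂ) •
      weyl f.vec := by
  rw [weyl_conj, ← neg_two_mul_im_inner_vec, Circle.coe_exp]
  congr 2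
  push_cast
  ring

/-- The integrand `⟨f, g'⟩` of the symplectic form vanishes pointwise: `g` is locally zero on the
open complementary arc, and off that arc `f` is zero. -/
theorem weyl_commute_of_disjoint {a b : ℝ} (hb : b < a + 2 * π) {f g : Loop n}
    (hg : g.SupportedIn (Circle.exp '' Set.Ioo a b))
    (hf : f.SupportedIn (Circle.exp '' Set.Ioo b (a + 2 * π))) :
    weyl g.vec * weyl f.vec = weyl f.vec * weyl g.vec := by
  have h : ∀ θ : ℝ, inner ℝ (f θ) (deriv g.toFun θ) = 0 := by
    intro θ
    by_cases hθ : Circle.exp θ ∈ Circle.exp '' Set.Ioo b (a + 2 * π)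
    · obtain ⟨k, hk⟩ := mem_arc_iff.1 hθ
      have hopen : IsOpen {t : ℝ | t + k * (2 * π) ∈ Set.Ioo b (a + 2 * π)} :=
        isOpen_Ioo.preimage (by fun_prop)
      have : g.toFun =ᶠ[𝓝 θ] fun _ => 0 := by
        filter_upwards [hopen.mem_nhds hk] with t ht
        refine hg t fun h => ?_
        exact arc_disjoint hb h (mem_arc_iff.2 ⟨k, ht⟩)
      rw [this.deriv_eq, deriv_const, inner_zero_right]
    · rw [hf θ hθ, inner_zero_left]
  have hc := weyl_vec_conj g f
  simp only [h, intervalIntegral.integral_zero, mul_zero, Circle.exp_zero, Circle.coe_one,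
    one_smul] at hc
  calc weyl g.vec * weyl f.vec = weyl g.vec * weyl f.vec * star (weyl g.vec) * weyl g.vec := by
        rw [mul_assoc _ (star _), star_weyl, weyl_neg_mul_weyl, mul_one]
    _ = _ := by rw [hc]

/-- Locality: the Weyl operator of a loop living on the complementary arc is in the commutant of the
generators and of their adjoints. -/
theorem currentAlgebra_commute {a b : ℝ} (hb : b < a + 2 * π) {f : Loop n}
    (hf : f.SupportedIn (Circle.exp '' Set.Ioo b (a + 2 * π)))
    {x : Fock (OneParticle n) →L[ℂ] Fock (OneParticle n)}
    (hx : x ∈ currentAlgebra n (Circle.exp '' Set.Ioo a b)) :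
    weyl f.vec * x = x * weyl f.vec := by
  rw [currentAlgebra_eq] at hx
  refine mem_vnGen_iff.1 hx _ ?_
  rintro _ ⟨_, ⟨g, hg, rfl⟩, rfl⟩
  have h := weyl_commute_of_disjoint hb hg hf
  refine ⟨h, ?_⟩
  rw [star_weyl]
  calc weyl (-g.vec) * weyl f.vec
      = weyl (-g.vec) * (weyl f.vec * weyl g.vec) * weyl (-g.vec) := by
        rw [mul_assoc, mul_assoc, weyl_mul_weyl_neg, mul_one]
    _ = weyl f.vec * weyl (-g.vec) := by
        rw [← h, ← mul_assoc, weyl_neg_mul_weyl, one_mul]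

/-- The plateaus tend boundedly to the indicator function of the arc, and all of the increment `2π`
of `M` over a period takes place there. The limit is the source of the phase `-1` in the proof of
freeness. -/
theorem tendsto_integral_plateau {a b : ℝ} (hab : a < b) (hb : b < a + 2 * π)
    (M : StepFunction (Circle.exp '' Set.Ioo a b)) {δ : ℕ → ℝ} (hδ : ∀ j, 0 < δ j)
    (hδ' : ∀ j, δ j < b - a) (hlim : Tendsto δ atTop (𝓝 0)) :
    Tendsto (fun j => ∫ θ in (0)..(2 * π), plateau a b (δ j) θ * deriv M.toFun θ) atTop
      (𝓝 (2 * π)) := by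
  have hp := two_pi_pos
  have hMc : Continuous (deriv M.toFun) := (contDiff_infty_iff_deriv.1 M.smooth).2.continuous
  have hpc : ∀ j, Continuous (plateau a b (δ j)) := fun j =>
    (contDiff_plateau (hδ j) (by linarith [hδ' j])).continuous
  have e1 : ∀ j, ∫ θ in (0)..(2 * π), plateau a b (δ j) θ * deriv M.toFun θ =
      ∫ θ in a..b, plateau a b (δ j) θ * deriv M.toFun θ := by
    intro j
    have hper : Function.Periodic (fun θ => plateau a b (δ j) θ * deriv M.toFun θ) (2 * π) :=
      fun θ => by simp only [plateau_periodic a b (δ j) θ, M.periodic_deriv θ]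
    have hci : ∀ x y, IntervalIntegrable (fun θ => plateau a b (δ j) θ * deriv M.toFun θ)
        volume x y := fun x y => ((hpc j).mul hMc).intervalIntegrable _ _
    have h1 := hper.intervalIntegral_add_eq 0 a
    rw [zero_add] at h1
    rw [h1, ← intervalIntegral.integral_add_adjacent_intervals (hci a b) (hci b _)]
    have h2 : ∫ θ in b..(a + 2 * π), plateau a b (δ j) θ * deriv M.toFun θ = 0 := by
      rw [← intervalIntegral.integral_zero (a := b) (b := a + 2 * π) (μ := volume)]
      refine intervalIntegral.integral_congr fun θ hθ => ?_
      rw [Set.uIcc_of_le hb.le] at hθ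
      rw [plateau_eq_zero (hδ j) (hδ' j) hb (notMem_arc hθ hab), zero_mul]
    rw [h2, add_zero]
  simp only [e1]
  -- `M` takes the same value at `b` and at `a + 2π`, being constant on the complementary arc.
  have e2 : ∫ θ in a..b, deriv M.toFun θ = 2 * π := by
    rw [intervalIntegral.integral_deriv_eq_sub
      (fun θ _ => M.smooth.differentiable (by simp) θ) (hMc.intervalIntegrable _ _)]
    have h1 := M.eq_of_isPreconnected (s := Set.Icc b (a + 2 * π)) isPreconnected_Icc
      (fun θ hθ => notMem_arc hθ hab) (Set.left_mem_Icc.2 hb.le) (Set.right_mem_Icc.2 hb.le)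
    rw [h1, M.map_add_two_pi]
    ring
  rw [← e2]
  refine intervalIntegral.tendsto_integral_filter_of_dominated_convergence
    (fun θ => |deriv M.toFun θ|) ?_ ?_ ?_ ?_
  · exact Eventually.of_forall fun j => ((hpc j).mul hMc).aestronglyMeasurable
  · refine Eventually.of_forall fun j => Eventually.of_forall fun θ _ => ?_
    rw [norm_mul, norm_eq_abs, norm_eq_abs]
    exact mul_le_of_le_one_left (abs_nonneg _) (abs_plateau_le (hδ j) (hδ' j) hb θ)
  · exact hMc.abs.intervalIntegrable _ _
  · have hne : ∀ᵐ θ : ℝ, θ ≠ b := by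
      simp [ae_iff, measure_singleton]
    filter_upwards [hne] with θ hθ hθ'
    rw [Set.uIoc_of_le hab.le] at hθ'
    have hlt : θ < b := lt_of_le_of_ne hθ'.2 hθ
    have hev : ∀ᶠ j in atTop, plateau a b (δ j) θ * deriv M.toFun θ = deriv M.toFun θ := by
      have h1 : ∀ᶠ j in atTop, δ j < min (θ - a) (b - θ) :=
        hlim.eventually_lt_const (lt_min (by linarith [hθ'.1]) (by linarith))
      filter_upwards [h1] with j hj
      have h2 := lt_min_iff.1 hj
      rw [plateau_eq_one (hδ j) (hδ' j) hb (by linarith [h2.1]) (by linarith [h2.2]), one_mul]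
    exact tendsto_const_nhds.congr' (hev.mono fun _ h => h.symm)

/-- The one-particle vectors of concentrating bumps. -/
theorem norm_vec_bump_sq_le {c δ : ℝ} (hδ : 0 < δ) (hδ' : δ < π / 2) {f : Loop n}
    {v : EuclideanSpace ℝ (Fin n)} (hf : ∀ θ, f θ = bump c δ θ • v) :
    ‖f.vec‖ ^ 2 ≤ ‖v‖ ^ 2 * ((2 * π)⁻¹ * ((∫ x, bumpProfile x ^ 2) +
      ∫ x, deriv bumpProfile x ^ 2)) := by
  have hp := pi_pos
  have hs := contDiff_bump (c := c) hδ (by linarith)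
  -- The interpolation parameter is taken to be `t = δ`, which makes the bound independent of `δ`.
  have h := Loop.norm_vec_sq_le hf
    (fun θ => (hs.differentiable (by simp) θ).hasDerivAt)
    (contDiff_infty_iff_deriv.1 hs).2.continuous
    (by have := bump_periodic c δ 0; rwa [zero_add] at this) hδ
  rw [integral_bump_sq hδ hδ', integral_deriv_bump_sq hδ hδ', inv_mul_cancel_left₀ hδ.ne',
    mul_inv_cancel_left₀ hδ.ne'] at h
  exact h

/-- The bumps have `L¹` norm of order `δ`, which bounds every Fourier coefficient. The norm in the
one-particle space is merely bounded, so only weak convergence results. -/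
theorem tendsto_vec_bump_apply {c : ℝ} {δ : ℕ → ℝ} (hδ : ∀ j, 0 < δ j)
    (hδ' : ∀ j, δ j < π / 2) (hlim : Tendsto δ atTop (𝓝 0)) {f : ℕ → Loop n}
    {v : EuclideanSpace ℝ (Fin n)} (hf : ∀ j θ, f j θ = bump c (δ j) θ • v) (m : ℕ) :
    Tendsto (fun j => (f j).vec m) atTop (𝓝 0) := by
  have h0 : Tendsto (fun j => ‖fc (bump c (δ j)) (-(m + 1 : ℤ))‖) atTop (𝓝 0) := by
    refine squeeze_zero (g := fun j => (2 * π)⁻¹ * (δ j * ∫ x, |bumpProfile x|))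
      (fun j => norm_nonneg _) (fun j => ?_) ?_
    · rw [← integral_abs_bump (hδ j) (hδ' j)]
      exact norm_fc_le _ _
    · simpa using (hlim.mul_const (∫ x, |bumpProfile x|)).const_mul (2 * π)⁻¹
  have h1 : Tendsto (fun j => ‖(f j).vec m‖ ^ 2) atTop (𝓝 0) := by
    simp only [Loop.norm_vec_apply_sq (hf _)]
    simpa using ((h0.pow 2).const_mul (m + 1 : ℝ)).const_mul (‖v‖ ^ 2)
  rw [tendsto_zero_iff_norm_tendsto_zero]
  have h2 := h1.sqrt
  simpa [sqrt_sq (norm_nonneg _)] using h2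

/-- The automorphisms given by step functions act freely on the local current algebra. -/
theorem eq_zero_of_intertwines {a b : ℝ} (hab : a < b) (hb : b < a + 2 * π)
    (M : StepFunction (Circle.exp '' Set.Ioo a b)) {α : EuclideanSpace ℝ (Fin n)} (hα : α ≠ 0)
    {x : Fock (OneParticle n) →L[ℂ] Fock (OneParticle n)}
    (hx : x ∈ currentAlgebra n (Circle.exp '' Set.Ioo a b))
    (h : ∀ f : Loop n, f.SupportedIn (Circle.exp '' Set.Ioo a b) → x * weyl f.vec =
      (Circle.exp ((2 * π)⁻¹ * ∫ θ in (0)..(2 * π), inner ℝ (f θ) (deriv M.toFun θ • α)) : ℂ) •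
        (weyl f.vec * x)) : x = 0 := by
  have hp := pi_pos
  -- Widths below `r` fit into both complementary arcs and into the range where the rescaling of
  -- integrals is valid.
  set r : ℝ := min (min (b - a) (a + 2 * π - b)) (π / 2) with hr
  have hr0 : 0 < r := lt_min (lt_min (by linarith) (by linarith)) (by linarith)
  set δ : ℕ → ℝ := fun j => r / 2 * (1 / (j + 1 : ℝ)) with hδd
  have hδ : ∀ j, 0 < δ j := fun j => by positivity
  have hδr : ∀ j, δ j < r := fun j => by
    have h1 : 1 / (j + 1 : ℝ) ≤ 1 := by
      rw [div_le_one (by positivity)]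
      have : (0 : ℝ) ≤ j := by positivity
      linarith
    calc δ j ≤ r / 2 * 1 := by simp only [hδd]; gcongr
      _ < r := by linarith
  have hδ1 : ∀ j, δ j < b - a := fun j =>
    (hδr j).trans_le ((min_le_left _ _).trans (min_le_left _ _))
  have hδ2 : ∀ j, δ j < a + 2 * π - b := fun j =>
    (hδr j).trans_le ((min_le_left _ _).trans (min_le_right _ _))
  have hδ3 : ∀ j, δ j < π / 2 := fun j => (hδr j).trans_le (min_le_right _ _)
  have hδ4 : ∀ j, δ j < 2 * π := fun j => by linarith [hδ3 j]
  have hlim : Tendsto δ atTop (𝓝 0) := by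
    simpa [hδd] using (tendsto_one_div_add_atTop_nhds_zero_nat (𝕜 := ℝ)).const_mul (r / 2)
  -- Normalized so that `⟨v, α⟩ = π`; this is where `α ≠ 0` enters.
  set v : EuclideanSpace ℝ (Fin n) := (π / ‖α‖ ^ 2) • α with hv
  have hvα : inner ℝ v α = π := by
    rw [hv, real_inner_smul_left, real_inner_self_eq_norm_sq]
    have : ‖α‖ ≠ 0 := norm_ne_zero_iff.2 hα
    field_simp
  let H : ℕ → Loop n := fun j =>
    smulLoop (plateau a b (δ j)) (contDiff_plateau (hδ j) (hδ4 j)) (plateau_periodic _ _ _) v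
  let K : ℕ → Loop n := fun j =>
    smulLoop (plateau b (a + 2 * π) (δ j)) (contDiff_plateau (hδ j) (hδ4 j))
      (plateau_periodic _ _ _) v
  let A : ℕ → Loop n := fun j =>
    smulLoop (bump a (δ j)) (contDiff_bump (hδ j) (hδ4 j)) (bump_periodic _ _) (-v)
  let B : ℕ → Loop n := fun j =>
    smulLoop (bump b (δ j)) (contDiff_bump (hδ j) (hδ4 j)) (bump_periodic _ _) (-v)
  -- The sum of the negative bumps differs from `H j + K j` by the constant `v`. Both decompositions
  -- of its class are used: the bumps for norms and weak limits, the plateaus for commutation with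
  -- `x`.
  let T : ℕ → Loop n := fun j => ⟨fun θ => A j θ + B j θ, (A j).smooth.add (B j).smooth,
    fun θ => by simp only [(A j).periodic θ, (B j).periodic θ]⟩
  have hT1 : ∀ j, (T j).vec = (A j).vec + (B j).vec := fun j =>
    Loop.vec_eq_add (c := 0) fun θ => (add_zero _).symm
  have hT2 : ∀ j, (T j).vec = (H j).vec + (K j).vec := fun j =>
    Loop.vec_eq_add (c := -v) fun θ => by
      change bump a (δ j) θ • (-v) + bump b (δ j) θ • (-v) =
        plateau a b (δ j) θ • v + plateau b (a + 2 * π) (δ j) θ • v + -v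
      rw [← add_smul, ← add_smul, plateau_add_plateau, sub_smul, one_smul, smul_neg]
      abel
  have hHs : ∀ j, (H j).SupportedIn (Circle.exp '' Set.Ioo a b) := fun j θ hθ => by
    change plateau a b (δ j) θ • v = 0
    rw [plateau_eq_zero (hδ j) (hδ1 j) hb hθ, zero_smul]
  have hKs : ∀ j, (K j).SupportedIn (Circle.exp '' Set.Ioo b (a + 2 * π)) := fun j θ hθ => by
    change plateau b (a + 2 * π) (δ j) θ • v = 0
    rw [plateau_eq_zero (hδ j) (hδ2 j) (by linarith) hθ, zero_smul]
  set R : ℝ := ‖-v‖ ^ 2 * ((2 * π)⁻¹ * ((∫ x, bumpProfile x ^ 2) +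
      ∫ x, deriv bumpProfile x ^ 2)) with hR
  set z : ℕ → ℂ := fun j => (Circle.exp ((2 * π)⁻¹ *
    ∫ θ in (0)..(2 * π), inner ℝ (H j θ) (deriv M.toFun θ • α)) : ℂ) with hz
  refine eq_zero_of_weyl_anticommute x (fun j => (T j).vec) z (√R + √R) (fun j => ?_) ?_ ?_ ?_
  · rw [hT1]
    refine (norm_add_le _ _).trans (add_le_add ?_ ?_)
    · exact le_sqrt_of_sq_le (norm_vec_bump_sq_le (hδ j) (hδ3 j) fun θ => rfl)
    · exact le_sqrt_of_sq_le (norm_vec_bump_sq_le (hδ j) (hδ3 j) fun θ => rfl)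
  · intro g
    refine tendsto_inner_of_coord _ (√R + √R) (fun j => ?_) (fun m => ?_) g
    · rw [hT1]
      refine (norm_add_le _ _).trans (add_le_add ?_ ?_)
      · exact le_sqrt_of_sq_le (norm_vec_bump_sq_le (hδ j) (hδ3 j) fun θ => rfl)
      · exact le_sqrt_of_sq_le (norm_vec_bump_sq_le (hδ j) (hδ3 j) fun θ => rfl)
    · simp only [hT1]
      have hA := tendsto_vec_bump_apply hδ hδ3 hlim (f := A) (v := -v) (c := a)
        (fun _ _ => rfl) m
      have hB := tendsto_vec_bump_apply hδ hδ3 hlim (f := B) (v := -v) (c := b)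
        (fun _ _ => rfl) m
      simpa using hA.add hB
  · have h1 : ∀ j, ∫ θ in (0)..(2 * π), inner ℝ (H j θ) (deriv M.toFun θ • α) =
        π * ∫ θ in (0)..(2 * π), plateau a b (δ j) θ * deriv M.toFun θ := by
      intro j
      rw [← intervalIntegral.integral_const_mul]
      refine intervalIntegral.integral_congr fun θ _ => ?_
      change inner ℝ (plateau a b (δ j) θ • v) (deriv M.toFun θ • α) = _
      rw [real_inner_smul_left, real_inner_smul_right, hvα]
      ring
    have h2 := ((tendsto_integral_plateau hab hb M hδ hδ1 hlim).const_mul π).const_mul (2 * π)⁻¹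
    have h3 : (2 * π)⁻¹ * (π * (2 * π)) = π := by field_simp
    rw [h3] at h2
    have hc : Continuous fun t : ℝ => (Circle.exp t : ℂ) := by fun_prop
    have h4 := (hc.tendsto π).comp h2
    have h5 : (Circle.exp π : ℂ) = -1 := by rw [Circle.coe_exp, Complex.exp_pi_mul_I]
    rw [h5] at h4
    simp only [hz, h1]
    exact h4
  · intro j
    have h1 := h (H j) (hHs j)
    have h2 := currentAlgebra_commute hb (hKs j) hx
    have h3 := weyl_mul (H j).vec (K j).vec
    simp only [hT2]
    -- The phase relating `W(H) W(K)` to `W(H + K)` occurs on both sides of the desired relation and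
    -- cancels.
    set e : ℂ := Complex.exp (-(Complex.I * (inner ℂ (H j).vec (K j).vec).im)) with he
    have he0 : e ≠ 0 := Complex.exp_ne_zero _
    have h4 : e • (x * weyl ((H j).vec + (K j).vec)) =
        e • (z j • (weyl ((H j).vec + (K j).vec) * x)) := by
      calc e • (x * weyl ((H j).vec + (K j).vec))
          = x * weyl (H j).vec * weyl (K j).vec := by rw [mul_assoc, h3, mul_smul_comm]
        _ = z j • (weyl (H j).vec * x * weyl (K j).vec) := by rw [h1, smul_mul_assoc]
        _ = z j • (weyl (H j).vec * weyl (K j).vec * x) := by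
            rw [mul_assoc, ← h2, mul_assoc]
        _ = _ := by rw [h3, smul_mul_assoc, smul_comm]
    exact smul_right_injective _ he0 h4

end Free

/-! ### Symmetric cocycles on free abelian groups -/

section SymmetricCocycle

variable {G T : Type*} [AddCommGroup G] [CommGroup T]

/-- The extension of `G` by `T` given by a symmetric 2-cocycle. -/
structure CocycleExt (s : G → G → T) where
  phase : T
  charge : G

namespace CocycleExt

variable {s : G → G → T}

theorem ext' {x y : CocycleExt s} (h1 : x.phase = y.phase) (h2 : x.charge = y.charge) : x = y := by
  cases x; cases y; simp_all

/-- The group structure of the extension. -/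
@[reducible] def addCommGroup (hs : ∀ a b c, s b c * s a (b + c) = s a b * s (a + b) c)
    (hsym : ∀ a b, s a b = s b a) : AddCommGroup (CocycleExt s) :=
  -- The cocycle is not assumed to be normalized, so the neutral element of the extension carries
  -- the phase `(s 0 0)⁻¹`.
  have h0 : ∀ a, s 0 a = s 0 0 := fun a => by
    have h := hs 0 0 a
    rw [zero_add, zero_add] at h
    exact mul_right_cancel h
  letI : Add (CocycleExt s) := ⟨fun x y => ⟨x.phase * y.phase * s x.charge y.charge,
    x.charge + y.charge⟩⟩
  letI : Zero (CocycleExt s) := ⟨⟨(s 0 0)⁻¹, 0⟩⟩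
  letI : Neg (CocycleExt s) := ⟨fun x => ⟨(x.phase * s (-x.charge) x.charge * s 0 0)⁻¹,
    -x.charge⟩⟩
  have hadd : ∀ x y : CocycleExt s, x + y = ⟨x.phase * y.phase * s x.charge y.charge,
    x.charge + y.charge⟩ := fun _ _ => rfl
  have hzero : (0 : CocycleExt s) = ⟨(s 0 0)⁻¹, 0⟩ := rfl
  have hneg : ∀ x : CocycleExt s, -x = ⟨(x.phase * s (-x.charge) x.charge * s 0 0)⁻¹,
    -x.charge⟩ := fun _ => rfl
  have hcomm : ∀ x y : CocycleExt s, x + y = y + x := fun x y => by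
    rw [hadd, hadd]
    exact ext' (by simp only [mul_comm x.phase, hsym x.charge]) (add_comm _ _)
  have hz : ∀ x : CocycleExt s, 0 + x = x := fun x => by
    rw [hadd, hzero]
    exact ext' (by simp only [h0]; rw [mul_comm, mul_inv_cancel_left]) (zero_add _)
  { add_assoc := fun x y z => by
      simp only [hadd]
      refine ext' ?_ (add_assoc _ _ _)
      simp only
      have h := hs x.charge y.charge z.charge
      calc x.phase * y.phase * s x.charge y.charge * z.phase * s (x.charge + y.charge) z.charge
          = x.phase * y.phase * z.phase *
            (s x.charge y.charge * s (x.charge + y.charge) z.charge) := by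
            simp only [mul_comm, mul_left_comm]
        _ = _ := by rw [← h]; simp only [mul_comm, mul_left_comm]
    zero_add := hz
    add_zero := fun x => by rw [hcomm, hz]
    nsmul := nsmulRec
    zsmul := zsmulRec
    neg_add_cancel := fun x => by
      rw [hadd, hneg, hzero]
      refine ext' ?_ (neg_add_cancel _)
      simp only [mul_inv_rev]
      calc _ = (s 0 0)⁻¹ * ((x.phase⁻¹ * x.phase) *
            ((s (-x.charge) x.charge)⁻¹ * s (-x.charge) x.charge)) := by
            simp only [mul_assoc, mul_comm, mul_left_comm]
        _ = _ := by simp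
    add_comm := hcomm }

end CocycleExt

/-- A symmetric 2-cocycle on a free abelian group is a coboundary. -/
theorem exists_coboundary_of_symmetric [Module.Free ℤ G] (s : G → G → T)
    (hs : ∀ a b c, s b c * s a (b + c) = s a b * s (a + b) c) (hsym : ∀ a b, s a b = s b a) :
    ∃ h : G → T, ∀ a b, h a * h b = h (a + b) * s a b := by
  let _ := CocycleExt.addCommGroup hs hsym
  let p : CocycleExt s →ₗ[ℤ] G :=
    AddMonoidHom.toIntLinearMap (AddMonoidHom.mk' CocycleExt.charge fun _ _ => rfl)
  have hp : Function.Surjective p := fun a => ⟨⟨1, a⟩, rfl⟩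
  -- Symmetry of `s` makes the extension abelian, that is a `ℤ`-module, so it splits over the free
  -- module `G`. The inverse phases of the splitting trivialize `s`.
  obtain ⟨l, hl⟩ := Module.projective_lifting_property p LinearMap.id hp
  have hc : ∀ a, (l a).charge = a := fun a => congrArg (fun f => f a) hl
  refine ⟨fun a => (l a).phase⁻¹, fun a b => ?_⟩
  have h : (l (a + b)).phase = (l a).phase * (l b).phase * s a b := by
    rw [map_add]
    change (l a).phase * (l b).phase * s (l a).charge (l b).charge = _
    rw [hc, hc]
  simp only
  rw [h, mul_inv_rev, mul_inv_rev, mul_comm (s a b)⁻¹, inv_mul_cancel_right, mul_comm]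

end SymmetricCocycle

/-! ### The vacuum representation of the loop group -/

section LoopGroup

open Real MeasureTheory

open scoped ContDiff

variable {n : ℕ} {L : Submodule ℤ (EuclideanSpace ℝ (Fin n))}

/-- The scalar product on `L`. -/
abbrev ip (α β : L) : ℝ := inner ℝ (α : EuclideanSpace ℝ (Fin n)) β

theorem ip_add_left (α β γ : L) : ip (α + β) γ = ip α γ + ip β γ := inner_add_left _ _ _
theorem ip_add_right (α β γ : L) : ip α (β + γ) = ip α β + ip α γ := inner_add_right _ _ _
theorem ip_comm (α β : L) : ip α β = ip β α := real_inner_comm _ _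

/-- An even lattice is integral. -/
theorem IsEven.exists_int (hL : IsEven L) (α β : L) : ∃ k : ℤ, ip α β = k := by
  obtain ⟨k, hk⟩ := hL α α.2
  obtain ⟨l, hl⟩ := hL β β.2
  obtain ⟨m, hm⟩ := hL _ (α + β).2
  refine ⟨m - k - l, ?_⟩
  have h : ip (α + β) (α + β) = ip α α + 2 * ip α β + ip β β := by
    rw [ip_add_left, ip_add_right, ip_add_right, ip_comm β α]
    ring
  change ip (α + β) (α + β) = _ at hm
  change ip α α = _ at hk
  change ip β β = _ at hl
  push_cast
  linarith

/-- The Klein cocycle as an element of the circle. -/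
def kleinC (ε : L → L → ℤˣ) (α β : L) : Circle :=
  ⟨klein ε α β, mem_sphere_zero_iff_norm.2 (norm_klein ε α β)⟩

theorem coe_kleinC (ε : L → L → ℤˣ) (α β : L) : (kleinC ε α β : ℂ) = klein ε α β := rfl

variable {ε : L → L → ℤˣ}

theorem kleinC_add_left (hε : IsSignCocycle L ε) (α β γ : L) :
    kleinC ε (α + β) γ = kleinC ε α γ * kleinC ε β γ := by
  ext
  rw [Circle.coe_mul, coe_kleinC, coe_kleinC, coe_kleinC, klein, klein, klein, hε.add_left]
  have := ip_add_left α β γ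
  simp only [ip] at this
  rw [this, mul_add, Circle.exp_add]
  push_cast
  ring

theorem kleinC_add_right (hε : IsSignCocycle L ε) (α β γ : L) :
    kleinC ε α (β + γ) = kleinC ε α β * kleinC ε α γ := by
  ext
  rw [Circle.coe_mul, coe_kleinC, coe_kleinC, coe_kleinC, klein, klein, klein, hε.add_right]
  have := ip_add_right α β γ
  simp only [ip] at this
  rw [this, mul_add, Circle.exp_add]
  push_cast
  ring

theorem kleinC_zero_right (hε : IsSignCocycle L ε) (α : L) : kleinC ε α 0 = 1 := by
  have h := kleinC_add_right hε α 0 0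
  rw [add_zero] at h
  exact mul_eq_left.1 h.symm

/-- The commutator function of the Klein cocycle is `(-1)^{⟨α, β⟩}`. -/
theorem kleinC_comm (hL : IsEven L) (hε : IsSignCocycle L ε) (α β : L) :
    kleinC ε α β = Circle.exp (π * ip α β) * kleinC ε β α := by
  obtain ⟨k, hk⟩ := hL α α.2
  obtain ⟨l, hl⟩ := hL β β.2
  obtain ⟨m, hm⟩ := hL _ (α + β).2
  have h : ip (α + β) (α + β) = ip α α + 2 * ip α β + ip β β := by
    rw [ip_add_left, ip_add_right, ip_add_right, ip_comm β α]
    ring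
  have hr : ip α β = m - k - l := by
    change ip (α + β) (α + β) = _ at hm
    change ip α α = _ at hk
    change ip β β = _ at hl
    linarith
  -- Polarization of the values on the diagonal determines `ε(α, β) ε(β, α)`. The exponential factor
  -- of the Klein cocycle is symmetric and does not contribute to the commutator.
  have e1 : ε (α + β) (α + β) = ε α α * ε α β * (ε β α * ε β β) := by
    rw [hε.add_left, hε.add_right, hε.add_right]
  rw [hε.self _ m hm, hε.self _ k hk, hε.self _ l hl] at e1
  have e2 : ε α β = (-1) ^ m * (-1) ^ k * (-1) ^ l * ε β α := by
    rw [e1]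
    have hk2 : ((-1 : ℤˣ) ^ k) * (-1) ^ k = 1 := by rw [← mul_pow]; simp
    have hl2 : ((-1 : ℤˣ) ^ l) * (-1) ^ l = 1 := by rw [← mul_pow]; simp
    have hb : ε β α * ε β α = 1 := Int.units_mul_self _
    calc ε α β = ε α β * ((-1) ^ k * (-1) ^ k) * ((-1) ^ l * (-1) ^ l) * (ε β α * ε β α) := by
          rw [hk2, hl2, hb]; simp
      _ = _ := by simp only [mul_assoc, mul_comm, mul_left_comm]
  have e3 : (Circle.exp (π * ip α β) : ℂ) = (-1) ^ m * (-1) ^ k * (-1) ^ l := by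
    have hpi : ∀ j : ℕ, Complex.exp (j * (π * Complex.I)) = (-1) ^ j := fun j => by
      rw [Complex.exp_nat_mul, Complex.exp_pi_mul_I]
    have hn : ∀ j : ℕ, Complex.exp (-(j * (π * Complex.I))) = (-1) ^ j := fun j => by
      rw [Complex.exp_neg, hpi, ← inv_pow, inv_neg, inv_one]
    rw [hr, Circle.coe_exp, ← hpi m, ← hn k, ← hn l, ← Complex.exp_add, ← Complex.exp_add]
    congr 1
    push_cast
    ring
  ext
  rw [Circle.coe_mul, coe_kleinC, coe_kleinC, klein, klein, e3, e2]
  have hc := ip_comm α β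
  simp only [ip] at hc
  rw [hc]
  push_cast
  ring

namespace TorusLoop

/-- The one-particle vector of the periodic part. -/
def vec (f : TorusLoop L) : OneParticle n := f.periodicPart.vec

/-- The phase in the definition of `π(e^{if})`. -/
def phase (ε : L → L → ℤˣ) (f : TorusLoop L) (q : L) : Circle :=
  Circle.exp (-inner ℝ f.zeroMode (q : EuclideanSpace ℝ (Fin n))) * kleinC ε (-q) f.winding

theorem op_apply (ε : L → L → ℤˣ) (f : TorusLoop L) (ξ : LatticeSpace L) (q : L) :
    f.op ε ξ q = (f.phase ε q : ℂ) • weyl f.vec (ξ (q - f.winding)) := by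
  rw [phase, Circle.coe_mul]
  rfl

/-- The product of loops. -/
def add (f g : TorusLoop L) : TorusLoop L where
  toFun θ := f θ + g θ
  smooth := f.smooth.add g.smooth
  winding := f.winding + g.winding
  map_add_two_pi θ := by
    rw [f.map_add_two_pi, g.map_add_two_pi, Submodule.coe_add, smul_add]
    abel

/-- The inverse loop. -/
def neg (f : TorusLoop L) : TorusLoop L where
  toFun θ := -f θ
  smooth := f.smooth.neg
  winding := -f.winding
  map_add_two_pi θ := by
    rw [f.map_add_two_pi, Submodule.coe_neg, smul_neg]
    abel

theorem ext' {f g : TorusLoop L} (h1 : ∀ θ, f θ = g θ) (h2 : f.winding = g.winding) : f = g := by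
  obtain ⟨f, _, _, _⟩ := f
  obtain ⟨g, _, _, _⟩ := g
  obtain rfl : f = g := funext h1
  cases h2
  rfl

theorem vec_add (f g : TorusLoop L) : (f.add g).vec = f.vec + g.vec :=
  Loop.vec_eq_add (c := 0) fun θ => by
    change f θ + g θ - θ • ((f.winding + g.winding : L) : EuclideanSpace ℝ (Fin n)) =
      (f θ - θ • (f.winding : EuclideanSpace ℝ (Fin n))) + (g θ - θ • (g.winding : _)) + 0
    rw [Submodule.coe_add, smul_add]
    abel

theorem zeroMode_add (f g : TorusLoop L) : (f.add g).zeroMode = f.zeroMode + g.zeroMode := by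
  rw [zeroMode, zeroMode, zeroMode, ← smul_add, ← intervalIntegral.integral_add
    (f.periodicPart.smooth.continuous.intervalIntegrable _ _)
    (g.periodicPart.smooth.continuous.intervalIntegrable _ _)]
  congr 1
  refine intervalIntegral.integral_congr fun θ _ => ?_
  change f θ + g θ - θ • ((f.winding + g.winding : L) : EuclideanSpace ℝ (Fin n)) =
      (f θ - θ • (f.winding : EuclideanSpace ℝ (Fin n))) + (g θ - θ • (g.winding : _))
  rw [Submodule.coe_add, smul_add]
  abel

/-- `π` is a projective representation. -/
theorem op_mul (hε : IsSignCocycle L ε) (f g : TorusLoop L) : f.op ε * g.op ε =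
    ((Circle.exp (inner ℝ g.zeroMode (f.winding : EuclideanSpace ℝ (Fin n)) -
      (inner ℂ f.vec g.vec).im) * kleinC ε f.winding g.winding : Circle) : ℂ) •
      (f.add g).op ε := by
  ext1 ξ
  ext1
  funext q
  set z : Circle := Circle.exp (inner ℝ g.zeroMode (f.winding : EuclideanSpace ℝ (Fin n)) -
      (inner ℂ f.vec g.vec).im) * kleinC ε f.winding g.winding with hz
  change f.op ε (g.op ε ξ) q = (z : ℂ) • (f.add g).op ε ξ q
  rw [op_apply, op_apply, op_apply, map_smul, smul_smul, smul_smul]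
  have h1 : weyl f.vec (weyl g.vec (ξ (q - f.winding - g.winding))) =
      (Circle.exp (-(inner ℂ f.vec g.vec).im) : ℂ) •
        weyl (f.add g).vec (ξ (q - (f.add g).winding)) := by
    have e : q - f.winding - g.winding = q - (f.add g).winding := by
      change _ = q - (f.winding + g.winding)
      abel
    rw [e, vec_add, Circle.coe_exp]
    have h := congrArg (fun X => X (ξ (q - (f.add g).winding))) (weyl_mul f.vec g.vec)
    have e2 : (((-(inner ℂ f.vec g.vec).im : ℝ) : ℂ) * Complex.I) =
        -(Complex.I * (inner ℂ f.vec g.vec).im) := by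
      push_cast
      ring
    rw [e2]
    exact h
  rw [h1, smul_smul]
  congr 1
  rw [← Circle.coe_mul, ← Circle.coe_mul, ← Circle.coe_mul]
  congr 1
  -- The second operator sees the charge `q - Δ_f` instead of `q`. The discrepancy in its Klein
  -- factor, together with that in its zero-mode factor below, makes up the charge-independent part
  -- of the cocycle.
  have h2 : kleinC ε (-(q - f.winding)) g.winding =
      kleinC ε (-q) g.winding * kleinC ε f.winding g.winding := by
    rw [← kleinC_add_left hε]
    congr 1
    abel
  have h3 : kleinC ε (-q) (f.add g).winding = kleinC ε (-q) f.winding * kleinC ε (-q) g.winding :=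
    kleinC_add_right hε _ _ _
  have h4 : Circle.exp (-inner ℝ g.zeroMode ((q - f.winding : L) : EuclideanSpace ℝ (Fin n))) =
      Circle.exp (-inner ℝ g.zeroMode (q : EuclideanSpace ℝ (Fin n))) *
        Circle.exp (inner ℝ g.zeroMode (f.winding : EuclideanSpace ℝ (Fin n))) := by
    rw [← Circle.exp_add, Submodule.coe_sub, inner_sub_right]
    congr 1
    ring
  rw [hz, phase, phase, phase, h2, h3, h4, zeroMode_add, inner_add_left, neg_add, Circle.exp_add,
    sub_eq_add_neg, Circle.exp_add]
  simp only [mul_assoc, mul_comm, mul_left_comm]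
  rfl

theorem smul_weyl_mem_unitary (c : Circle) (f : OneParticle n) :
    (c : ℂ) • weyl f ∈ unitary (Fock (OneParticle n) →L[ℂ] Fock (OneParticle n)) := by
  have h1 : conj (c : ℂ) * c = 1 := by rw [← Circle.coe_inv_eq_conj, ← Circle.coe_mul]; simp
  rw [Unitary.mem_iff, star_smul, smul_mul_smul_comm, smul_mul_smul_comm, star_weyl,
    weyl_neg_mul_weyl, weyl_mul_weyl_neg, RCLike.star_def, mul_comm (c : ℂ), h1, one_smul]
  exact ⟨rfl, rfl⟩

/-- A phase times a Weyl operator as a unitary. -/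
def phaseWeyl (c : Circle) (f : OneParticle n) :
    unitary (Fock (OneParticle n) →L[ℂ] Fock (OneParticle n)) :=
  ⟨(c : ℂ) • weyl f, smul_weyl_mem_unitary c f⟩

theorem op_eq (ε : L → L → ℤˣ) (f : TorusLoop L) : f.op ε =
    (diagUnitary fun q => phaseWeyl (f.phase ε q) f.vec : LatticeSpace L →L[ℂ] LatticeSpace L) *
      shift f.winding := by
  ext1 ξ
  ext1
  funext q
  rw [op_apply]
  rfl

theorem op_mem_unitary (ε : L → L → ℤˣ) (f : TorusLoop L) :
    f.op ε ∈ unitary (LatticeSpace L →L[ℂ] LatticeSpace L) := by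
  rw [op_eq]
  refine mul_mem (diagUnitary _).2 ?_
  rw [Unitary.mem_iff, star_shift, shift_mul_shift, shift_mul_shift, neg_add_cancel,
    add_neg_cancel, shift_zero]
  exact ⟨rfl, rfl⟩

end TorusLoop

end LoopGroup

/-! ### The current algebra in the lattice net -/

section ChargeRep

variable {G : Type*} [AddCommGroup G]
variable {E : Type*} [NormedAddCommGroup E] [InnerProductSpace ℂ E]

/-- The representation `x ↦ ⨁_q Ad W(u_q)(x)` on `ℓ²(G, e^E)`. -/
def chargeRep (u : G → E) : (Fock E →L[ℂ] Fock E) →⋆ₐ[ℂ]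
    (Ell2 G (Fock E) →L[ℂ] Ell2 G (Fock E)) :=
  let φ := Unitary.conjStarAlgAut ℂ (Ell2 G (Fock E) →L[ℂ] Ell2 G (Fock E))
    (diagUnitary fun q => weylU (u q))
  have h1 : φ 1 = 1 := by
    rw [Unitary.conjStarAlgAut_apply, mul_one]
    exact Unitary.mul_star_self_of_mem (Subtype.prop _)
  { toFun := fun x => φ (amp G (Fock E) x)
    map_one' := by rw [map_one, h1]
    map_mul' := fun x y => by rw [map_mul]; exact φ.map_mul' _ _
    map_zero' := by
      rw [map_zero]
      have h := φ.map_add' 0 0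
      rw [add_zero] at h
      exact left_eq_add.1 h
    map_add' := fun x y => by rw [map_add]; exact φ.map_add' _ _
    commutes' := fun c => by
      rw [Algebra.algebraMap_eq_smul_one, Algebra.algebraMap_eq_smul_one, map_smul, map_one]
      exact (φ.map_smul' _ _).trans (congrArg (c • ·) h1)
    map_star' := fun x => by rw [map_star]; exact φ.map_star' _ }

theorem chargeRep_eq (u : G → E) (x : Fock E →L[ℂ] Fock E) : chargeRep u x =
    Unitary.conjStarAlgAut ℂ _ (diagUnitary fun q => weylU (u q)) (amp G (Fock E) x) := rfl

theorem chargeRep_apply (u : G → E) (x : Fock E →L[ℂ] Fock E) (ξ : Ell2 G (Fock E)) (q : G) :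
    chargeRep u x ξ q = adWeyl (u q) x (ξ q) := by
  set U := diagUnitary fun q => weylU (u q) with hU
  change weyl (u q) (x (star (U : Ell2 G (Fock E) →L[ℂ] Ell2 G (Fock E)) ξ q)) = _
  rw [hU, star_diagUnitary_apply]
  rfl

theorem chargeRep_injective (u : G → E) : Function.Injective (chargeRep u) := by
  intro x y h
  rw [chargeRep_eq, chargeRep_eq] at h
  exact amp_injective (EquivLike.injective _ h)

/-- Both constituents of `chargeRep`, the amplification and the conjugation by a diagonal unitary,
are compatible with generation. In particular the image of a von Neumann algebra is again one,
without any appeal to normality. -/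
theorem mem_vnGen_chargeRep_image (u : G → E) {S : Set (Fock E →L[ℂ] Fock E)}
    {T : Ell2 G (Fock E) →L[ℂ] Ell2 G (Fock E)} :
    T ∈ vnGen (chargeRep u '' S) ↔ ∃ x ∈ vnGen S, chargeRep u x = T := by
  set φ := Unitary.conjStarAlgAut ℂ (Ell2 G (Fock E) →L[ℂ] Ell2 G (Fock E))
    (diagUnitary fun q => weylU (u q)) with hφ
  have e : chargeRep u '' S = φ '' (amp G (Fock E) '' S) := by
    rw [Set.image_image]
    rfl
  obtain ⟨T, rfl⟩ := EquivLike.surjective φ T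
  rw [e, mem_vnGen_image, mem_vnGen_amp_image]
  simp only [chargeRep_eq, ← hφ, (EquivLike.injective φ).eq_iff]

theorem chargeRep_single [DecidableEq G] (u : G → E) {q : G} (hq : u q = 0)
    (x : Fock E →L[ℂ] Fock E) (ξ : Fock E) :
    chargeRep u x (lp.single 2 q ξ) = lp.single 2 q (x ξ) := by
  ext p
  rw [chargeRep_apply]
  by_cases h : p = q
  · subst h
    rw [lp.single_apply_self, lp.single_apply_self, hq, adWeyl_apply, weyl_zero]
    simp
  · rw [lp.single_apply_ne _ _ _ h, lp.single_apply_ne _ _ _ h, map_zero]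

end ChargeRep

/-! ### Step loops: isotropy of their vectors, cocycle and phases -/

section Step

open Real MeasureTheory

open scoped ContDiff

variable {n : ℕ} {L : Submodule ℤ (EuclideanSpace ℝ (Fin n))}

variable {I J : Set Circle}

/-- The one-particle vector of `e^{iMα}`. -/
def StepFunction.vec (M : StepFunction I) (α : L) : OneParticle n := (M.loop α).vec

theorem StepFunction.loop_add (M : StepFunction I) (α β : L) :
    (M.loop α).add (M.loop β) = M.loop (α + β) :=
  TorusLoop.ext' (fun θ => (smul_add (M.toFun θ) (α : EuclideanSpace ℝ (Fin n)) β).symm) rfl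

theorem StepFunction.vec_add (M : StepFunction I) (α β : L) :
    M.vec (α + β) = M.vec α + M.vec β := by
  rw [vec, ← M.loop_add, TorusLoop.vec_add]
  rfl

/-- `α ↦ [(Mα)₁]` as a homomorphism. -/
def StepFunction.vecHom (M : StepFunction I) : L →+ OneParticle n :=
  AddMonoidHom.mk' M.vec M.vec_add

theorem StepFunction.vecHom_apply (M : StepFunction I) (α : L) : M.vecHom α = M.vec α := rfl

theorem StepFunction.hasDerivAt (M : StepFunction I) (θ : ℝ) :
    HasDerivAt M.toFun (deriv M.toFun θ) θ :=
  (M.smooth.differentiable (by simp) θ).hasDerivAt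

theorem StepFunction.continuous_deriv (M : StepFunction I) : Continuous (deriv M.toFun) :=
  (contDiff_infty_iff_deriv.1 M.smooth).2.continuous

theorem StepFunction.deriv_periodicPart (M : StepFunction I) (α : L) (θ : ℝ) :
    deriv (M.loop α).periodicPart.toFun θ =
      (deriv M.toFun θ - 1) • (α : EuclideanSpace ℝ (Fin n)) := by
  have h : (M.loop α).periodicPart.toFun =
      fun θ => (M.toFun θ - θ) • (α : EuclideanSpace ℝ (Fin n)) := by
    ext1 θ
    exact (sub_smul _ _ _).symm
  rw [h]
  exact (((M.hasDerivAt θ).sub (hasDerivAt_id θ)).smul_const _).deriv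

/-- The symplectic form is `⟨α, β⟩` times the integral of `(M - θ)(M' - 1)`, the derivative of the
periodic function `(M - θ)² / 2`. Consequently the Weyl operators of the step loops multiply without
phases. -/
theorem StepFunction.im_inner_vec (M : StepFunction I) (α β : L) :
    (inner ℂ (M.vec α) (M.vec β)).im = 0 := by
  have h := neg_two_mul_im_inner_vec (M.loop α).periodicPart (M.loop β).periodicPart
  have e : ∀ θ : ℝ, inner ℝ ((M.loop β).periodicPart θ)
      (deriv (M.loop α).periodicPart.toFun θ) =
        (M.toFun θ - θ) * (deriv M.toFun θ - 1) * ip β α := fun θ => by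
    have h : (M.loop β).periodicPart θ =
      (M.toFun θ - θ) • (β : EuclideanSpace ℝ (Fin n)) := (sub_smul _ _ _).symm
    rw [h, M.deriv_periodicPart, real_inner_smul_left, real_inner_smul_right, mul_assoc]
  have h0 : ∫ θ in (0)..(2 * π), (M.toFun θ - θ) * (deriv M.toFun θ - 1) = 0 := by
    have hd : ∀ θ, HasDerivAt (fun θ => (M.toFun θ - θ) ^ 2 / 2)
        ((M.toFun θ - θ) * (deriv M.toFun θ - 1)) θ := fun θ => by
      refine ((((M.hasDerivAt θ).sub (hasDerivAt_id θ)).pow 2).div_const 2).congr_deriv ?_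
      simp
      ring
    have hM := M.smooth.continuous
    have hM' := M.continuous_deriv
    rw [intervalIntegral.integral_eq_sub_of_hasDerivAt (fun θ _ => hd θ)
      (Continuous.intervalIntegrable (by fun_prop) _ _)]
    have := M.map_add_two_pi 0
    rw [zero_add] at this
    rw [this]
    ring
  simp only [e, intervalIntegral.integral_mul_const, h0, zero_mul, mul_zero] at h
  change (inner ℂ (M.loop α).periodicPart.vec (M.loop β).periodicPart.vec).im = 0
  linarith

variable {ε : L → L → ℤˣ}

/-- The mean of `M - id`. -/
def StepFunction.mean (M : StepFunction I) : ℝ :=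
  (2 * π)⁻¹ * ∫ θ in (0)..(2 * π), (M.toFun θ - θ)

theorem StepFunction.zeroMode_loop (M : StepFunction I) (α : L) :
    (M.loop α).zeroMode = M.mean • (α : EuclideanSpace ℝ (Fin n)) := by
  have h : ∀ θ, (M.loop α).periodicPart θ = (M.toFun θ - θ) • (α : EuclideanSpace ℝ (Fin n)) :=
    fun θ => (sub_smul _ _ _).symm
  simp only [TorusLoop.zeroMode, h]
  rw [intervalIntegral.integral_smul_const, smul_smul]
  rfl

/-- The cocycle of the operators `π(e^{iMα})`. -/
def StepFunction.cocycle (ε : L → L → ℤˣ) (M : StepFunction I) (α β : L) : Circle :=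
  Circle.exp (M.mean * ip α β) * kleinC ε α β

/-- By isotropy the Weyl relation contributes nothing, and only the zero mode and the Klein cocycle
remain. -/
theorem StepFunction.op_mul (hε : IsSignCocycle L ε) (M : StepFunction I) (α β : L) :
    (M.loop α).op ε * (M.loop β).op ε =
      (M.cocycle ε α β : ℂ) • (M.loop (α + β)).op ε := by
  rw [TorusLoop.op_mul hε, M.loop_add]
  congr 2
  have h1 : (inner ℂ (M.loop α).vec (M.loop β).vec).im = 0 := M.im_inner_vec α β
  rw [h1, sub_zero, M.zeroMode_loop, real_inner_smul_left]
  have h2 : inner ℝ (β : EuclideanSpace ℝ (Fin n)) ((M.loop α).winding : _) = ip α β :=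
    real_inner_comm _ _
  rw [h2]
  rfl

theorem StepFunction.cocycle_identity (hε : IsSignCocycle L ε) (M : StepFunction I) (α β γ : L) :
    M.cocycle ε β γ * M.cocycle ε α (β + γ) = M.cocycle ε α β * M.cocycle ε (α + β) γ := by
  simp only [cocycle, kleinC_add_left hε, kleinC_add_right hε, ip_add_left, ip_add_right, mul_add,
    Circle.exp_add]
  simp only [mul_assoc, mul_comm, mul_left_comm]

/-- The zero-mode factor is symmetric, so the commutator is that of the Klein cocycle, whatever the
mean of `M`. -/
theorem StepFunction.cocycle_comm (hL : IsEven L) (hε : IsSignCocycle L ε) (M : StepFunction I)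
    (α β : L) : M.cocycle ε α β = Circle.exp (π * ip α β) * M.cocycle ε β α := by
  rw [cocycle, cocycle, kleinC_comm hL hε α β, ip_comm β α]
  simp only [mul_left_comm]

theorem StepFunction.phase_loop (M : StepFunction I) (α q : L) :
    (M.loop α).phase ε q = Circle.exp (-(M.mean * ip α q)) * kleinC ε (-q) α := by
  rw [TorusLoop.phase, M.zeroMode_loop, real_inner_smul_left]
  rfl

theorem kleinC_neg_left (hε : IsSignCocycle L ε) (α β : L) :
    kleinC ε (-α) β = (kleinC ε α β)⁻¹ := by
  have h0 : kleinC ε 0 β = 1 := by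
    have h := kleinC_add_left hε 0 0 β
    rw [add_zero] at h
    exact mul_eq_left.1 h.symm
  rw [eq_inv_iff_mul_eq_one, ← kleinC_add_left hε, neg_add_cancel, h0]

/-- The relation between the phases in `π(e^{iMα})` and their cocycle. -/
theorem StepFunction.phase_loop_add (hε : IsSignCocycle L ε) (M : StepFunction I) (α β : L) :
    (M.loop α).phase ε (α + β) * (M.loop β).phase ε β =
      M.cocycle ε α β * (M.loop (α + β)).phase ε (α + β) := by
  rw [phase_loop, phase_loop, phase_loop, cocycle]
  simp only [kleinC_neg_left hε, kleinC_add_left hε, kleinC_add_right hε, ip_add_left,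
    ip_add_right, mul_add, neg_add, Circle.exp_add, Circle.exp_neg, mul_inv, ip_comm β α]
  generalize Circle.exp (M.mean * ip α α) = x1
  generalize Circle.exp (M.mean * ip α β) = x2
  generalize Circle.exp (M.mean * ip β β) = x3
  generalize kleinC ε α α = y1
  generalize kleinC ε α β = y2
  generalize kleinC ε β α = y3
  generalize kleinC ε β β = y4
  ext
  push_cast
  have h1 := x1.coe_ne_zero
  have h2 := x2.coe_ne_zero
  have h3 := x3.coe_ne_zero
  have h4 := y1.coe_ne_zero
  have h5 := y2.coe_ne_zero
  have h6 := y3.coe_ne_zero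
  have h7 := y4.coe_ne_zero
  field_simp

end Step

/-! ### The local algebras of the lattice net -/

section LocalAlgebras

open Real MeasureTheory

open scoped ContDiff

variable {n : ℕ} {L : Submodule ℤ (EuclideanSpace ℝ (Fin n))} {ε : L → L → ℤˣ} {a b : ℝ}

theorem mem_of_circle_smul_mem {K : Type*} [NormedAddCommGroup K] [InnerProductSpace ℂ K]
    [CompleteSpace K] (A : VonNeumannAlgebra K) {z : Circle} {x : K →L[ℂ] K}
    (h : (z : ℂ) • x ∈ A) : x ∈ A := by
  have := smul_mem_vn A (z : ℂ)⁻¹ h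
  rwa [smul_smul, inv_mul_cancel₀ z.coe_ne_zero, one_smul] at this

/-- On charge `q` both operators are multiples of `W([g])`. As `N' = 0` on the arc, the symplectic
phase is given by minus the pairing of `q` with the mean of `g`. This mean is the zero mode of `f`
up to `2πl`, which is invisible because the lattice is integral. -/
theorem op_eq_chargeRep (hL : IsEven L) (hε : IsSignCocycle L ε) (hb : b < a + 2 * π)
    (N : StepFunction (Circle.exp '' Set.Ioo b (a + 2 * π))) {f : TorusLoop L} {g : Loop n}
    (hf : f.winding = 0) (hg : g.SupportedIn (Circle.exp '' Set.Ioo a b)) (l : L)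
    (h : ∀ θ, f θ = g θ + (2 * π) • (l : EuclideanSpace ℝ (Fin n))) :
    f.op ε = chargeRep N.vec (weyl g.vec) := by
  have hper : ∀ θ, f.periodicPart θ = g θ + (2 * π) • (l : EuclideanSpace ℝ (Fin n)) := fun θ => by
    change f θ - θ • (f.winding : EuclideanSpace ℝ (Fin n)) = _
    rw [hf, h, Submodule.coe_zero, smul_zero, sub_zero]
  have hvec : f.vec = g.vec := Loop.vec_congr hper
  ext1 ξ
  ext1
  funext q
  rw [TorusLoop.op_apply, chargeRep_apply, hf, sub_zero, hvec, adWeyl_apply]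
  have hc := weyl_vec_conj (N.loop q).periodicPart g
  change _ = (weyl (N.loop q).periodicPart.vec * weyl g.vec *
    star (weyl (N.loop q).periodicPart.vec)) (ξ q)
  rw [hc]
  change (f.phase ε q : ℂ) • weyl g.vec (ξ q) = (Circle.exp _ : ℂ) • weyl g.vec (ξ q)
  refine congrArg (fun z : Circle => (z : ℂ) • weyl g.vec (ξ q)) ?_
  rw [TorusLoop.phase, hf, kleinC_zero_right hε, mul_one, Circle.exp_eq_exp]
  have hi : ∀ θ, inner ℝ (g θ) (deriv (N.loop q).periodicPart.toFun θ) =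
      -inner ℝ (q : EuclideanSpace ℝ (Fin n)) (g θ) := by
    intro θ
    rw [N.deriv_periodicPart, real_inner_smul_right, real_inner_comm]
    by_cases hθ : Circle.exp θ ∈ Circle.exp '' Set.Ioo a b
    · rw [N.deriv_eq_zero_of_mem hb hθ]
      ring
    · rw [hg θ hθ, inner_zero_right]
      ring
  have hgi : IntervalIntegrable g.toFun volume 0 (2 * π) :=
    g.smooth.continuous.intervalIntegrable _ _
  have h0 : f.zeroMode = (2 * π)⁻¹ • (∫ θ in (0)..(2 * π), g θ) +
      (2 * π) • (l : EuclideanSpace ℝ (Fin n)) := by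
    rw [TorusLoop.zeroMode]
    simp only [hper]
    rw [intervalIntegral.integral_add hgi intervalIntegrable_const, intervalIntegral.integral_const,
      sub_zero, smul_add, inv_smul_smul₀ two_pi_pos.ne']
  have hI : ∫ θ in (0)..(2 * π), inner ℝ (q : EuclideanSpace ℝ (Fin n)) (g θ) =
      inner ℝ (q : EuclideanSpace ℝ (Fin n)) (∫ θ in (0)..(2 * π), g θ) := by
    have := (innerSL ℝ (q : EuclideanSpace ℝ (Fin n))).intervalIntegral_comp_comm hgi
    exact this
  obtain ⟨k, hk⟩ := hL.exists_int l q
  simp only [ip] at hk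
  refine ⟨-k, ?_⟩
  simp only [hi, intervalIntegral.integral_neg]
  rw [hI, h0, inner_add_left, real_inner_smul_left, real_inner_smul_left, hk,
    real_inner_comm (q : EuclideanSpace ℝ (Fin n))]
  push_cast
  ring

/-- The generating sets correspond. On the connected complementary arc a neutral localized loop
takes values in the discrete set `2πL`, so it is a constant there; subtracting this constant leaves
a loop vanishing off the arc. -/
theorem mem_neutralAlgebra_iff [DiscreteTopology L] (hL : IsEven L) (hε : IsSignCocycle L ε)
    (hab : a < b) (hb : b < a + 2 * π)
    (N : StepFunction (Circle.exp '' Set.Ioo b (a + 2 * π)))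
    {T : LatticeSpace L →L[ℂ] LatticeSpace L} :
    T ∈ neutralAlgebra ε (Circle.exp '' Set.Ioo a b) ↔
      ∃ x ∈ currentAlgebra n (Circle.exp '' Set.Ioo a b), chargeRep N.vec x = T := by
  have e : {x | ∃ f : TorusLoop L, f.SupportedIn (Circle.exp '' Set.Ioo a b) ∧ f.winding = 0 ∧
      f.op ε = x} = chargeRep N.vec '' (weyl ''
        {v | ∃ f : Loop n, f.SupportedIn (Circle.exp '' Set.Ioo a b) ∧ f.vec = v}) := by
    ext T
    constructor
    · rintro ⟨f, hf, hw, rfl⟩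
      have hdisc : DiscreteTopology (L : Set (EuclideanSpace ℝ (Fin n))) :=
        inferInstanceAs (DiscreteTopology L)
      have hmem : ∀ θ : ℝ, Circle.exp θ ∉ Circle.exp '' Set.Ioo a b →
          (2 * π)⁻¹ • f θ ∈ (L : Set (EuclideanSpace ℝ (Fin n))) := by
        intro θ hθ
        obtain ⟨l, hl, e⟩ := hf θ hθ
        rw [e, inv_smul_smul₀ two_pi_pos.ne']
        exact hl
      have hconst : ∀ θ ∈ Set.Icc b (a + 2 * π), (2 * π)⁻¹ • f θ = (2 * π)⁻¹ • f b := fun θ hθ =>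
        eq_of_mem_discrete (T := (L : Set (EuclideanSpace ℝ (Fin n)))) isPreconnected_Icc
          (g := fun θ => (2 * π)⁻¹ • f θ) (by have := f.smooth.continuous; fun_prop)
          (fun t ht => hmem t (notMem_arc ht hab)) hθ (Set.left_mem_Icc.2 hb.le)
      have hper : Function.Periodic f.toFun (2 * π) := fun θ => by
        rw [f.map_add_two_pi, hw, Submodule.coe_zero, smul_zero, add_zero]
      let l : L := ⟨(2 * π)⁻¹ • f b, hmem b (notMem_arc (Set.left_mem_Icc.2 hb.le) hab)⟩
      have hl : (2 * π) • (l : EuclideanSpace ℝ (Fin n)) = f b :=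
        smul_inv_smul₀ two_pi_pos.ne' _
      let g : Loop n := ⟨fun θ => f θ - f b, f.smooth.sub contDiff_const, fun θ => by
        simp only [hper θ]⟩
      have hg : g.SupportedIn (Circle.exp '' Set.Ioo a b) := by
        intro θ hθ
        obtain ⟨k, hk⟩ := exists_add_mem_Ico b θ
        have hk' : θ + k * (2 * π) ∈ Set.Icc b (a + 2 * π) := by
          refine ⟨hk.1, ?_⟩
          by_contra h'
          -- A representative beyond `a + 2π` and below `b + 2π` returns to `(a, b)` after
          -- subtracting one period.
          refine hθ (mem_arc_iff.2 ⟨k - 1, ?_⟩)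
          push_cast
          constructor <;> linarith [hk.2]
        have h1 := hconst _ hk'
        rw [hper.int_mul k θ] at h1
        change f θ - f b = 0
        rw [sub_eq_zero]
        exact smul_right_injective _ (inv_ne_zero two_pi_pos.ne') h1
      refine ⟨_, ⟨_, ⟨g, hg, rfl⟩, rfl⟩, (op_eq_chargeRep hL hε hb N hw hg l fun θ => ?_).symm⟩
      rw [hl]
      exact (sub_add_cancel _ _).symm
    · rintro ⟨_, ⟨_, ⟨g, hg, rfl⟩, rfl⟩, rfl⟩
      let f : TorusLoop L := ⟨g.toFun, g.smooth, 0, fun θ => by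
        rw [g.periodic θ, Submodule.coe_zero, smul_zero, add_zero]⟩
      refine ⟨f, fun θ hθ => ⟨0, L.zero_mem, ?_⟩, rfl, op_eq_chargeRep hL hε hb N rfl hg 0 fun θ => ?_⟩
      · change g θ = _
        rw [hg θ hθ, smul_zero]
      · change g θ = _
        rw [Submodule.coe_zero, smul_zero, add_zero]
  rw [neutralAlgebra, e, mem_vnGen_chargeRep_image, currentAlgebra_eq]

/-- A von Neumann algebra containing the neutral algebra and the operators of the localized step
loops contains the local algebra of the lattice net. -/
theorem latticeAlgebra_le (hε : IsSignCocycle L ε) {I : Set Circle} (M : StepFunction I)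
    (B : VonNeumannAlgebra (LatticeSpace L)) (h1 : neutralAlgebra ε I ≤ B)
    (h2 : ∀ α, (M.loop α).op ε ∈ B) : latticeAlgebra ε I ≤ B := by
  refine vnGen_le ?_
  rintro _ ⟨f, hf, rfl⟩
  -- Dividing by the step loop of the same winding number leaves a neutral localized loop.
  let g : TorusLoop L := f.add (M.loop f.winding).neg
  have hgw : g.winding = 0 := add_neg_cancel f.winding
  have hgs : g.SupportedIn I := by
    intro θ hθ
    obtain ⟨l, hl, e1⟩ := hf θ hθ
    obtain ⟨m, hm, e2⟩ := M.loop_supportedIn f.winding θ hθ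
    refine ⟨l - m, L.sub_mem hl hm, ?_⟩
    change f θ + -(M.loop f.winding θ) = _
    rw [e1, e2, smul_sub, sub_eq_add_neg]
  have hg : g.op ε ∈ B := h1 (mem_vnGen_of_mem ⟨g, hgs, hgw, rfl⟩)
  have hadd : g.add (M.loop f.winding) = f := by
    refine TorusLoop.ext' (fun θ => ?_) ?_
    · exact neg_add_cancel_right _ _
    · exact neg_add_cancel_right f.winding f.winding
  have hm := mul_mem hg (h2 f.winding)
  rw [TorusLoop.op_mul hε, hadd] at hm
  exact mem_of_circle_smul_mem B hm

/-- Phases do not affect membership in `B`, so the charges whose step operators belong to `B` form a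
subgroup of `L`. -/
theorem op_loop_mem_of_basis (hε : IsSignCocycle L ε) {I : Set Circle} (M : StepFunction I)
    (B : VonNeumannAlgebra (LatticeSpace L)) (h1 : neutralAlgebra ε I ≤ B) {ι : Type}
    (e : Module.Basis ι ℤ L) (h2 : ∀ i, (M.loop (e i)).op ε ∈ B) (α : L) :
    (M.loop α).op ε ∈ B := by
  have h0 : (M.loop (0 : L)).op ε ∈ B := h1 (mem_vnGen_of_mem ⟨_, M.loop_supportedIn 0, rfl, rfl⟩)
  let P : AddSubgroup L :=
    { carrier := {α | (M.loop α).op ε ∈ B}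
      zero_mem' := h0
      add_mem' := fun {α β} hα hβ => by
        have hm : (M.loop α).op ε * (M.loop β).op ε ∈ B := mul_mem hα hβ
        rw [M.op_mul hε] at hm
        exact mem_of_circle_smul_mem B hm
      neg_mem' := fun {α} hα => by
        have hm := M.op_mul hε (-α) α
        rw [neg_add_cancel] at hm
        have hu := (TorusLoop.op_mem_unitary ε (M.loop α))
        have h3 : (M.loop (-α)).op ε =
            (M.cocycle ε (-α) α : ℂ) • ((M.loop (0 : L)).op ε * star ((M.loop α).op ε)) := by
          rw [← smul_mul_assoc, ← hm, mul_assoc, Unitary.mul_star_self_of_mem hu, mul_one]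
        change (M.loop (-α)).op ε ∈ B
        rw [h3]
        exact smul_mem_vn B _ (mul_mem h0 (star_mem hα)) }
  have hP : (⊤ : Submodule ℤ L) ≤ AddSubgroup.toIntSubmodule P := by
    rw [← e.span_eq, Submodule.span_le]
    rintro _ ⟨i, rfl⟩
    exact h2 i
  exact hP (Submodule.mem_top (x := α))

theorem latticeAlgebra_eq_of_basis (hε : IsSignCocycle L ε) {I : Set Circle} (M : StepFunction I)
    {ι : Type} (e : Module.Basis ι ℤ L) : latticeAlgebra ε I =
      vnGen ((neutralAlgebra ε I : Set (LatticeSpace L →L[ℂ] LatticeSpace L)) ∪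
        Set.range fun i => (M.loop (e i)).op ε) := by
  apply le_antisymm
  · have h1 : neutralAlgebra ε I ≤
        vnGen ((neutralAlgebra ε I : Set (LatticeSpace L →L[ℂ] LatticeSpace L)) ∪
          Set.range fun i => (M.loop (e i)).op ε) := fun x hx => mem_vnGen_of_mem (Or.inl hx)
    exact latticeAlgebra_le hε M _ h1 (op_loop_mem_of_basis hε M _ h1 e
      fun i => mem_vnGen_of_mem (Or.inr ⟨i, rfl⟩))
  · refine vnGen_le ?_
    rintro x (hx | ⟨i, rfl⟩)
    · exact vnGen_le (A := latticeAlgebra ε I)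
        (by rintro _ ⟨f, hf, -, rfl⟩; exact mem_vnGen_of_mem ⟨f, hf, rfl⟩) hx
    · exact mem_vnGen_of_mem ⟨_, M.loop_supportedIn _, rfl⟩

theorem neutralAlgebra_le (ε : L → L → ℤˣ) (I : Set Circle) :
    neutralAlgebra ε I ≤ latticeAlgebra ε I :=
  vnGen_le (by rintro _ ⟨f, hf, -, rfl⟩; exact mem_vnGen_of_mem ⟨f, hf, rfl⟩)

end LocalAlgebras

/-! ### The action of the lattice and the crossed product -/

section Action

open Real MeasureTheory

open scoped ContDiff

/-- No localization of `w` is needed: `Ad W(w)` multiplies each Weyl generator by a phase. -/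
theorem adWeyl_mem_currentAlgebra {n : ℕ} (I : Set Circle) (w : OneParticle n)
    {x : Fock (OneParticle n) →L[ℂ] Fock (OneParticle n)} (hx : x ∈ currentAlgebra n I) :
    adWeyl w x ∈ currentAlgebra n I := by
  rw [currentAlgebra_eq] at hx ⊢
  exact adWeyl_mem _ _ hx

theorem adWeyl_zero {E : Type*} [NormedAddCommGroup E] [InnerProductSpace ℂ E]
    (x : Fock E →L[ℂ] Fock E) : adWeyl 0 x = x := by
  rw [adWeyl_apply, star_weyl, neg_zero, weyl_zero, mul_one, one_mul]

/-- The restriction to a globally invariant von Neumann algebra of an action on `B(K)`. -/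
def restrictAction {G K : Type*} [AddCommGroup G] [NormedAddCommGroup K] [InnerProductSpace ℂ K]
    [CompleteSpace K] (A : VonNeumannAlgebra K) (φ : G → (K →L[ℂ] K) ≃⋆ₐ[ℂ] (K →L[ℂ] K))
    (h0 : ∀ x, φ 0 x = x) (hadd : ∀ g h x, φ (g + h) x = φ g (φ h x))
    (hA : ∀ g, ∀ x ∈ A, φ g x ∈ A) (hA' : ∀ g, ∀ x ∈ A, (φ g).symm x ∈ A) :
    Multiplicative G →* (Alg A ≃⋆ₐ[ℂ] Alg A) where
  toFun g := restrictAut A (φ g.toAdd) (hA _) (hA' _)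
  map_one' := StarAlgEquiv.ext fun x => Subtype.ext (h0 x)
  map_mul' g h := StarAlgEquiv.ext fun x => Subtype.ext (hadd g.toAdd h.toAdd x)

theorem coe_restrictAction {G K : Type*} [AddCommGroup G] [NormedAddCommGroup K]
    [InnerProductSpace ℂ K] [CompleteSpace K] (A : VonNeumannAlgebra K)
    (φ : G → (K →L[ℂ] K) ≃⋆ₐ[ℂ] (K →L[ℂ] K)) (h0 hadd hA hA') (g : G) (x : Alg A) :
    (restrictAction A φ h0 hadd hA hA' (.ofAdd g) x : K →L[ℂ] K) = φ g (x : K →L[ℂ] K) := rfl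

variable {n : ℕ} {L : Submodule ℤ (EuclideanSpace ℝ (Fin n))} {ε : L → L → ℤˣ} {a b : ℝ}

/-- The action of the lattice defined by two step functions, for the interval and for its
complement. -/
def stepAction {I J : Set Circle} (M : StepFunction I) (N : StepFunction J) :
    Multiplicative L →* (Alg (currentAlgebra n I) ≃⋆ₐ[ℂ] Alg (currentAlgebra n I)) :=
  restrictAction (currentAlgebra n I) (fun α : L => adWeyl (M.vec α - N.vec α))
    (fun x => by
      rw [← M.vecHom_apply, ← N.vecHom_apply, map_zero, map_zero, sub_zero, adWeyl_zero])
    (fun α γ x => by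
      rw [adWeyl_adWeyl, M.vec_add, N.vec_add, add_sub_add_comm])
    (fun _ _ hx => adWeyl_mem_currentAlgebra I _ hx)
    (fun _ x hx => by
      rw [adWeyl_symm_apply]
      exact adWeyl_mem_currentAlgebra I _ hx)

theorem coe_stepAction {I J : Set Circle} (M : StepFunction I) (N : StepFunction J) (α : L)
    (x : Alg (currentAlgebra n I)) :
    (stepAction M N (.ofAdd α) x : Fock (OneParticle n) →L[ℂ] Fock (OneParticle n)) =
      adWeyl (M.vec α - N.vec α) (x : Fock (OneParticle n) →L[ℂ] Fock (OneParticle n)) :=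
  coe_restrictAction _ _ _ _ _ _ _ _

/-- The operators `π(e^{iMα})` implement the action. -/
theorem chargeRep_stepAction {I J : Set Circle} (M : StepFunction I) (N : StepFunction J)
    (ε : L → L → ℤˣ) (α : L) (x : Fock (OneParticle n) →L[ℂ] Fock (OneParticle n)) :
    chargeRep N.vec (adWeyl (M.vec α - N.vec α) x) =
      (M.loop α).op ε * chargeRep N.vec x * star ((M.loop α).op ε) := by
  have hu := TorusLoop.op_mem_unitary ε (M.loop α)
  have key : chargeRep N.vec (adWeyl (M.vec α - N.vec α) x) * (M.loop α).op ε =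
      (M.loop α).op ε * chargeRep N.vec x := by
    ext1 ξ
    ext1
    funext q
    change chargeRep N.vec (adWeyl (M.vec α - N.vec α) x) ((M.loop α).op ε ξ) q =
      (M.loop α).op ε (chargeRep N.vec x ξ) q
    rw [chargeRep_apply, TorusLoop.op_apply, TorusLoop.op_apply, chargeRep_apply, map_smul,
      adWeyl_adWeyl]
    -- The shift by `α` in `π(e^{iMα})` compensates the term `-n_α` in the definition of the action.
    have e : N.vec q + (M.vec α - N.vec α) = M.vec α + N.vec (q - α) := by
      have h : N.vec q = N.vec (q - α) + N.vec α := by rw [← N.vec_add, sub_add_cancel]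
      rw [h]
      abel
    rw [e, ← adWeyl_adWeyl]
    change _ • adWeyl (M.vec α) (adWeyl (N.vec (q - α)) x) (weyl (M.vec α) (ξ (q - α))) =
      _ • weyl (M.vec α) (adWeyl (N.vec (q - α)) x (ξ (q - α)))
    generalize adWeyl (N.vec (q - α)) x = y
    have h2 : adWeyl (M.vec α) y * weyl (M.vec α) = weyl (M.vec α) * y := by
      rw [adWeyl_apply, mul_assoc, star_weyl, weyl_neg_mul_weyl, mul_one]
    exact congrArg _ (congrArg (fun X => X (ξ (q - α))) h2)
  rw [← key, mul_assoc, Unitary.mul_star_self_of_mem hu, mul_one]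

/-- The action on Weyl operators of loops which are constant off the interval. -/
theorem adWeyl_step_weyl (hb : b < a + 2 * π) (M : StepFunction (Circle.exp '' Set.Ioo a b))
    (N : StepFunction (Circle.exp '' Set.Ioo b (a + 2 * π))) (α : L) {f : Loop n}
    {c : EuclideanSpace ℝ (Fin n)}
    (hf : ∀ θ : ℝ, Circle.exp θ ∉ Circle.exp '' Set.Ioo a b → f θ = c) :
    adWeyl (M.vec α - N.vec α) (weyl f.vec) =
      (Circle.exp ((2 * π)⁻¹ * ∫ θ in (0)..(2 * π), inner ℝ (f θ - c)
        (deriv M.toFun θ • (α : EuclideanSpace ℝ (Fin n)))) : ℂ) • weyl f.vec := by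
  -- The winding numbers of `Mα` and `Nα` cancel, so the vector implementing the action is the class
  -- of an honest loop and the symplectic formula applies.
  let g : Loop n := ⟨fun θ => (M.toFun θ - N.toFun θ) • (α : EuclideanSpace ℝ (Fin n)),
    (M.smooth.sub N.smooth).smul contDiff_const, fun θ => by
      simp only [M.map_add_two_pi, N.map_add_two_pi, add_sub_add_right_eq_sub]⟩
  have hg : g.vec = M.vec α - N.vec α := by
    rw [eq_sub_iff_add_eq]
    refine (Loop.vec_eq_add (f := (M.loop α).periodicPart) (g := g)
      (h := (N.loop α).periodicPart) (c := 0) fun θ => ?_).symm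
    change M.toFun θ • (α : EuclideanSpace ℝ (Fin n)) - θ • (α : EuclideanSpace ℝ (Fin n)) =
      (M.toFun θ - N.toFun θ) • (α : EuclideanSpace ℝ (Fin n)) +
        (N.toFun θ • (α : EuclideanSpace ℝ (Fin n)) - θ • (α : EuclideanSpace ℝ (Fin n))) + 0
    rw [sub_smul]
    abel
  rw [← hg, adWeyl_apply, weyl_vec_conj]
  suffices hint : (∫ θ in (0)..(2 * π), inner ℝ (f θ) (deriv g.toFun θ)) =
      ∫ θ in (0)..(2 * π), inner ℝ (f θ - c)
        (deriv M.toFun θ • (α : EuclideanSpace ℝ (Fin n))) by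
    rw [hint]
  have hd : ∀ θ, deriv g.toFun θ =
      (deriv M.toFun θ - deriv N.toFun θ) • (α : EuclideanSpace ℝ (Fin n)) := fun θ =>
    (((M.hasDerivAt θ).sub (N.hasDerivAt θ)).smul_const _).deriv
  -- The correction by `c` carries the factor `M' - N'`, whose integral over a period vanishes
  -- because both functions increase by `2π`.
  have hpt : ∀ θ, inner ℝ (f θ) (deriv g.toFun θ) =
      inner ℝ (f θ - c) (deriv M.toFun θ • (α : EuclideanSpace ℝ (Fin n))) +
        (deriv M.toFun θ - deriv N.toFun θ) * inner ℝ c (α : EuclideanSpace ℝ (Fin n)) := by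
    intro θ
    rw [hd, real_inner_smul_right, real_inner_smul_right, inner_sub_left]
    by_cases hθ : Circle.exp θ ∈ Circle.exp '' Set.Ioo a b
    · rw [N.deriv_eq_zero_of_mem hb hθ]
      ring
    · rw [hf θ hθ]
      ring
  simp only [hpt]
  have hM := M.continuous_deriv
  have hN := N.continuous_deriv
  have hfc := f.smooth.continuous
  rw [intervalIntegral.integral_add (Continuous.intervalIntegrable (by fun_prop) _ _)
    (Continuous.intervalIntegrable (by fun_prop) _ _), intervalIntegral.integral_mul_const,
    intervalIntegral.integral_sub (hM.intervalIntegrable _ _) (hN.intervalIntegrable _ _),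
    intervalIntegral.integral_eq_sub_of_hasDerivAt (fun θ _ => M.hasDerivAt θ)
      (hM.intervalIntegrable _ _),
    intervalIntegral.integral_eq_sub_of_hasDerivAt (fun θ _ => N.hasDerivAt θ)
      (hN.intervalIntegrable _ _)]
  have h1 := M.map_add_two_pi 0
  have h2 := N.map_add_two_pi 0
  rw [zero_add] at h1 h2
  rw [h1, h2]
  ring

theorem isFreeAction_stepAction (hab : a < b) (hb : b < a + 2 * π)
    (M : StepFunction (Circle.exp '' Set.Ioo a b))
    (N : StepFunction (Circle.exp '' Set.Ioo b (a + 2 * π))) :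
    IsFreeAction (stepAction (L := L) M N) := by
  intro α hα x hx
  refine Subtype.ext (eq_zero_of_intertwines hab hb M (α := (α : EuclideanSpace ℝ (Fin n)))
    (by simpa using hα) x.2 fun f hf => ?_)
  have h := congrArg Subtype.val (hx ⟨weyl f.vec, weyl_mem_currentAlgebra hf⟩)
  have h' : (x : Fock (OneParticle n) →L[ℂ] Fock (OneParticle n)) * weyl f.vec =
      adWeyl (M.vec α - N.vec α) (weyl f.vec) * x := by
    rw [← coe_stepAction M N α ⟨weyl f.vec, weyl_mem_currentAlgebra hf⟩]
    exact h
  rw [h', adWeyl_step_weyl hb M N α hf, smul_mul_assoc]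
  simp only [sub_zero]

/-- If `β_g` were trivial for some `g ≠ 0`, then `a = 1` would satisfy the intertwining relation and
freeness would give `1 = 0`, contradicting that the vacuum `e^0` has norm one. -/
theorem injective_of_isFreeAction {n : ℕ} {G : Type*} [AddGroup G] {I : Set Circle}
    {β : Multiplicative G →* (Alg (currentAlgebra n I) ≃⋆ₐ[ℂ] Alg (currentAlgebra n I))}
    (hβ : IsFreeAction β) : Function.Injective β := by
  rw [injective_iff_map_eq_one]
  intro g hg
  by_contra hne
  have h := hβ g.toAdd (fun h0 => hne (by rw [← ofAdd_toAdd g, h0]; rfl)) 1 fun x => by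
    rw [ofAdd_toAdd, hg, one_mul, mul_one]
    rfl
  have h1 := congrArg Subtype.val h
  change (1 : Fock (OneParticle n) →L[ℂ] Fock (OneParticle n)) = 0 at h1
  have h2 := congrArg (fun X => X (coherent (0 : OneParticle n))) h1
  change coherent (0 : OneParticle n) = 0 at h2
  have h3 := inner_coherent (0 : OneParticle n) 0
  rw [h2, inner_zero_left, inner_zero_left, Complex.exp_zero] at h3
  exact zero_ne_one h3

theorem twistedTranslation_apply {G K : Type*} [AddCommGroup G] [NormedAddCommGroup K]
    [InnerProductSpace ℂ K] [CompleteSpace K] (σ : G → G → Circle) (g : G) (ξ : Ell2 G K) (q : G) :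
    twistedTranslation σ g ξ q = (σ g (q - g) : ℂ) • ξ (q - g) := rfl

/-- The unitary identifying the local algebra of the lattice net with a crossed product. -/
def crossedUnitary {I : Set Circle} (M : StepFunction I) (c : L → Circle) :
    LatticeSpace L ≃ₗᵢ[ℂ] Ell2 L (Fock (OneParticle n)) :=
  Unitary.linearIsometryEquiv (diagUnitary fun q => TorusLoop.phaseWeyl (c q) (-M.vec q))

theorem crossedUnitary_apply {I : Set Circle} (M : StepFunction I) (c : L → Circle)
    (ξ : LatticeSpace L) (q : L) :
    crossedUnitary M c ξ q = (c q : ℂ) • weyl (-M.vec q) (ξ q) := rfl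

theorem conj_eq_of_intertwines {H K : Type*} [NormedAddCommGroup H] [InnerProductSpace ℂ H]
    [CompleteSpace H] [NormedAddCommGroup K] [InnerProductSpace ℂ K] [CompleteSpace K]
    (V : H ≃ₗᵢ[ℂ] K) {X : H →L[ℂ] H} {Y : K →L[ℂ] K} (h : ∀ ξ, V (X ξ) = Y (V ξ)) :
    V.conjStarAlgEquiv X = Y := by
  ext1 η
  rw [LinearIsometryEquiv.conjStarAlgEquiv_apply_apply, h, V.apply_symm_apply]

/-- At charge `q` the conjugations combine to `Ad W(-m_q + n_q)`, which is `β_{-q}`; the phases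
`c_q` drop out. -/
theorem crossedUnitary_conj_chargeRep {I J : Set Circle} (M : StepFunction I)
    (N : StepFunction J) (c : L → Circle) (x : Alg (currentAlgebra n I)) :
    (crossedUnitary M c).conjStarAlgEquiv (chargeRep N.vec
      (x : Fock (OneParticle n) →L[ℂ] Fock (OneParticle n))) = crossedRep (stepAction M N) x := by
  refine conj_eq_of_intertwines _ fun ξ => ?_
  refine lp.ext (funext fun q => ?_)
  rw [crossedUnitary_apply, chargeRep_apply, crossedRep, diag_apply, coe_stepAction,
    crossedUnitary_apply, map_smul]
  have e : M.vec (-q) - N.vec (-q) = -M.vec q + N.vec q := by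
    rw [← M.vecHom_apply, ← N.vecHom_apply, map_neg, map_neg, M.vecHom_apply, N.vecHom_apply]
    abel
  rw [e, ← adWeyl_adWeyl]
  generalize adWeyl (N.vec q) (x : Fock (OneParticle n) →L[ℂ] Fock (OneParticle n)) = y
  have h2 : weyl (-M.vec q) * y = adWeyl (-M.vec q) y * weyl (-M.vec q) := by
    rw [adWeyl_apply, mul_assoc, star_weyl, weyl_neg_mul_weyl, mul_one]
  exact congrArg (fun X => (c q : ℂ) • X (ξ q)) h2

/-- By isotropy `W(-m_{α+γ}) W(m_α) = W(-m_γ)` without a phase, so the Weyl operators cancel and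
`hc` matches the scalars that are left. -/
theorem crossedUnitary_conj_op {I : Set Circle} (M : StepFunction I) (c h : L → Circle)
    (σ : L → L → Circle) (ε : L → L → ℤˣ)
    (hc : ∀ α γ, c (α + γ) * (h α * (M.loop α).phase ε (α + γ)) = σ α γ * c γ) (α : L) :
    (crossedUnitary M c).conjStarAlgEquiv ((h α : ℂ) • (M.loop α).op ε) =
      twistedTranslation σ α := by
  refine conj_eq_of_intertwines _ fun ξ => ?_
  refine lp.ext (funext fun q => ?_)
  obtain ⟨γ, rfl⟩ : ∃ γ, q = α + γ := ⟨q - α, by abel⟩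
  have e : α + γ - α = γ := by abel
  have e1 : ((h α : ℂ) • (M.loop α).op ε) ξ (α + γ) =
      (h α : ℂ) • (M.loop α).op ε ξ (α + γ) := rfl
  have e2 : (M.loop α).op ε ξ (α + γ) =
      ((M.loop α).phase ε (α + γ) : ℂ) • weyl (M.vec α) (ξ (α + γ - α)) :=
    TorusLoop.op_apply ε (M.loop α) ξ (α + γ)
  rw [crossedUnitary_apply, e1, e2, twistedTranslation_apply, e,
    crossedUnitary_apply, map_smul, map_smul, smul_smul, smul_smul, smul_smul, ← Circle.coe_mul,
    ← Circle.coe_mul, ← Circle.coe_mul, mul_assoc, hc]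
  have h0 : (inner ℂ (-M.vec (α + γ)) (M.vec α)).im = 0 := by
    rw [inner_neg_left, Complex.neg_im, M.im_inner_vec, neg_zero]
  have h1 := weyl_mul (-M.vec (α + γ)) (M.vec α)
  have h2 : -M.vec (α + γ) + M.vec α = -M.vec γ := by
    rw [M.vec_add]
    abel
  rw [h0, h2, Complex.ofReal_zero, mul_zero, neg_zero, Complex.exp_zero, one_smul] at h1
  exact congrArg (fun X => (σ α γ * c γ : ℂ) • X (ξ γ)) h1

/-- The phases which identify the operators `π(e^{iMα})` with twisted translations. -/
theorem exists_phases [Module.Free ℤ L] (hL : IsEven L) (hε : IsSignCocycle L ε) {I : Set Circle}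
    (M : StepFunction I) (σ : L → L → Circle) (hσ : IsTwoCocycle σ)
    (hσ' : ∀ α γ : L, σ α γ = Circle.exp (π * ip α γ) * σ γ α) :
    ∃ c h : L → Circle, ∀ α γ,
      c (α + γ) * (h α * (M.loop α).phase ε (α + γ)) = σ α γ * c γ := by
  -- The commutators of `σ` and of the cocycle of the step operators are both `(-1)^{⟨α, γ⟩}`, so
  -- the quotient of the two cocycles is symmetric.
  obtain ⟨h, hh⟩ := exists_coboundary_of_symmetric
    (fun α γ => σ α γ * (M.cocycle ε α γ)⁻¹) (fun α β γ => by
      have h1 := hσ α β γ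
      have h2 := M.cocycle_identity hε α β γ
      calc _ = (σ β γ * σ α (β + γ)) * (M.cocycle ε β γ * M.cocycle ε α (β + γ))⁻¹ := by
            rw [mul_inv]; exact mul_mul_mul_comm _ _ _ _
        _ = _ := by rw [h1, h2, mul_inv]; exact mul_mul_mul_comm _ _ _ _) (fun α γ => by
      rw [hσ' α γ, M.cocycle_comm hL hε α γ, mul_inv, mul_mul_mul_comm, mul_inv_cancel, one_mul])
  have h0 : ∀ α γ, σ (α + γ) 0 = σ γ 0 := fun α γ => by
    have := hσ α γ 0
    rw [add_zero, mul_comm] at this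
    exact (mul_left_cancel this).symm
  -- The value of `c` is forced by the required relation with second argument zero once `c` is
  -- normalized to be `1` at zero. The factor `σ γ 0` is independent of `γ` and equals `1` only for
  -- normalized `σ`.
  refine ⟨fun γ => σ γ 0 * (h γ * (M.loop γ).phase ε γ)⁻¹, h, fun α γ => ?_⟩
  have h1 := hh α γ
  have h2 := M.phase_loop_add hε α γ
  simp only
  rw [h0]
  generalize σ γ 0 = s0 at *
  generalize σ α γ = s at *
  generalize M.cocycle ε α γ = τ at *
  generalize (M.loop α).phase ε (α + γ) = t1 at *
  generalize (M.loop γ).phase ε γ = t2 at *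
  generalize (M.loop (α + γ)).phase ε (α + γ) = t3 at *
  have h3 : h (α + γ) * s = h α * h γ * τ := by rw [h1]; group
  have h4 : h (α + γ) * t3 * s * t2⁻¹ = h α * h γ * t1 := by
    have : h (α + γ) * t3 * s = h α * h γ * (τ * t3) := by
      rw [mul_right_comm, h3, mul_assoc]
    rw [this, ← h2, ← mul_assoc, mul_inv_cancel_right]
  rw [mul_assoc, mul_left_comm s]
  congr 1
  rw [inv_mul_eq_iff_eq_mul, eq_comm, ← mul_assoc, mul_inv, ← mul_assoc,
    mul_right_comm _ (h γ)⁻¹, h4, mul_right_comm, mul_inv_cancel_right]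

end Action

/-! ### Isomorphism with the neutral algebra and with the crossed product -/

section Main

variable {n : ℕ} {L : Submodule ℤ (EuclideanSpace ℝ (Fin n))} {ε : L → L → ℤˣ} {a b : ℝ}

/-- The identification of the current algebra with the algebra of neutral localized loops. -/
theorem exists_currentAlgebra_equiv [DiscreteTopology L] (hL : IsEven L) (hε : IsSignCocycle L ε)
    (hab : a < b) (hb : b < a + 2 * Real.pi)
    (N : StepFunction (Circle.exp '' Set.Ioo b (a + 2 * Real.pi))) :
    ∃ Φ : Alg (currentAlgebra n (Circle.exp '' Set.Ioo a b)) ≃⋆ₐ[ℂ]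
        Alg (neutralAlgebra ε (Circle.exp '' Set.Ioo a b)),
      ∀ x : Alg (currentAlgebra n (Circle.exp '' Set.Ioo a b)),
        (Φ x : LatticeSpace L →L[ℂ] LatticeSpace L) =
          chargeRep N.vec (x : Fock (OneParticle n) →L[ℂ] Fock (OneParticle n)) :=
  ⟨restrictEquiv _ _ (chargeRep N.vec) (chargeRep_injective _)
      (fun x hx => (mem_neutralAlgebra_iff hL hε hab hb N).2 ⟨x, hx, rfl⟩)
      (fun _ hy => (mem_neutralAlgebra_iff hL hε hab hb N).1 hy),
    coe_restrictEquiv _ _ _ _ _ _⟩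

theorem latticeAlgebra_eq (hε : IsSignCocycle L ε) {I : Set Circle} (M : StepFunction I) :
    latticeAlgebra ε I =
      vnGen ((neutralAlgebra ε I : Set (LatticeSpace L →L[ℂ] LatticeSpace L)) ∪
        Set.range fun α => (M.loop α).op ε) :=
  le_antisymm
    (latticeAlgebra_le hε M _ (fun _ hx => mem_vnGen_of_mem (Or.inl hx))
      fun α => mem_vnGen_of_mem (Or.inr ⟨α, rfl⟩))
    (vnGen_le (Set.union_subset (neutralAlgebra_le ε I) (by
      rintro _ ⟨α, rfl⟩
      exact mem_vnGen_of_mem ⟨M.loop α, M.loop_supportedIn α, rfl⟩)))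

/-- A von Neumann algebra generated by a represented algebra and a family of operators is mapped
onto a crossed product if the generators are mapped to the generators, up to phases. -/
theorem image_vnGen_eq_crossedProduct {H K G : Type*} [NormedAddCommGroup H]
    [InnerProductSpace ℂ H] [CompleteSpace H] [NormedAddCommGroup K] [InnerProductSpace ℂ K]
    [CompleteSpace K] [AddCommGroup G] {A : VonNeumannAlgebra K}
    (β : Multiplicative G →* (Alg A ≃⋆ₐ[ℂ] Alg A)) (σ : G → G → Circle)
    (φ : (H →L[ℂ] H) ≃⋆ₐ[ℂ] (Ell2 G K →L[ℂ] Ell2 G K)) {S : Set (H →L[ℂ] H)}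
    {T : G → H →L[ℂ] H} {h : G → Circle} (hS : φ '' S = Set.range (crossedRep β))
    (hT : ∀ g, φ ((h g : ℂ) • T g) = twistedTranslation σ g) :
    φ '' (vnGen (S ∪ Set.range T) : Set (H →L[ℂ] H)) = crossedProduct β σ := by
  have hT' : ∀ g, (h g : ℂ) • φ (T g) = twistedTranslation σ g := fun g =>
    (φ.map_smul' _ _).symm.trans (hT g)
  rw [image_vnGen, Set.image_union, hS]
  refine congrArg SetLike.coe (le_antisymm (vnGen_le (Set.union_subset ?_ ?_))
    (vnGen_le (Set.union_subset ?_ ?_)))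
  · exact fun y hy => mem_vnGen_of_mem (Or.inl hy)
  · rintro _ ⟨_, ⟨g, rfl⟩, rfl⟩
    refine mem_of_circle_smul_mem _ (z := h g) ?_
    rw [hT']
    exact mem_vnGen_of_mem (Or.inr ⟨g, rfl⟩)
  · exact fun y hy => mem_vnGen_of_mem (Or.inl hy)
  · rintro _ ⟨g, rfl⟩
    rw [← hT']
    exact smul_mem_vn _ _ (mem_vnGen_of_mem (Or.inr ⟨T g, ⟨g, rfl⟩, rfl⟩))

theorem image_latticeAlgebra [DiscreteTopology L] (hL : IsEven L) (hε : IsSignCocycle L ε)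
    (hab : a < b) (hb : b < a + 2 * Real.pi) (M : StepFunction (Circle.exp '' Set.Ioo a b))
    (N : StepFunction (Circle.exp '' Set.Ioo b (a + 2 * Real.pi))) {c h : L → Circle}
    {σ : L → L → Circle}
    (hc : ∀ α γ, c (α + γ) * (h α * (M.loop α).phase ε (α + γ)) = σ α γ * c γ) :
    (crossedUnitary M c).conjStarAlgEquiv ''
        (latticeAlgebra ε (Circle.exp '' Set.Ioo a b) :
          Set (LatticeSpace L →L[ℂ] LatticeSpace L)) =
      crossedProduct (stepAction M N) σ := by
  rw [latticeAlgebra_eq hε M]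
  refine image_vnGen_eq_crossedProduct (stepAction M N) σ _ ?_
    (crossedUnitary_conj_op M c h σ ε hc)
  refine Set.Subset.antisymm ?_ ?_
  · rintro _ ⟨y, hy, rfl⟩
    obtain ⟨x, hx, rfl⟩ := (mem_neutralAlgebra_iff hL hε hab hb N).1 hy
    exact ⟨⟨x, hx⟩, (crossedUnitary_conj_chargeRep M N c ⟨x, hx⟩).symm⟩
  · rintro _ ⟨x, rfl⟩
    exact ⟨_, (mem_neutralAlgebra_iff hL hε hab hb N).2 ⟨x, x.2, rfl⟩,
      crossedUnitary_conj_chargeRep M N c x⟩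

end Main

end LatticeNet

end

theorem mainTheorem8 {n : ℕ} (L : Submodule ℤ (EuclideanSpace ℝ (Fin n))) [DiscreteTopology L]
    [IsZLattice ℝ L] (hL : IsEven L) (ε : L → L → ℤˣ) (hε : IsSignCocycle L ε)
    (I : Set Circle) (hI : IsProperInterval I) :
    Nonempty (StepFunction I) ∧
    -- the current algebra is identified with the algebra of the localized loops of winding number
    -- zero, by restriction of the latter to the charge zero subspace
    ∃ Φ : Alg (currentAlgebra n I) ≃⋆ₐ[ℂ] Alg (neutralAlgebra ε I),
      (∀ (x : Alg (currentAlgebra n I)) (ξ : Fock (OneParticle n)),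
        (Φ x : LatticeSpace L →L[ℂ] LatticeSpace L) (lp.single 2 0 ξ) =
          lp.single 2 0 ((x : Fock (OneParticle n) →L[ℂ] Fock (OneParticle n)) ξ)) ∧
      ∀ M : StepFunction I,
        ∃ β : Multiplicative L →* (Alg (currentAlgebra n I) ≃⋆ₐ[ℂ] Alg (currentAlgebra n I)),
          -- `β α` is `Ad` of the loop `e^{iMα}`, which has winding number `α`
          (∀ (α : L) (x : Alg (currentAlgebra n I)),
            (Φ (β (.ofAdd α) x) : LatticeSpace L →L[ℂ] LatticeSpace L) =
              (M.loop α).op ε * (Φ x : LatticeSpace L →L[ℂ] LatticeSpace L) *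
                star ((M.loop α).op ε)) ∧
          -- action on Weyl operators
          (∀ (α : L) (f : Loop n) (c : EuclideanSpace ℝ (Fin n)),
            (∀ θ : ℝ, Circle.exp θ ∉ I → f θ = c) →
            ∃ hf : weyl f.vec ∈ (currentAlgebra n I).toStarSubalgebra,
              (β (.ofAdd α) ⟨weyl f.vec, hf⟩ :
                  Fock (OneParticle n) →L[ℂ] Fock (OneParticle n)) =
                (Circle.exp ((2 * Real.pi)⁻¹ * ∫ θ in (0)..(2 * Real.pi), inner ℝ (f θ - c)
                  (deriv M.toFun θ • (α : EuclideanSpace ℝ (Fin n)))) : ℂ) • weyl f.vec) ∧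
          -- the action is free and faithful
          IsFreeAction β ∧ Function.Injective β ∧
          -- the lattice algebra is generated by the current algebra and the implementing unitaries
          (∀ (ι : Type) (b : Module.Basis ι ℤ L),
            latticeAlgebra ε I =
              vnGen ((neutralAlgebra ε I : Set (LatticeSpace L →L[ℂ] LatticeSpace L)) ∪
                Set.range fun i => (M.loop (b i)).op ε)) ∧
          -- it is the crossed product by the action `β`
          ∀ σ : L → L → Circle, IsTwoCocycle σ →
            (∀ α γ : L, σ α γ =
              Circle.exp (Real.pi * inner ℝ (α : EuclideanSpace ℝ (Fin n)) γ) * σ γ α) →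
            ∃ (h : L → Circle)
              (V : LatticeSpace L ≃ₗᵢ[ℂ] Ell2 L (Fock (OneParticle n))),
              V.conjStarAlgEquiv ''
                  (latticeAlgebra ε I : Set (LatticeSpace L →L[ℂ] LatticeSpace L)) =
                crossedProduct β σ ∧
              (∀ x : Alg (currentAlgebra n I),
                V.conjStarAlgEquiv (Φ x : LatticeSpace L →L[ℂ] LatticeSpace L) =
                  crossedRep β x) ∧
              ∀ α : L, V.conjStarAlgEquiv ((h α : ℂ) • (M.loop α).op ε) =
                twistedTranslation σ α := by
  obtain ⟨a, b, hab, hb, rfl⟩ := hI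
  -- The auxiliary step function of the complementary arc is chosen once, before `Φ` and
  -- independently of `M`.
  have hN := nonempty_stepFunction (I := Circle.exp '' Set.Ioo b (a + 2 * Real.pi))
    ⟨b, a + 2 * Real.pi, hb, by linarith, rfl⟩
  obtain ⟨N⟩ := hN
  -- Freeness of `L` as an abelian group is what splits the extension defined by the quotient
  -- cocycle.
  have hfree : Module.Free ℤ L := ZLattice.module_free ℝ L
  have hequiv := exists_currentAlgebra_equiv hL hε hab hb N
  obtain ⟨Φ, hΦ⟩ := hequiv
  refine ⟨nonempty_stepFunction ⟨a, b, hab, hb, rfl⟩, Φ, fun x ξ => ?_, fun M => ?_⟩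
  · rw [hΦ]
    exact chargeRep_single _ N.vecHom.map_zero _ _
  refine ⟨stepAction M N, fun α x => ?_, fun α f c hf => ?_, isFreeAction_stepAction hab hb M N,
    injective_of_isFreeAction (isFreeAction_stepAction hab hb M N),
    fun ι e => latticeAlgebra_eq_of_basis hε M e, fun σ hσ hσ' => ?_⟩
  · rw [hΦ, hΦ, coe_stepAction, chargeRep_stepAction]
  · refine ⟨weyl_mem_currentAlgebra_of_const hf, ?_⟩
    rw [coe_stepAction]
    exact adWeyl_step_weyl hb M N α hf
  · have hphases := exists_phases hL hε M σ hσ hσ'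
    obtain ⟨c, h, hc⟩ := hphases
    refine ⟨h, crossedUnitary M c, image_latticeAlgebra hL hε hab hb M N hc, fun x => ?_,
      crossedUnitary_conj_op M c h σ ε hc⟩
    rw [hΦ]
    exact crossedUnitary_conj_chargeRep M N c x
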